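/- **Setting.** Let $d\in\mathbb N$. Let $\mathcal M$ be the space of 1-currents on $\mathbb R^d$ that are continuous for the uniform norm, i.e. of finite $\mathbb R^d$-valued Borel measures acting on $\theta\in C_b(\mathbb R^d;\mathbb R^d)$ by integration; equivalently, $\mathcal M$ consists of those $\xi$ in the dual of $C_b(\mathbb R^d;\mathbb R^d)$ such that for every $\varepsilon>0$ there is a compact $K\subset\mathbb R^d$ with $|\xi(\theta)|\le\varepsilon\|\theta\|_\infty$ whenever $\theta=0$ on $K$. Put $|\xi|_{\mathcal M}=\sup_{\|\theta\|_\infty\le1}|\xi(\theta)|$ and $\|\xi\|=\sup\{\xi(\theta):\|\theta\|_\infty+\mathrm{Lip}(\theta)\le1\}$, and let $\mathcal M_w$ be $\mathcal M$ with the metric $\|\xi-\xi'\|$. Let $B:\mathcal M_w\to C_b^2(\mathbb R^d;\mathbb R^d)$ be a continuous map with values in divergence-free vector fields such that, for a constant $C_B$ and all $\xi,\xi'\in\mathcal M$, $$\|B(\xi)\|_{C_b^2}\le C_B(\|\xi\|+1),\quad \|B(\xi)-B(\xi')\|_\infty\le C_B\|\xi-\xi'\|,\quad \|DB(\xi)-DB(\xi')\|_\infty\le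 C_B\|\xi-\xi'\|.$$ Let $\xi_0\in\mathcal M$ and let $J\subset[0,\infty)$ be an interval containing $0$. * For a time-dependent field $b_t\in C_b^2(\mathbb R^d;\mathbb R^d)$, $t\in J$, a *current-valued solution* on $J$ of the linear PDE $\partial_t\xi+\operatorname{div}(b\,\xi)=(\xi\cdot\nabla)b$, $\xi(0)=\xi_0$, is a map $\xi\in C(J;\mathcal M_w)$ with $\sup_{0\le s\le t}|\xi_s|_{\mathcal M}<\infty$ for each $t\in J$ such that, for all $\theta\in C_b^1(\mathbb R^d;\mathbb R^d)$ and $t\in J$, the integrands below are integrable on $[0,t]$ and $$\xi_t(\theta)-\int_0^t\xi_s(D\theta\cdot b_s)\,ds=\xi_0(\theta)+\int_0^t\xi_s\big(Db_s^{T}\cdot\theta\big)\,ds .$$ A current-valued solution of the nonlinear PDE $$\partial_t\xi+\operatorname{div}(B(\xi)\xi)=(\xi\cdot\nabla)B(\xi),\qquad \xi(0)=\xi_0,\tag{1}$$ is a $\xi$ satisfying this with $b_s=B(\xi_s)$. * Let $\varphi^{t,b}$ be the flow of $X_t'=b(t,X_t)$, and for a $C^1$ map $\varphi$ with bounded derivative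 let $(\varphi_\sharp\xi)(\theta)=\xi\big(D\varphi(\cdot)^T\theta(\varphi(\cdot))\big)$. A solution on $J$ of the *flow equation* is a $\xi\in C(J;\mathcal M_w)$ with $$\xi_t=\varphi^{t,B(\xi)}_\sharp\xi_0\quad\text{for all }t\in J.\tag{2}$$ * $T_{\xi_0}\in[0,\infty]$ denotes the supremum of all $T>0$ such that (2) has exactly one solution on $[0,T]$. **Theorem.** For every $\xi_0\in\mathcal M$: 1. There is $T>0$ such that (1) has exactly one current-valued solution on $[0,T]$. 2. $T_{\xi_0}>0$, and there is a map $\xi:[0,T_{\xi_0})\to\mathcal M$ which is both a current-valued solution of (1) and a solution of (2) on $[0,T_{\xi_0})$, and which is the unique maximal solution of each of them: if $\eta$ is a solution of (1), or a solution of (2), on an interval $J\subset[0,\infty)$ containing $0$, then $J\subset[0,T_{\xi_0})$ and $\eta=\xi$ on $J$. 3. For every $T>0$ and every $b\in C([0,T];C_b^2(\mathbb R^d;\mathbb R^d))$, a map $\xi:[0,T]\to\mathcal M$ is a current-valued solution of the linear PDE with drift $b$ on $[0,T]$ if and only if $\xi\in C([0,T];\mathcal M_w)$ and $\xi_t=\varphi^{t,b}_\sharp\xi_0$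 for all $t\in[0,T]$. -/

import Mathlib

open Set Filter Topology MeasureTheory
open scoped BoundedContinuousFunction NNReal

noncomputable section

/-- The Euclidean space `ℝ^d`. -/
abbrev Euc (d : ℕ) : Type := EuclideanSpace ℝ (Fin d)

/-- A bounded continuous vector field from a continuous function with a bound. -/
def bddField {d : ℕ} (f : Euc d → Euc d) (hf : Continuous f) (hb : ∃ C : ℝ, ∀ x, ‖f x‖ ≤ C) :
    Euc d →ᵇ Euc d where
  toFun := f
  continuous_toFun := hf
  map_bounded' := by
    obtain ⟨C, hC⟩ := hb
    exact ⟨C + C, fun x y => (dist_le_norm_add_norm _ _).trans (add_le_add (hC x) (hC y))⟩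

/-! ### Currents -/

/-- The dual space of `C_b(E; E)`, with the operator norm. -/
abbrev FieldDual (E : Type) [NormedAddCommGroup E] [NormedSpace ℝ E] : Type :=
  StrongDual ℝ (E →ᵇ E)

/-- The Banach space `𝓜` of 1-currents on `ℝ^d` that are continuous for the uniform norm, acting on
`C_b(ℝ^d; ℝ^d)`. A current is determined by its values on compactly supported fields; within the
dual of `C_b` this is the tightness condition below, so that `𝓜` is the space of finite
`ℝ^d`-valued Borel measures, acting by integration. -/
def Current (d : ℕ) : Submodule ℝ (FieldDual (Euc d)) where
  carrier := {ξ | ∀ ε : ℝ, 0 < ε → ∃ K : Set (Euc d), IsCompact K ∧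
    ∀ θ : Euc d →ᵇ Euc d, (∀ x ∈ K, θ x = 0) → |ξ θ| ≤ ε * ‖θ‖}
  zero_mem' := fun ε hε => ⟨∅, isCompact_empty, fun θ _ => by simp; positivity⟩
  add_mem' := by
    intro ξ η hξ hη ε hε
    obtain ⟨K, hK, h1⟩ := hξ (ε / 2) (half_pos hε)
    obtain ⟨L, hL, h2⟩ := hη (ε / 2) (half_pos hε)
    refine ⟨K ∪ L, hK.union hL, fun θ hθ => ?_⟩
    have a := h1 θ fun x hx => hθ x (Or.inl hx)
    have b := h2 θ fun x hx => hθ x (Or.inr hx)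
    have c := abs_add_le (ξ θ) (η θ)
    simp only [add_apply]
    linarith
  smul_mem' := by
    intro c ξ hξ ε hε
    obtain ⟨K, hK, h1⟩ := hξ (ε / (|c| + 1)) (by positivity)
    refine ⟨K, hK, fun θ hθ => ?_⟩
    have a := h1 θ hθ
    simp only [smul_apply, smul_eq_mul, abs_mul]
    calc |c| * |ξ θ| ≤ (|c| + 1) * (ε / (|c| + 1) * ‖θ‖) := by gcongr; linarith
      _ = ε * ‖θ‖ := by field_simp

/-- The weak norm `‖ξ‖ = sup {ξ(θ) : ‖θ‖_∞ + Lip(θ) ≤ 1}`. -/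
def weakNorm {d : ℕ} (ξ : Current d) : ℝ :=
  sSup {r : ℝ | ∃ θ : Euc d →ᵇ Euc d, ∃ L : ℝ≥0, LipschitzWith L θ ∧ ‖θ‖ + L ≤ 1 ∧ r = ξ.1 θ}

/-- `ξ ∈ C(J; 𝓜_w)`: continuity in time for the metric `d(ξ, ξ') = ‖ξ - ξ'‖`. -/
def WeaklyContinuousOn {d : ℕ} (ξ : ℝ → Current d) (J : Set ℝ) : Prop :=
  ∀ t ∈ J, Tendsto (fun s => weakNorm (ξ s - ξ t)) (𝓝[J] t) (𝓝 0)

/-! ### Vector fields of class `C_b^k` -/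

/-- `‖f‖_{C_b^k} ≤ C`. -/
def CbNormLE {d : ℕ} (k : ℕ) (f : Euc d → Euc d) (C : ℝ) : Prop :=
  ∀ j ≤ k, ∀ x, ‖iteratedFDeriv ℝ j f x‖ ≤ C

/-- The space `C_b^k(ℝ^d; ℝ^d)`. -/
structure CbField (k d : ℕ) where
  toFun : Euc d → Euc d
  contDiff : ContDiff ℝ k toFun
  bdd : ∃ C : ℝ, CbNormLE k toFun C

instance cbFieldCoeFun {k d : ℕ} : CoeFun (CbField k d) (fun _ => Euc d → Euc d) := ⟨CbField.toFun⟩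

namespace CbField

variable {k d : ℕ}

theorem bounded (f : CbField k d) : ∃ C : ℝ, ∀ x, ‖f x‖ ≤ C := by
  obtain ⟨C, hC⟩ := f.bdd
  exact ⟨C, fun x => by simpa using hC 0 (Nat.zero_le _) x⟩

theorem bounded_fderiv (f : CbField k d) (hk : 1 ≤ k) : ∃ C : ℝ, ∀ x, ‖fderiv ℝ f x‖ ≤ C := by
  obtain ⟨C, hC⟩ := f.bdd
  exact ⟨C, fun x => by simpa [norm_iteratedFDeriv_one] using hC 1 hk x⟩

theorem continuous_fderiv (f : CbField k d) (hk : 1 ≤ k) : Continuous (fderiv ℝ f) :=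
  f.contDiff.continuous_fderiv (by
    have : k ≠ 0 := by omega
    exact_mod_cast this)

/-- An element of `C_b^k` as an element of `C_b`. -/
def toBdd (f : CbField k d) : Euc d →ᵇ Euc d := bddField f f.contDiff.continuous f.bounded

end CbField

/-- The field `Dθ · b`. -/
def advect {d : ℕ} (θ : CbField 1 d) (b : CbField 2 d) : Euc d →ᵇ Euc d :=
  bddField (fun x => fderiv ℝ θ x (b x))
    ((θ.continuous_fderiv le_rfl).clm_apply b.contDiff.continuous) (by
      obtain ⟨C, hC⟩ := θ.bounded_fderiv le_rfl
      obtain ⟨D, hD⟩ := b.bounded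
      exact ⟨C * D, fun x => ((fderiv ℝ θ x).le_opNorm _).trans
        (mul_le_mul (hC x) (hD x) (norm_nonneg _) ((norm_nonneg _).trans (hC x)))⟩)

/-- The field `(Db)ᵀ · θ`. -/
def stretch {d : ℕ} (b : CbField 2 d) (θ : CbField 1 d) : Euc d →ᵇ Euc d :=
  bddField (fun x => ContinuousLinearMap.adjoint (fderiv ℝ b x) (θ x))
    ((ContinuousLinearMap.adjoint.continuous.comp
      (b.continuous_fderiv one_le_two)).clm_apply θ.contDiff.continuous) (by
      obtain ⟨C, hC⟩ := b.bounded_fderiv one_le_two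
      obtain ⟨D, hD⟩ := θ.bounded
      refine ⟨C * D, fun x => (ContinuousLinearMap.le_opNorm _ _).trans ?_⟩
      rw [LinearIsometryEquiv.norm_map]
      exact mul_le_mul (hC x) (hD x) (norm_nonneg _) ((norm_nonneg _).trans (hC x)))

/-- `div b = 0`. -/
def DivergenceFree {d : ℕ} (b : Euc d → Euc d) : Prop :=
  ∀ x, ∑ i : Fin d, fderiv ℝ b x (EuclideanSpace.single i 1) i = 0

/-! ### Push-forward -/

/-- `C^1` maps of `ℝ^d` with bounded derivative. -/
structure C1Map (d : ℕ) where
  toFun : Euc d → Euc d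
  contDiff : ContDiff ℝ 1 toFun
  bdd : ∃ C : ℝ, ∀ x, ‖fderiv ℝ toFun x‖ ≤ C

instance c1MapCoeFun {d : ℕ} : CoeFun (C1Map d) (fun _ => Euc d → Euc d) := ⟨C1Map.toFun⟩

/-- The push-forward of test fields, `(φ_♯ θ)(x) = Dφ(x)ᵀ θ(φ(x))`. -/
def pushField {d : ℕ} (φ : C1Map d) (θ : Euc d →ᵇ Euc d) : Euc d →ᵇ Euc d :=
  bddField (fun x => ContinuousLinearMap.adjoint (fderiv ℝ φ x) (θ (φ x)))
    ((ContinuousLinearMap.adjoint.continuous.comp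
      (φ.contDiff.continuous_fderiv one_ne_zero)).clm_apply
        (θ.continuous.comp φ.contDiff.continuous)) (by
      obtain ⟨C, hC⟩ := φ.bdd
      refine ⟨C * ‖θ‖, fun x => (ContinuousLinearMap.le_opNorm _ _).trans ?_⟩
      rw [LinearIsometryEquiv.norm_map]
      exact mul_le_mul (hC x) (θ.norm_coe_le_norm _) (norm_nonneg _)
        ((norm_nonneg _).trans (hC x)))

theorem pushField_apply {d : ℕ} (φ : C1Map d) (θ : Euc d →ᵇ Euc d) (x : Euc d) :
    pushField φ θ x = ContinuousLinearMap.adjoint (fderiv ℝ φ x) (θ (φ x)) := rfl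

theorem norm_pushField_le {d : ℕ} (φ : C1Map d) :
    ∃ C : ℝ, 0 ≤ C ∧ ∀ θ : Euc d →ᵇ Euc d, ‖pushField φ θ‖ ≤ C * ‖θ‖ := by
  obtain ⟨C, hC⟩ := φ.bdd
  have h0 : 0 ≤ C := (norm_nonneg _).trans (hC 0)
  refine ⟨C, h0, fun θ => (BoundedContinuousFunction.norm_le (by positivity)).2 fun x => ?_⟩
  rw [pushField_apply]
  refine (ContinuousLinearMap.le_opNorm _ _).trans ?_
  rw [LinearIsometryEquiv.norm_map]
  exact mul_le_mul (hC x) (θ.norm_coe_le_norm _) (norm_nonneg _) h0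

/-- The push-forward of currents, `(φ_♯ ξ)(θ) = ξ(φ_♯ θ)`. -/
def pushCurrent {d : ℕ} (φ : C1Map d) (ξ : Current d) : Current d :=
  ⟨LinearMap.mkContinuousOfExistsBound
    { toFun := fun θ => ξ.1 (pushField φ θ)
      map_add' := fun θ η => by
        rw [← map_add]; congr 1; ext1 x; simp [pushField_apply]
      map_smul' := fun c θ => by
        rw [RingHom.id_apply, ← map_smul]; congr 1; ext1 x; simp [pushField_apply] } (by
      obtain ⟨C, h0, hC⟩ := norm_pushField_le φ
      refine ⟨‖ξ.1‖ * C, fun θ => (ξ.1.le_opNorm _).trans ?_⟩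
      rw [mul_assoc]
      exact mul_le_mul_of_nonneg_left (hC θ) (norm_nonneg _)), by
    intro ε hε
    obtain ⟨C, h0, hC⟩ := norm_pushField_le φ
    obtain ⟨K, hK, h⟩ := ξ.2 (ε / (C + 1)) (by positivity)
    refine ⟨φ '' K, hK.image φ.contDiff.continuous, fun θ hθ => ?_⟩
    have h1 := h (pushField φ θ) fun x hx => by
      rw [pushField_apply, hθ _ (mem_image_of_mem _ hx), map_zero]
    refine h1.trans ?_
    calc ε / (C + 1) * ‖pushField φ θ‖ ≤ ε / (C + 1) * ((C + 1) * ‖θ‖) := by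
          have := hC θ
          gcongr
          nlinarith [norm_nonneg θ]
      _ = ε * ‖θ‖ := by field_simp⟩

/-! ### The drift -/

/-- The assumptions on the drift `B : 𝓜_w → C_b^2`: continuity, linear growth in the weak norm, and
Lipschitz continuity of `B` and `DB` in the weak norm. -/
structure IsDrift {d : ℕ} (B : Current d → CbField 2 d) (C_B : ℝ) : Prop where
  continuous : ∀ ξ, ∀ ε : ℝ, 0 < ε → ∃ δ : ℝ, 0 < δ ∧ ∀ ξ', weakNorm (ξ' - ξ) < δ →
    CbNormLE 2 (fun x => B ξ' x - B ξ x) ε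
  growth : ∀ ξ, CbNormLE 2 (B ξ) (C_B * (weakNorm ξ + 1))
  lipschitz : ∀ ξ ξ' x, ‖B ξ x - B ξ' x‖ ≤ C_B * weakNorm (ξ - ξ')
  lipschitz_fderiv : ∀ ξ ξ' x,
    ‖fderiv ℝ (B ξ) x - fderiv ℝ (B ξ') x‖ ≤ C_B * weakNorm (ξ - ξ')

/-- `b ∈ C(J; C_b^2)`. -/
def CbContinuousOn {d : ℕ} (b : ℝ → CbField 2 d) (J : Set ℝ) : Prop :=
  ∀ t ∈ J, ∀ ε : ℝ, 0 < ε → ∀ᶠ s in 𝓝[J] t, CbNormLE 2 (fun x => b s x - b t x) ε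

/-! ### Lagrangian and Eulerian formulations -/

/-- `φ t = φ^{t,b}` is the flow of the equation `X' = b(t, X)` on the time interval `J ∋ 0`. -/
def IsFlow {d : ℕ} (b : ℝ → CbField 2 d) (J : Set ℝ) (φ : ℝ → C1Map d) : Prop :=
  (∀ x, φ 0 x = x) ∧ ∀ t ∈ J, ∀ x, HasDerivWithinAt (fun s => φ s x) (b t (φ t x)) J t

/-- `ξ_t = φ^{t,b}_♯ ξ₀` for `t ∈ J`, in the class `C(J; 𝓜_w)`. -/
structure IsTransported {d : ℕ} (b : ℝ → CbField 2 d) (ξ₀ : Current d) (J : Set ℝ)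
    (ξ : ℝ → Current d) : Prop where
  weaklyContinuous : WeaklyContinuousOn ξ J
  push : ∃ φ : ℝ → C1Map d, IsFlow b J φ ∧ ∀ t ∈ J, ξ t = pushCurrent (φ t) ξ₀

/-- Current-valued weak solutions on `J` of `∂_t ξ + div(b ξ) = (ξ·∇) b`, `ξ(0) = ξ₀`. -/
structure IsLinearWeakSolution {d : ℕ} (b : ℝ → CbField 2 d) (ξ₀ : Current d) (J : Set ℝ)
    (ξ : ℝ → Current d) : Prop where
  weaklyContinuous : WeaklyContinuousOn ξ J
  locallyBounded : ∀ t ∈ J, ∃ C : ℝ, ∀ s ∈ Icc 0 t, ‖ξ s‖ ≤ C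
  integrable : ∀ θ : CbField 1 d, ∀ t ∈ J,
    IntervalIntegrable (fun s => (ξ s).1 (advect θ (b s))) volume 0 t ∧
    IntervalIntegrable (fun s => (ξ s).1 (stretch (b s) θ)) volume 0 t
  weak : ∀ θ : CbField 1 d, ∀ t ∈ J,
    (ξ t).1 θ.toBdd - ∫ s in (0 : ℝ)..t, (ξ s).1 (advect θ (b s)) =
      ξ₀.1 θ.toBdd + ∫ s in (0 : ℝ)..t, (ξ s).1 (stretch (b s) θ)

/-- Current-valued solutions on `J` of `∂_t ξ + div(B(ξ) ξ) = (ξ·∇) B(ξ)`, `ξ(0) = ξ₀`. -/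
def IsPDESolution {d : ℕ} (B : Current d → CbField 2 d) (ξ₀ : Current d) (J : Set ℝ)
    (ξ : ℝ → Current d) : Prop :=
  IsLinearWeakSolution (fun s => B (ξ s)) ξ₀ J ξ

/-- Solutions on `J` of the flow equation `ξ_t = φ^{t,B(ξ)}_♯ ξ₀`. -/
def IsFlowSolution {d : ℕ} (B : Current d → CbField 2 d) (ξ₀ : Current d) (J : Set ℝ)
    (ξ : ℝ → Current d) : Prop :=
  IsTransported (fun s => B (ξ s)) ξ₀ J ξ

/-! ### Maximal solutions -/

/-- There is exactly one solution on `[0, T]`. -/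
def UniquelySolvable {d : ℕ} (Sol : Set ℝ → (ℝ → Current d) → Prop) (T : ℝ) : Prop :=
  ∃ ξ, Sol (Icc 0 T) ξ ∧ ∀ η, Sol (Icc 0 T) η → EqOn η ξ (Icc 0 T)

/-- The supremum of all `T > 0` such that there is exactly one solution on `[0, T]`. -/
def lifespan {d : ℕ} (Sol : Set ℝ → (ℝ → Current d) → Prop) : EReal :=
  sSup {τ : EReal | ∃ T : ℝ, 0 < T ∧ UniquelySolvable Sol T ∧ τ = (T : EReal)}

/-- The interval `[0, τ)`, possibly infinite. -/
def timeInterval (τ : EReal) : Set ℝ := {t : ℝ | 0 ≤ t ∧ (t : EReal) < τ}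

/-- `ξ` is the unique maximal solution and `[0, τ)` is its interval of existence: every solution on
an interval `J ∋ 0` of nonnegative times is a restriction of `ξ`. -/
structure IsMaximalSolution {d : ℕ} (Sol : Set ℝ → (ℝ → Current d) → Prop) (τ : EReal)
    (ξ : ℝ → Current d) : Prop where
  pos : 0 < τ
  sol : Sol (timeInterval τ) ξ
  maximal : ∀ J : Set ℝ, J.OrdConnected → 0 ∈ J → J ⊆ Ici 0 → ∀ η, Sol J η →
    J ⊆ timeInterval τ ∧ EqOn η ξ J

end

/-!
The flow equation is an ordinary differential equation in disguise. The push-forward of `ξ₀` by a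
map `φ` depends on the displacement `U = φ - id` and the Jacobian `V = Dφ` only. Along the flow of
a field `b`, the pair `(U, V)` solves `U' = b(id + U)`, `V' = Db(id + U) V` in the Banach space
`C_b(ℝ^d; ℝ^d) × C_b(ℝ^d; End ℝ^d)`, and for `b = B(ξ)` with `ξ = φ_♯ ξ₀` the right-hand side is an
autonomous vector field of `(U, V)` (`isFlowSolution_iff`). It is Lipschitz on bounded sets
(`lipschitzOnBounded_jetVectorField`), because the weak norm of the push-forward is Lipschitz in
`(U, V)` (`weakNorm_jetCurrent_sub_le`) and `B` and `DB` are Lipschitz in the weak norm, with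
values bounded in `C_b^2`. Solutions therefore exist locally, are unique, and extend beyond every
compact interval. This yields the unique maximal solution of the flow equation (`exists_maximal`).

The flow equation and the partial differential equation are equivalent because their linear
versions are (`isLinearWeakSolution_iff_isTransported`). A transported current is a weak solution:
for a test field `θ`, the time derivative of `(Dφ)ᵀ θ(φ)` is bounded and continuous, and by
tightness the current `ξ₀` may be applied to it (`IsTransported.isLinearWeakSolution`). The
converse is the uniqueness of weak solutions. The classical duality argument tests the difference
`ζ` of two solutions with the solution of the backward equation, which needs a flow of class `C^2`
and test fields that depend on time. Both are avoided by a discretization of the backward equation.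
Within a time step of length `h`, the field `b` is replaced by a mollification `β` with `‖b - β‖ ≤
η` in `C^1`, and the test field by its pull-back under the Euler step `id + h β`. One step then
costs an error of order `h η` times the `C^1` bound of the test field, plus a term of order `h (w +
h)` times the Lipschitz bound of its derivative, where `w` is the oscillation of `ζ` in the weak
norm (`IsNullSolution.one_step`). The pull-backs have a `C^1` bound that depends on the `C_b^2`
norm of `b` only, while their `C^{1,1}` bound also depends on the mollification
(`C11Bound.eulerPull`). Summing over the steps, the second contribution vanishes as `h` and `w`
tend to zero for fixed `η`, and the first one vanishes as `η` tends to zero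
(`IsNullSolution.eq_zero`).
-/

/-! ### The weak norm -/

section WeakNorm

variable {d : ℕ}

theorem abs_current_apply_le (ξ : Current d) (θ : Euc d →ᵇ Euc d) : |ξ.1 θ| ≤ ‖ξ‖ * ‖θ‖ :=
  ξ.1.le_opNorm θ

theorem bddAbove_weakNorm_set (ξ : Current d) :
    BddAbove {r : ℝ | ∃ θ : Euc d →ᵇ Euc d, ∃ L : ℝ≥0,
      LipschitzWith L θ ∧ ‖θ‖ + L ≤ 1 ∧ r = ξ.1 θ} := by
  refine ⟨‖ξ‖, ?_⟩
  rintro r ⟨θ, L, -, h, rfl⟩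
  have h1 : ‖θ‖ ≤ 1 := by linarith [L.coe_nonneg]
  exact (le_abs_self _).trans ((abs_current_apply_le ξ θ).trans
    (mul_le_of_le_one_right (norm_nonneg ξ) h1))

theorem weakNorm_nonneg (ξ : Current d) : 0 ≤ weakNorm ξ :=
  le_csSup (bddAbove_weakNorm_set ξ) ⟨0, 0, by simp, by simp, by simp⟩

theorem weakNorm_le {ξ : Current d} {C : ℝ}
    (h : ∀ θ : Euc d →ᵇ Euc d, ∀ L : ℝ≥0, LipschitzWith L θ → ‖θ‖ + L ≤ 1 → ξ.1 θ ≤ C) :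
    weakNorm ξ ≤ C := by
  refine csSup_le ⟨0, 0, 0, by simp, by simp, by simp⟩ ?_
  rintro r ⟨θ, L, h1, h2, rfl⟩
  exact h θ L h1 h2

theorem apply_le_weakNorm (ξ : Current d) {θ : Euc d →ᵇ Euc d} {L : ℝ≥0}
    (h : LipschitzWith L θ) (h' : ‖θ‖ + L ≤ 1) : ξ.1 θ ≤ weakNorm ξ :=
  le_csSup (bddAbove_weakNorm_set ξ) ⟨θ, L, h, h', rfl⟩

/-- The weak norm controls the action on Lipschitz fields. The estimate is homogeneous in the field,
so that fields outside the unit ball in the definition of the weak norm are covered. -/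
theorem abs_apply_le_weakNorm (ξ : Current d) {θ : Euc d →ᵇ Euc d} {a L : ℝ}
    (ha : ∀ x, ‖θ x‖ ≤ a) (hL : 0 ≤ L) (h : ∀ x y, ‖θ x - θ y‖ ≤ L * ‖x - y‖) :
    |ξ.1 θ| ≤ weakNorm ξ * (a + L) := by
  have ha0 : 0 ≤ a := (norm_nonneg _).trans (ha 0)
  have hθ : ‖θ‖ ≤ a := (BoundedContinuousFunction.norm_le ha0).2 ha
  rcases eq_or_lt_of_le (add_nonneg ha0 hL) with h0 | h0
  · have : θ = 0 := by
      have : ‖θ‖ ≤ 0 := by linarith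
      simpa using this
    simp [this, ← h0]
  -- The absolute value is covered by the two fields `θ` and `-θ`.
  have key : ∀ η : Euc d →ᵇ Euc d, (∀ x, ‖η x‖ ≤ a) → (∀ x y, ‖η x - η y‖ ≤ L * ‖x - y‖) →
      ξ.1 η ≤ weakNorm ξ * (a + L) := by
    intro η h1 h2
    have hη : ‖η‖ ≤ a := (BoundedContinuousFunction.norm_le ha0).2 h1
    have hc : 0 ≤ (a + L)⁻¹ := by positivity
    have hcL : ((Real.toNNReal ((a + L)⁻¹ * L) : ℝ≥0) : ℝ) = (a + L)⁻¹ * L :=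
      Real.coe_toNNReal _ (mul_nonneg hc hL)
    have h3 : LipschitzWith (Real.toNNReal ((a + L)⁻¹ * L)) ((a + L)⁻¹ • η) := by
      refine LipschitzWith.of_dist_le_mul fun x y => ?_
      rw [hcL, mul_assoc]
      simp only [BoundedContinuousFunction.coe_smul, dist_eq_norm, ← smul_sub, norm_smul,
        Real.norm_eq_abs, abs_of_nonneg hc]
      exact mul_le_mul_of_nonneg_left (h2 x y) hc
    have h4 := apply_le_weakNorm ξ h3 (by
      rw [norm_smul, Real.norm_eq_abs, abs_of_nonneg hc, hcL, ← mul_add, inv_mul_le_iff₀ h0]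
      linarith)
    rw [map_smul, smul_eq_mul, inv_mul_le_iff₀ h0] at h4
    linarith
  refine abs_le.2 ⟨?_, key θ ha h⟩
  have := key (-θ) (by simpa using ha) (fun x y => by
    have := h y x
    simpa [norm_sub_rev, neg_add_eq_sub] using this)
  rw [map_neg] at this
  linarith

theorem weakNorm_zero : weakNorm (0 : Current d) = 0 :=
  le_antisymm (weakNorm_le fun θ L _ _ => by simp) (weakNorm_nonneg _)

theorem weakNorm_add_le (ξ η : Current d) : weakNorm (ξ + η) ≤ weakNorm ξ + weakNorm η :=
  weakNorm_le fun _ _ h h' => add_le_add (apply_le_weakNorm ξ h h') (apply_le_weakNorm η h h')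

theorem weakNorm_neg (ξ : Current d) : weakNorm (-ξ) = weakNorm ξ := by
  have key : ∀ η : Current d, weakNorm (-η) ≤ weakNorm η := fun η =>
    weakNorm_le fun θ L h h' => by
      have := apply_le_weakNorm η (θ := -θ) (L := L) (by simpa using h.neg) (by simpa using h')
      simpa using this
  refine le_antisymm (key ξ) ((key (-ξ)).trans' (le_of_eq ?_))
  congr 1
  exact Subtype.ext (neg_neg _).symm

theorem weakNorm_sub_comm (ξ η : Current d) : weakNorm (ξ - η) = weakNorm (η - ξ) := by
  rw [← weakNorm_neg]
  congr 1
  exact Subtype.ext (neg_sub _ _)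

theorem weakNorm_sub_le (ξ η ζ : Current d) :
    weakNorm (ξ - ζ) ≤ weakNorm (ξ - η) + weakNorm (η - ζ) := by
  refine le_trans (le_of_eq ?_) (weakNorm_add_le (ξ - η) (η - ζ))
  congr 1
  exact Subtype.ext (sub_add_sub_cancel _ _ _).symm

theorem WeaklyContinuousOn.mono {ξ : ℝ → Current d} {J J' : Set ℝ} (h : WeaklyContinuousOn ξ J)
    (hJ : J' ⊆ J) : WeaklyContinuousOn ξ J' :=
  fun t ht => (h t (hJ ht)).mono_left (nhdsWithin_mono _ hJ)

theorem WeaklyContinuousOn.congr {ξ η : ℝ → Current d} {J : Set ℝ} (h : WeaklyContinuousOn ξ J)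
    (he : EqOn η ξ J) : WeaklyContinuousOn η J := by
  intro t ht
  refine (h t ht).congr' ?_
  filter_upwards [self_mem_nhdsWithin] with s hs
  rw [he hs, he ht]

theorem WeaklyContinuousOn.sub {ξ η : ℝ → Current d} {J : Set ℝ} (hξ : WeaklyContinuousOn ξ J)
    (hη : WeaklyContinuousOn η J) : WeaklyContinuousOn (fun t => ξ t - η t) J := by
  intro t ht
  refine squeeze_zero (fun _ => weakNorm_nonneg _) (fun s => ?_)
    (by simpa using (hξ t ht).add (hη t ht))
  have := weakNorm_add_le (ξ s - ξ t) (-(η s - η t))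
  rw [weakNorm_neg] at this
  refine le_trans (le_of_eq ?_) this
  congr 1
  refine Subtype.ext (ContinuousLinearMap.ext fun θ => ?_)
  simp only [Submodule.coe_sub, Submodule.coe_add, Submodule.coe_neg, sub_apply, add_apply,
    neg_apply]
  abel

/-- A weakly continuous curve on a compact set is uniformly weakly continuous. -/
theorem WeaklyContinuousOn.uniform {ξ : ℝ → Current d} {J : Set ℝ}
    (h : WeaklyContinuousOn ξ J) (hJ : IsCompact J) {ε : ℝ} (hε : 0 < ε) :
    ∃ δ > 0, ∀ s ∈ J, ∀ t ∈ J, |s - t| < δ → weakNorm (ξ s - ξ t) ≤ ε := by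
  have h1 : ∀ t ∈ J, ∃ δ > 0, ∀ s ∈ J, |s - t| < δ → weakNorm (ξ s - ξ t) < ε / 2 := by
    intro t ht
    have := (h t ht).eventually (gt_mem_nhds (half_pos hε))
    rw [eventually_nhdsWithin_iff, Metric.eventually_nhds_iff] at this
    obtain ⟨δ, hδ, h2⟩ := this
    exact ⟨δ, hδ, fun s hs hst => h2 (by rwa [Real.dist_eq]) hs⟩
  choose! δ hδ h2 using h1
  obtain ⟨ρ, hρ, h3⟩ := lebesgue_number_lemma_of_metric (c := fun t : J => Metric.ball t.1 (δ t.1))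
    hJ (fun _ => Metric.isOpen_ball)
    (fun t ht => mem_iUnion.2 ⟨⟨t, ht⟩, Metric.mem_ball_self (hδ t ht)⟩)
  refine ⟨ρ, hρ, fun s hs t ht hst => ?_⟩
  obtain ⟨⟨r, hr⟩, h4⟩ := h3 t ht
  have a := h2 r hr s hs (by simpa [Real.dist_eq] using h4 (show s ∈ Metric.ball t ρ by
    rwa [Metric.mem_ball, Real.dist_eq]))
  have b := h2 r hr t ht (by simpa [Real.dist_eq] using h4 (Metric.mem_ball_self hρ))
  have c := weakNorm_sub_le (ξ s) (ξ r) (ξ t)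
  rw [weakNorm_sub_comm (ξ r)] at c
  linarith

end WeakNorm

/-! ### Tightness of currents -/

section Tight

variable {d : ℕ}

/-- A field that is small on a compact set carrying most of a functional has a small image: it is
split into its radial truncation, which is small everywhere, and a remainder vanishing on the
compact set. -/
theorem abs_apply_le_of_le_on {ξ : FieldDual (Euc d)} {K : Set (Euc d)} {ε δ : ℝ}
    (hK : ∀ θ : Euc d →ᵇ Euc d, (∀ x ∈ K, θ x = 0) → |ξ θ| ≤ ε * ‖θ‖) (hε : 0 ≤ ε) (hδ : 0 < δ)
    {f : Euc d →ᵇ Euc d} (hf : ∀ x ∈ K, ‖f x‖ ≤ δ) : |ξ f| ≤ ‖ξ‖ * δ + ε * ‖f‖ := by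
  have hpos : ∀ x, 0 < max δ ‖f x‖ := fun x => lt_max_of_lt_left hδ
  have hle : ∀ x, δ / max δ ‖f x‖ ≤ 1 := fun x => (div_le_one (hpos x)).2 (le_max_left _ _)
  have hcont : Continuous fun x => (δ / max δ ‖f x‖) • f x :=
    (continuous_const.div (continuous_const.max f.continuous.norm) fun x => (hpos x).ne').smul
      f.continuous
  have hb : ∀ x, ‖(δ / max δ ‖f x‖) • f x‖ ≤ δ := by
    intro x
    rw [norm_smul, Real.norm_eq_abs, abs_of_nonneg (div_nonneg hδ.le (hpos x).le),
      div_mul_eq_mul_div, div_le_iff₀ (hpos x)]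
    exact mul_le_mul_of_nonneg_left (le_max_right _ _) hδ.le
  let g : Euc d →ᵇ Euc d := bddField _ hcont ⟨δ, hb⟩
  have hg : ∀ x, g x = (δ / max δ ‖f x‖) • f x := fun _ => rfl
  have h1 : |ξ g| ≤ ‖ξ‖ * δ := (ξ.le_opNorm g).trans
    (mul_le_mul_of_nonneg_left ((BoundedContinuousFunction.norm_le hδ.le).2 hb) (norm_nonneg _))
  have h2 : |ξ (f - g)| ≤ ε * ‖f‖ := by
    refine (hK (f - g) fun x hx => ?_).trans (mul_le_mul_of_nonneg_left ?_ hε)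
    · rw [BoundedContinuousFunction.sub_apply, hg, max_eq_left (hf x hx), div_self hδ.ne',
        one_smul, sub_self]
    · refine (BoundedContinuousFunction.norm_le (norm_nonneg _)).2 fun x => ?_
      have : f x - g x = (1 - δ / max δ ‖f x‖) • f x := by rw [hg, sub_smul, one_smul]
      rw [BoundedContinuousFunction.sub_apply, this, norm_smul, Real.norm_eq_abs,
        abs_of_nonneg (sub_nonneg.2 (hle x))]
      refine (mul_le_of_le_one_left (norm_nonneg _) ?_).trans (f.norm_coe_le_norm x)
      linarith [div_nonneg hδ.le (hpos x).le]
  have h3 : ξ f = ξ g + ξ (f - g) := by rw [← map_add]; congr 1; abel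
  rw [h3]
  exact (abs_add_le _ _).trans (add_le_add h1 h2)

/-- Currents are continuous along bounded sequences converging locally uniformly. -/
theorem Current.tendsto_apply_zero {ι : Type*} {l : Filter ι} (ξ : Current d)
    {g : ι → Euc d →ᵇ Euc d} {C : ℝ} (hC : ∀ᶠ i in l, ‖g i‖ ≤ C)
    (h : ∀ K : Set (Euc d), IsCompact K → ∀ ε > 0, ∀ᶠ i in l, ∀ x ∈ K, ‖g i x‖ ≤ ε) :
    Tendsto (fun i => ξ.1 (g i)) l (𝓝 0) := by
  rw [Metric.tendsto_nhds]
  intro ε hε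
  obtain ⟨K, hK, h1⟩ := ξ.2 (ε / (4 * (|C| + 1))) (by positivity)
  filter_upwards [hC, h K hK (ε / (4 * (‖ξ.1‖ + 1))) (by positivity)] with i hi hi'
  have h2 := abs_apply_le_of_le_on h1 (by positivity) (by positivity) hi'
  have h3 : ‖ξ.1‖ * (ε / (4 * (‖ξ.1‖ + 1))) ≤ ε / 4 := by
    rw [mul_div_assoc', div_le_div_iff₀ (by positivity) (by positivity)]
    nlinarith [norm_nonneg ξ.1]
  have h4 : ε / (4 * (|C| + 1)) * ‖g i‖ ≤ ε / 4 := by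
    rw [div_mul_eq_mul_div, div_le_div_iff₀ (by positivity) (by positivity)]
    nlinarith [le_abs_self C, norm_nonneg (g i)]
  rw [Real.dist_eq, sub_zero]
  linarith

/-- A current is determined by its values on smooth compactly supported fields: by tightness, the
value at a bounded continuous field changes little if the field is cut off outside of a large ball,
and the result is the uniform limit of its mollifications. -/
theorem Current.eq_zero_of_forall_smooth (ξ : Current d)
    (h : ∀ θ : Euc d →ᵇ Euc d, ContDiff ℝ 3 θ → HasCompactSupport θ → ξ.1 θ = 0) : ξ = 0 := by
  have hsmooth : ∀ g : Euc d → Euc d, Continuous g → HasCompactSupport g → ∀ ε > 0,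
      ∃ θ : Euc d →ᵇ Euc d, ContDiff ℝ 3 θ ∧ HasCompactSupport θ ∧ ∀ x, ‖θ x - g x‖ ≤ ε := by
    intro g hg hgc ε hε
    obtain ⟨δ, hδ, hu⟩ := Metric.uniformContinuous_iff.1
      (hgc.uniformContinuous_of_continuous hg) ε hε
    let φ : ContDiffBump (0 : Euc d) := ⟨δ / 2, δ, half_pos hδ, half_lt_self hδ⟩
    let c := convolution (φ.normed volume) g (ContinuousLinearMap.lsmul ℝ ℝ) volume
    have hc : ContDiff ℝ 3 c :=
      HasCompactSupport.contDiff_convolution_left _ φ.hasCompactSupport_normed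
        φ.contDiff_normed hg.locallyIntegrable
    have hcc : HasCompactSupport c := HasCompactSupport.convolution _ φ.hasCompactSupport_normed hgc
    refine ⟨bddField c hc.continuous (hcc.exists_bound_of_continuous hc.continuous), hc, hcc,
      fun x => ?_⟩
    have := φ.dist_normed_convolution_le (x₀ := x) (μ := volume) (g := g) (ε := ε)
      hg.aestronglyMeasurable (fun y hy => (hu hy).le)
    rwa [dist_eq_norm] at this
  have key : ∀ g : Euc d →ᵇ Euc d, ξ.1 g = 0 := by
    intro g
    -- `ε` bounds both the mass outside of `K` and the distance on `K` from `g` to a smooth field.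
    have hle : ∀ ε > 0, |ξ.1 g| ≤ ‖ξ.1‖ * ε + ε * (2 * ‖g‖ + 1) := by
      intro ε hε
      obtain ⟨K, hK, h1⟩ := ξ.2 ε hε
      obtain ⟨R, hR⟩ := hK.isBounded.subset_closedBall (0 : Euc d)
      let χ : ContDiffBump (0 : Euc d) := ⟨|R| + 1, |R| + 2, by positivity, by linarith⟩
      have hχ : ∀ x ∈ K, χ x = 1 := fun x hx =>
        χ.one_of_mem_closedBall (Metric.closedBall_subset_closedBall
          ((le_abs_self R).trans (by simp [χ])) (hR hx))
      obtain ⟨θ, hθ, hθc, hθg⟩ := hsmooth (fun x => χ x • g x) (χ.continuous.smul g.continuous)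
        χ.hasCompactSupport.smul_right (min ε 1) (by positivity)
      have h2 := abs_apply_le_of_le_on h1 hε.le hε (f := g - θ) fun x hx => by
        have := hθg x
        rw [hχ x hx, one_smul, norm_sub_rev] at this
        exact this.trans (min_le_left _ _)
      rw [map_sub, h θ hθ hθc, sub_zero] at h2
      refine h2.trans (add_le_add le_rfl (mul_le_mul_of_nonneg_left ?_ hε.le))
      refine (BoundedContinuousFunction.norm_le (by positivity)).2 fun x => ?_
      have a : ‖χ x • g x‖ ≤ ‖g‖ := by
        rw [norm_smul, Real.norm_eq_abs, abs_of_nonneg χ.nonneg]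
        exact (mul_le_of_le_one_left (norm_nonneg _) χ.le_one).trans (g.norm_coe_le_norm x)
      have b := (hθg x).trans (min_le_right _ _)
      have c := g.norm_coe_le_norm x
      calc ‖(g - θ) x‖ = ‖g x - (θ x - χ x • g x) - χ x • g x‖ := by
            rw [BoundedContinuousFunction.sub_apply]; congr 1; abel
        _ ≤ ‖g x‖ + ‖θ x - χ x • g x‖ + ‖χ x • g x‖ :=
            (norm_sub_le _ _).trans (add_le_add (norm_sub_le _ _) le_rfl)
        _ ≤ 2 * ‖g‖ + 1 := by linarith
    have hlim : Tendsto (fun ε : ℝ => ‖ξ.1‖ * ε + ε * (2 * ‖g‖ + 1)) (𝓝[>] 0) (𝓝 0) := by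
      have : Continuous fun ε : ℝ => ‖ξ.1‖ * ε + ε * (2 * ‖g‖ + 1) := by fun_prop
      simpa using (this.tendsto 0).mono_left nhdsWithin_le_nhds
    have := ge_of_tendsto hlim (by filter_upwards [self_mem_nhdsWithin] with ε hε using hle ε hε)
    exact abs_nonpos_iff.1 this
  ext g
  exact key g

end Tight

/-! ### Ordinary differential equations in Banach spaces -/

section ODE

variable {F : Type*} [NormedAddCommGroup F] [NormedSpace ℝ F]

/-- `f` solves `f' = v(t, f)` on the set `J`. -/
def SolvesODE (v : ℝ → F → F) (J : Set ℝ) (f : ℝ → F) : Prop :=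
  ∀ t ∈ J, HasDerivWithinAt f (v t (f t)) J t

theorem SolvesODE.continuousOn {v : ℝ → F → F} {J : Set ℝ} {f : ℝ → F} (h : SolvesODE v J f) :
    ContinuousOn f J :=
  fun t ht => (h t ht).continuousWithinAt

theorem SolvesODE.mono {v : ℝ → F → F} {J J' : Set ℝ} {f : ℝ → F} (h : SolvesODE v J f)
    (hJ : J' ⊆ J) : SolvesODE v J' f :=
  fun t ht => (h t (hJ ht)).mono hJ

theorem HasDerivWithinAt.Ici_of_Icc {f : ℝ → F} {f' : F} {a b t : ℝ}
    (h : HasDerivWithinAt f f' (Icc a b) t) (ht : t ∈ Ico a b) : HasDerivWithinAt f f' (Ici t) t :=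
  h.mono_of_mem_nhdsWithin (mem_of_superset (Icc_mem_nhdsGE ht.2) (Icc_subset_Icc_left ht.1))

/-- Solutions on adjacent intervals that agree at the common endpoint fit together. -/
theorem SolvesODE.glue {v : ℝ → F → F} {f g : ℝ → F} {a b c : ℝ} (hab : a ≤ b) (hbc : b ≤ c)
    (hf : SolvesODE v (Icc a b) f) (hg : SolvesODE v (Icc b c) g) (h : f b = g b) :
    ∃ k : ℝ → F, EqOn k f (Icc a b) ∧ SolvesODE v (Icc a c) k := by
  classical
  let k : ℝ → F := fun t => if t ≤ b then f t else g t
  have h1 : EqOn k f (Icc a b) := fun t ht => if_pos ht.2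
  have h2 : EqOn k g (Icc b c) := fun t ht => by
    rcases eq_or_lt_of_le ht.1 with rfl | hlt
    · exact (if_pos le_rfl).trans h
    · exact if_neg (not_le.2 hlt)
  refine ⟨k, h1, fun t ht => ?_⟩
  rw [← Icc_union_Icc_eq_Icc hab hbc]
  refine HasDerivWithinAt.union ?_ ?_
  · by_cases htb : t ∈ Icc a b
    · rw [h1 htb]
      exact (hf t htb).congr h1 (h1 htb)
    · exact HasFDerivWithinAt.of_notMem_closure (by rwa [isClosed_Icc.closure_eq])
  · by_cases htb : t ∈ Icc b c
    · rw [h2 htb]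
      exact (hg t htb).congr h2 (h2 htb)
    · exact HasFDerivWithinAt.of_notMem_closure (by rwa [isClosed_Icc.closure_eq])

/-- Solutions exist on every time step that is short compared with the Lipschitz constant. -/
theorem exists_solvesODE_of_short [CompleteSpace F] {v : ℝ → F → F} {a b : ℝ} (hab : a ≤ b)
    {K : ℝ≥0} (hv : ∀ t ∈ Icc a b, LipschitzWith K (v t))
    (hc : ∀ x, ContinuousOn (v · x) (Icc a b)) (hK : (K + 1) * (b - a) ≤ 1) (x : F) :
    ∃ f : ℝ → F, f a = x ∧ SolvesODE v (Icc a b) f := by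
  obtain ⟨C, hC⟩ := isCompact_Icc.exists_bound_of_continuousOn (hc x)
  have hC0 : 0 ≤ C := (norm_nonneg _).trans (hC a (left_mem_Icc.2 hab))
  lift C to ℝ≥0 using hC0
  -- On the ball of radius `C` about `x` the speed is at most `(K + 1) * C`, so that solutions
  -- do not leave this ball within the time `b - a ≤ 1 / (K + 1)`.
  have hPL : IsPicardLindelof v (⟨a, left_mem_Icc.2 hab⟩ : Icc a b) x C 0 ((K + 1) * C) K := by
    refine ⟨fun t ht => (hv t ht).lipschitzOnWith, fun y _ => hc y, fun t ht y hy => ?_, ?_⟩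
    · have h1 := (hv t ht).dist_le_mul y x
      have h2 : K * dist y x ≤ K * C := mul_le_mul_of_nonneg_left hy K.2
      have h3 : ‖v t y‖ ≤ ‖v t x‖ + dist (v t y) (v t x) := by
        rw [dist_eq_norm]
        simpa using norm_add_le (v t x) (v t y - v t x)
      have h4 := hC t ht
      push_cast
      linarith
    · simp only [sub_self, max_eq_left (sub_nonneg.2 hab)]
      push_cast
      nlinarith [C.2]
  exact hPL.exists_eq_forall_mem_Icc_hasDerivWithinAt₀

/-- A globally Lipschitz equation has solutions for all times. -/
theorem exists_solvesODE_of_lipschitz [CompleteSpace F] {v : ℝ → F → F} {T : ℝ} (hT : 0 ≤ T)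
    {K : ℝ≥0} (hv : ∀ t ∈ Icc 0 T, LipschitzWith K (v t))
    (hc : ∀ x, ContinuousOn (v · x) (Icc 0 T)) (x₀ : F) :
    ∃ f : ℝ → F, f 0 = x₀ ∧ SolvesODE v (Icc 0 T) f := by
  -- Each of the `N` steps of length `T / N` is short enough for `exists_solvesODE_of_short`.
  obtain ⟨N, hN⟩ := exists_nat_gt ((K + 1) * T)
  have hN0 : (0 : ℝ) < N := lt_of_le_of_lt (by positivity) hN
  set h : ℝ := T / N with hh
  have hh0 : 0 ≤ h := by positivity
  have hNh : N * h = T := by rw [hh]; field_simp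
  have key : ∀ k : ℕ, k ≤ N → ∃ f : ℝ → F, f 0 = x₀ ∧ SolvesODE v (Icc 0 (k * h)) f := by
    intro k
    induction k with
    | zero =>
      intro _
      refine ⟨fun _ => x₀, rfl, fun t ht => ?_⟩
      have : Icc (0 : ℝ) ((0 : ℕ) * h) = {t} := by
        have h0 : t = 0 := by simpa using ht
        simp [h0]
      rw [this]
      exact HasFDerivWithinAt.singleton
    | succ k ih =>
      intro hk
      obtain ⟨f, hf0, hf⟩ := ih (by omega)
      have h1 : (k : ℝ) * h ≤ (k + 1 : ℕ) * h :=
        mul_le_mul_of_nonneg_right (by push_cast; linarith) hh0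
      have h2 : ((k + 1 : ℕ) : ℝ) * h ≤ T := by
        rw [← hNh]; exact mul_le_mul_of_nonneg_right (by exact_mod_cast hk) hh0
      have hsub : Icc ((k : ℝ) * h) ((k + 1 : ℕ) * h) ⊆ Icc 0 T :=
        Icc_subset_Icc (by positivity) h2
      obtain ⟨g, hg0, hg⟩ := exists_solvesODE_of_short h1 (fun t ht => hv t (hsub ht))
        (fun x => (hc x).mono hsub) (by
          have : ((k + 1 : ℕ) : ℝ) * h - k * h = h := by push_cast; ring
          rw [this, hh, mul_div_assoc', div_le_one hN0]
          exact hN.le) (f (k * h))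
      obtain ⟨u, hu, hu'⟩ := hf.glue (by positivity) h1 hg hg0.symm
      exact ⟨u, (hu ⟨le_rfl, by positivity⟩).trans hf0, hu'⟩
  obtain ⟨f, hf⟩ := key N le_rfl
  rw [hNh] at hf
  exact ⟨f, hf⟩

/-- Bounded sets are mapped Lipschitz continuously by `v`. -/
def LipschitzOnBounded (v : F → F) : Prop :=
  ∀ R : ℝ, ∃ K : ℝ≥0, LipschitzOnWith K v (Metric.closedBall 0 R)

/-- Local existence. The length of the interval is the time in which the unit ball about the initial
value is not left. -/
theorem LipschitzOnBounded.exists_solvesODE [CompleteSpace F] {v : F → F}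
    (hv : LipschitzOnBounded v) (t₀ : ℝ) (x : F) :
    ∃ δ > 0, ∃ f : ℝ → F, f t₀ = x ∧ SolvesODE (fun _ => v) (Icc t₀ (t₀ + δ)) f := by
  obtain ⟨K, hK⟩ := hv (‖x‖ + 1)
  have hsub : Metric.closedBall x 1 ⊆ Metric.closedBall (0 : F) (‖x‖ + 1) :=
    Metric.closedBall_subset_closedBall' (by rw [dist_zero_right, add_comm])
  set L : ℝ≥0 := ‖v x‖₊ + K with hL
  have hδ : (0 : ℝ) < (L + 1 : ℝ)⁻¹ := by positivity
  have ht : t₀ ≤ t₀ + (L + 1 : ℝ)⁻¹ := by linarith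
  have hPL : IsPicardLindelof (fun _ => v)
      (⟨t₀, left_mem_Icc.2 ht⟩ : Icc t₀ (t₀ + (L + 1 : ℝ)⁻¹)) x 1 0 L K := by
    refine ⟨fun t _ => hK.mono hsub, fun y _ => continuousOn_const, fun t _ y hy => ?_, ?_⟩
    · have h1 := hK.dist_le_mul y (hsub hy) x (hsub (Metric.mem_closedBall_self zero_le_one))
      have h2 : (K : ℝ) * dist y x ≤ K * 1 := mul_le_mul_of_nonneg_left hy K.2
      have h3 : ‖v y‖ ≤ ‖v x‖ + dist (v y) (v x) := by
        rw [dist_eq_norm]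
        simpa using norm_add_le (v x) (v y - v x)
      rw [hL]
      push_cast
      linarith
    · simp only [sub_self, add_sub_cancel_left, max_eq_left hδ.le]
      rw [mul_inv_le_iff₀ (by positivity)]
      simp
  obtain ⟨f, hf⟩ := hPL.exists_eq_forall_mem_Icc_hasDerivWithinAt₀
  exact ⟨_, hδ, f, hf⟩

/-- Uniqueness on a compact interval, where two given solutions stay in a common ball. -/
theorem LipschitzOnBounded.unique {v : F → F} (hv : LipschitzOnBounded v) {T : ℝ} {f g : ℝ → F}
    (hf : SolvesODE (fun _ => v) (Icc 0 T) f) (hg : SolvesODE (fun _ => v) (Icc 0 T) g)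
    (h0 : f 0 = g 0) : EqOn f g (Icc 0 T) := by
  obtain ⟨A, hA⟩ := isCompact_Icc.exists_bound_of_continuousOn hf.continuousOn
  obtain ⟨A', hA'⟩ := isCompact_Icc.exists_bound_of_continuousOn hg.continuousOn
  obtain ⟨K, hK⟩ := hv (max A A')
  refine ODE_solution_unique_of_mem_Icc_right (v := fun _ => v)
    (s := fun _ => Metric.closedBall 0 (max A A')) (fun _ _ => hK) hf.continuousOn
    (fun t ht => (hf t (Ico_subset_Icc_self ht)).Ici_of_Icc ht) (fun t ht => ?_) hg.continuousOn
    (fun t ht => (hg t (Ico_subset_Icc_self ht)).Ici_of_Icc ht) (fun t ht => ?_) h0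
  · rw [mem_closedBall_zero_iff]
    exact (hA t (Ico_subset_Icc_self ht)).trans (le_max_left _ _)
  · rw [mem_closedBall_zero_iff]
    exact (hA' t (Ico_subset_Icc_self ht)).trans (le_max_right _ _)

end ODE

/-! ### Fields of class `C_b^2` -/

section Fields

variable {d : ℕ}

/-- The space `C_b(ℝ^d; End(ℝ^d))` of fields of matrices. The metric of `End(ℝ^d)` is the one that
underlies its ring structure, so that `Jac d` is a normed ring for pointwise composition. -/
abbrev Jac (d : ℕ) : Type :=
  @BoundedContinuousFunction (Euc d) (Euc d →L[ℝ] Euc d) _ SeminormedRing.toPseudoMetricSpace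

theorem CbNormLE.norm_le {k : ℕ} {f : Euc d → Euc d} {C : ℝ} (h : CbNormLE k f C) (x : Euc d) :
    ‖f x‖ ≤ C := by
  simpa using h 0 (Nat.zero_le _) x

theorem CbNormLE.norm_fderiv_le {k : ℕ} {f : Euc d → Euc d} {C : ℝ} (h : CbNormLE k f C)
    (hk : 1 ≤ k) (x : Euc d) : ‖fderiv ℝ f x‖ ≤ C := by
  simpa [norm_iteratedFDeriv_one] using h 1 hk x

theorem CbNormLE.norm_fderiv_fderiv_le {f : Euc d → Euc d} {C : ℝ} (h : CbNormLE 2 f C)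
    (x : Euc d) : ‖fderiv ℝ (fderiv ℝ f) x‖ ≤ C := by
  have := h 2 le_rfl x
  rwa [← norm_iteratedFDeriv_fderiv, norm_iteratedFDeriv_one] at this

theorem norm_sub_le_of_norm_fderiv_le {F G : Type*} [NormedAddCommGroup F] [NormedSpace ℝ F]
    [NormedAddCommGroup G] [NormedSpace ℝ G] {f : F → G} {C : ℝ} (hf : Differentiable ℝ f)
    (h : ∀ x, ‖fderiv ℝ f x‖ ≤ C) (x y : F) : ‖f x - f y‖ ≤ C * ‖x - y‖ :=
  convex_univ.norm_image_sub_le_of_norm_fderiv_le (fun z _ => hf z) (fun z _ => h z)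
    (mem_univ y) (mem_univ x)

/-- The first order Taylor estimate for a map with Lipschitz derivative. -/
theorem norm_taylor_le {F G : Type*} [NormedAddCommGroup F] [NormedSpace ℝ F]
    [NormedAddCommGroup G] [NormedSpace ℝ G] {f : F → G} {C : ℝ} (hf : Differentiable ℝ f)
    (hC : 0 ≤ C) (h : ∀ x y, ‖fderiv ℝ f x - fderiv ℝ f y‖ ≤ C * ‖x - y‖) (x y : F) :
    ‖f y - f x - fderiv ℝ f x (y - x)‖ ≤ C * ‖y - x‖ ^ 2 := by
  have := (convex_segment x y).norm_image_sub_le_of_norm_hasFDerivWithin_le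
    (f := fun z => f z - fderiv ℝ f x z) (f' := fun z => fderiv ℝ f z - fderiv ℝ f x)
    (C := C * ‖y - x‖)
    (fun z _ => ((hf z).hasFDerivAt.sub (fderiv ℝ f x).hasFDerivAt).hasFDerivWithinAt)
    (fun z hz => (h z x).trans (mul_le_mul_of_nonneg_left (norm_sub_le_of_mem_segment hz) hC))
    (left_mem_segment ℝ x y) (right_mem_segment ℝ x y)
  rw [map_sub]
  calc _ = ‖f y - fderiv ℝ f x y - (f x - fderiv ℝ f x x)‖ := by congr 1; abel
    _ ≤ _ := this
    _ = _ := by ring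

namespace CbField

variable (b : CbField 2 d)

theorem differentiable : Differentiable ℝ b := b.contDiff.differentiable two_ne_zero

theorem differentiable_fderiv : Differentiable ℝ (fderiv ℝ b) :=
  (b.contDiff.fderiv_right (m := 1) (by norm_num)).differentiable one_ne_zero

/-- The Jacobian of a field of class `C_b^2`, as a bounded continuous function. -/
noncomputable def jac : Jac d :=
  BoundedContinuousFunction.ofNormedAddCommGroup (fderiv ℝ b) (b.continuous_fderiv one_le_two)
    (b.bounded_fderiv one_le_two).choose (b.bounded_fderiv one_le_two).choose_spec

variable {b} {m : ℝ}

theorem lipschitz (h : CbNormLE 2 b m) (x y : Euc d) : ‖b x - b y‖ ≤ m * ‖x - y‖ :=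
  norm_sub_le_of_norm_fderiv_le b.differentiable (h.norm_fderiv_le one_le_two) x y

theorem lipschitz_fderiv (h : CbNormLE 2 b m) (x y : Euc d) :
    ‖fderiv ℝ b x - fderiv ℝ b y‖ ≤ m * ‖x - y‖ :=
  norm_sub_le_of_norm_fderiv_le b.differentiable_fderiv h.norm_fderiv_fderiv_le x y

theorem dist_toBdd_le (h : CbNormLE 2 b m) (x y : Euc d) :
    dist (b.toBdd x) (b.toBdd y) ≤ m * ‖x - y‖ := by
  rw [dist_eq_norm]
  exact lipschitz h x y

theorem dist_jac_le (h : CbNormLE 2 b m) (x y : Euc d) :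
    dist (b.jac x) (b.jac y) ≤ m * ‖x - y‖ := by
  rw [dist_eq_norm]
  exact lipschitz_fderiv h x y

theorem taylor (h : CbNormLE 2 b m) (x y : Euc d) :
    ‖b y - b x - fderiv ℝ b x (y - x)‖ ≤ m * ‖y - x‖ ^ 2 :=
  norm_taylor_le b.differentiable ((norm_nonneg _).trans (h.norm_le 0)) (lipschitz_fderiv h) x y

end CbField

theorem CbNormLE.mono {k : ℕ} {f : Euc d → Euc d} {C C' : ℝ} (h : CbNormLE k f C) (hC : C ≤ C') :
    CbNormLE k f C' :=
  fun j hj x => (h j hj x).trans hC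

theorem CbNormLE.of_sub {f g : CbField 2 d} {C C' : ℝ} (hg : CbNormLE 2 g C)
    (h : CbNormLE 2 (fun x => f x - g x) C') : CbNormLE 2 f (C + C') := by
  intro j hj x
  have hj' : (j : WithTop ℕ∞) ≤ ((2 : ℕ) : WithTop ℕ∞) := Nat.cast_le.2 hj
  have h1 := h j hj x
  have h2 : iteratedFDeriv ℝ j (fun x => f x - g x) x =
      iteratedFDeriv ℝ j f x - iteratedFDeriv ℝ j g x :=
    iteratedFDeriv_sub_apply (f.contDiff.of_le hj').contDiffAt (g.contDiff.of_le hj').contDiffAt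
  rw [h2] at h1
  have h3 := hg j hj x
  calc _ = ‖iteratedFDeriv ℝ j g x + (iteratedFDeriv ℝ j f x - iteratedFDeriv ℝ j g x)‖ := by
        congr 1; abel
    _ ≤ _ := (norm_add_le _ _).trans (add_le_add h3 h1)

theorem CbNormLE.norm_fderiv_sub_le {f g : CbField 2 d} {C : ℝ}
    (h : CbNormLE 2 (fun x => f x - g x) C) (x : Euc d) :
    ‖fderiv ℝ f x - fderiv ℝ g x‖ ≤ C := by
  have := h.norm_fderiv_le one_le_two x
  rwa [fderiv_fun_sub (f.differentiable x) (g.differentiable x)] at this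

/-- A continuous curve in `C_b^2` over a compact set is bounded. -/
theorem CbContinuousOn.exists_bound {b : ℝ → CbField 2 d} {J : Set ℝ} (h : CbContinuousOn b J)
    (hJ : IsCompact J) : ∃ m > 0, ∀ t ∈ J, CbNormLE 2 (b t) m := by
  refine hJ.induction_on (p := fun s => ∃ m > 0, ∀ t ∈ s, CbNormLE 2 (b t) m)
    ⟨1, one_pos, by simp⟩ (fun s t hst ⟨m, hm, h⟩ => ⟨m, hm, fun r hr => h r (hst hr)⟩) ?_ ?_
  · rintro s t ⟨m, hm, h1⟩ ⟨m', hm', h2⟩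
    refine ⟨m + m', by positivity, ?_⟩
    rintro r (hr | hr)
    · exact (h1 r hr).mono (by linarith)
    · exact (h2 r hr).mono (by linarith)
  · intro t ht
    obtain ⟨C, hC⟩ := (b t).bdd
    refine ⟨_, h t ht 1 one_pos, |C| + 1, by positivity, fun s hs => ?_⟩
    exact CbNormLE.of_sub (hC.mono (le_abs_self C)) hs

theorem CbContinuousOn.continuousOn_toBdd {b : ℝ → CbField 2 d} {J : Set ℝ}
    (h : CbContinuousOn b J) : ContinuousOn (fun t => (b t).toBdd) J := by
  intro t ht
  refine Metric.tendsto_nhds.2 fun ε hε => ?_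
  filter_upwards [h t ht (ε / 2) (half_pos hε)] with s hs
  refine lt_of_le_of_lt ?_ (half_lt_self hε)
  rw [dist_eq_norm]
  exact (BoundedContinuousFunction.norm_le (half_pos hε).le).2 fun x => hs.norm_le x

theorem CbContinuousOn.continuousOn_jac {b : ℝ → CbField 2 d} {J : Set ℝ}
    (h : CbContinuousOn b J) : ContinuousOn (fun t => (b t).jac) J := by
  intro t ht
  refine Metric.tendsto_nhds.2 fun ε hε => ?_
  filter_upwards [h t ht (ε / 2) (half_pos hε)] with s hs
  refine lt_of_le_of_lt ?_ (half_lt_self hε)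
  rw [dist_eq_norm]
  exact (BoundedContinuousFunction.norm_le (half_pos hε).le).2 fun x => hs.norm_fderiv_sub_le x

end Fields

/-! ### The flow and its Jacobian -/

section Flow

variable {d : ℕ} {F : Type*} [PseudoMetricSpace F]

/-- The composition of `g` with the map `x ↦ x + U(x)`. A flow moves points by a bounded distance
in bounded time, so that its displacement `U`, unlike the flow itself, is an element of `C_b`. -/
noncomputable def along (g : Euc d →ᵇ F) (U : Euc d →ᵇ Euc d) : Euc d →ᵇ F :=
  g.compContinuous ⟨fun x => x + U x, by fun_prop⟩

theorem norm_along_jac_le {b : CbField 2 d} {m : ℝ} (h : CbNormLE 2 b m) (U : Euc d →ᵇ Euc d) :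
    ‖along b.jac U‖ ≤ m :=
  (BoundedContinuousFunction.norm_le ((norm_nonneg _).trans (h.norm_le 0))).2
    fun _ => h.norm_fderiv_le one_le_two _

theorem dist_along_le {g g' : Euc d →ᵇ F} {m e : ℝ} (hm : 0 ≤ m)
    (h : ∀ x y, dist (g x) (g y) ≤ m * ‖x - y‖) (he : ∀ x, dist (g x) (g' x) ≤ e)
    (U U' : Euc d →ᵇ Euc d) : dist (along g U) (along g' U') ≤ m * ‖U - U'‖ + e := by
  have he0 : 0 ≤ e := dist_nonneg.trans (he 0)
  refine (BoundedContinuousFunction.dist_le (by positivity)).2 fun x => ?_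
  have h1 : dist (g (x + U x)) (g (x + U' x)) ≤ m * ‖U - U'‖ := by
    refine (h _ _).trans (mul_le_mul_of_nonneg_left ?_ hm)
    rw [add_sub_add_left_eq_sub]
    exact (U - U').norm_coe_le_norm x
  exact (dist_triangle _ _ _).trans (add_le_add h1 (he _))

/-- The displacement `U_t = φ_t - id` of the flow of `b` and its Jacobian `V_t = Dφ_t`, as
solutions of a differential equation in spaces of bounded continuous functions. -/
structure IsJet (b : ℝ → CbField 2 d) (J : Set ℝ) (U : ℝ → Euc d →ᵇ Euc d)
    (V : ℝ → Jac d) : Prop where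
  init_fst : U 0 = 0
  init_snd : V 0 = 1
  fst : SolvesODE (fun t U => along (b t).toBdd U) J U
  snd : SolvesODE (fun t V => along (b t).jac (U t) * V) J V

theorem continuousOn_along {g : ℝ → Euc d →ᵇ F} {U : ℝ → Euc d →ᵇ Euc d} {J : Set ℝ} {m : ℝ}
    (hg : ContinuousOn g J) (hm : ∀ t ∈ J, ∀ x y, dist (g t x) (g t y) ≤ m * ‖x - y‖)
    (hm0 : 0 ≤ m) (hU : ContinuousOn U J) : ContinuousOn (fun t => along (g t) (U t)) J := by
  intro t ht
  rw [ContinuousWithinAt, tendsto_iff_dist_tendsto_zero]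
  have h1 : Tendsto (fun s => m * ‖U t - U s‖ + dist (g t) (g s)) (𝓝[J] t) (𝓝 0) := by
    have a := ((continuousWithinAt_const (b := U t)).sub (hU t ht)).norm.const_mul m
    have b := (continuousWithinAt_const (b := g t)).dist (hg t ht)
    have c : ContinuousWithinAt (fun s => m * ‖U t - U s‖ + dist (g t) (g s)) J t := a.add b
    simpa [ContinuousWithinAt] using c
  refine squeeze_zero (fun _ => dist_nonneg) (fun s => ?_) h1
  rw [dist_comm]
  exact dist_along_le hm0 (hm t ht) (fun x => BoundedContinuousFunction.dist_coe_le_dist x) _ _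

/-- The equation for the displacement is globally Lipschitz, and the equation for the Jacobian along
a given displacement is linear. -/
theorem exists_isJet {b : ℝ → CbField 2 d} {T : ℝ} (hT : 0 ≤ T)
    (hb : CbContinuousOn b (Icc 0 T)) : ∃ U V, IsJet b (Icc 0 T) U V := by
  obtain ⟨m, hm, hbm⟩ := hb.exists_bound isCompact_Icc
  lift m to ℝ≥0 using hm.le
  obtain ⟨U, hU0, hU⟩ := exists_solvesODE_of_lipschitz (v := fun t U => along (b t).toBdd U)
    (K := m) hT
    (fun t ht => LipschitzWith.of_dist_le_mul fun U U' => by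
      rw [dist_eq_norm U]
      simpa using dist_along_le (g := (b t).toBdd) (e := 0) m.2
        (CbField.dist_toBdd_le (hbm t ht)) (fun x => by simp) U U')
    (fun U => continuousOn_along hb.continuousOn_toBdd
      (fun t ht => CbField.dist_toBdd_le (hbm t ht)) m.2 continuousOn_const) 0
  have hA : ContinuousOn (fun t => along (b t).jac (U t)) (Icc 0 T) :=
    continuousOn_along hb.continuousOn_jac (fun t ht => CbField.dist_jac_le (hbm t ht)) m.2
      hU.continuousOn
  obtain ⟨V, hV0, hV⟩ := exists_solvesODE_of_lipschitz
    (v := fun t V => along (b t).jac (U t) * V) (K := m) hT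
    (fun t ht => LipschitzWith.of_dist_le_mul fun V V' => by
      rw [dist_eq_norm, dist_eq_norm, ← mul_sub]
      exact (norm_mul_le _ _).trans (mul_le_mul_of_nonneg_right
        (norm_along_jac_le (hbm t ht) _) (norm_nonneg _)))
    (fun V => hA.mul continuousOn_const) 1
  exact ⟨U, V, hU0, hV0, hU, hV⟩

theorem hasDerivWithinAt_apply {G : Type*} [NormedAddCommGroup G] [NormedSpace ℝ G]
    {u : ℝ → Euc d →ᵇ G} {u' : Euc d →ᵇ G} {J : Set ℝ} {t : ℝ} (h : HasDerivWithinAt u u' J t)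
    (x : Euc d) : HasDerivWithinAt (fun s => u s x) (u' x) J t :=
  (BoundedContinuousFunction.evalCLM ℝ x : (Euc d →ᵇ G) →L[ℝ] G).hasFDerivAt.comp_hasDerivWithinAt
    (f := u) t h

namespace IsJet

variable {b : ℝ → CbField 2 d} {U : ℝ → Euc d →ᵇ Euc d}
  {V : ℝ → Jac d} {T m : ℝ}

theorem hasDerivWithinAt_fst {J : Set ℝ} (h : IsJet b J U V) {t : ℝ} (ht : t ∈ J) (x : Euc d) :
    HasDerivWithinAt (fun s => x + U s x) (b t (x + U t x)) J t :=
  (hasDerivWithinAt_apply (h.fst t ht) x).const_add x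

theorem hasDerivWithinAt_snd {J : Set ℝ} (h : IsJet b J U V) {t : ℝ} (ht : t ∈ J) (x : Euc d) :
    HasDerivWithinAt (fun s => V s x) ((fderiv ℝ (b t) (x + U t x)).comp (V t x)) J t :=
  hasDerivWithinAt_apply (h.snd t ht) x

/-- Any flow of `b` is the identity plus the displacement of the jet. -/
theorem flow_unique (h : IsJet b (Icc 0 T) U V) (hm : ∀ t ∈ Icc 0 T, CbNormLE 2 (b t) m)
    {φ : ℝ → C1Map d} (hφ : IsFlow b (Icc 0 T) φ) {t : ℝ} (ht : t ∈ Icc 0 T) (x : Euc d) :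
    φ t x = x + U t x := by
  have hm0 : 0 ≤ m := (norm_nonneg _).trans ((hm t ht).norm_le 0)
  lift m to ℝ≥0 using hm0
  refine ODE_solution_unique_of_mem_Icc_right (v := fun t => b t) (s := fun _ => univ) (K := m)
    (fun t ht => (LipschitzWith.of_dist_le_mul fun x y => ?_).lipschitzOnWith)
    (fun t ht => (hφ.2 t ht x).continuousWithinAt)
    (fun t ht => (hφ.2 t (Ico_subset_Icc_self ht) x).Ici_of_Icc ht) (fun _ _ => mem_univ _)
    (fun t ht => (h.hasDerivWithinAt_fst ht x).continuousWithinAt)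
    (fun t ht => (h.hasDerivWithinAt_fst (Ico_subset_Icc_self ht) x).Ici_of_Icc ht)
    (fun _ _ => mem_univ _) ?_ ht
  · rw [dist_eq_norm, dist_eq_norm]
    exact CbField.lipschitz (hm t (Ico_subset_Icc_self ht)) x y
  · simp [hφ.1, h.init_fst]

theorem dist_flow_le (h : IsJet b (Icc 0 T) U V) (hm : ∀ t ∈ Icc 0 T, CbNormLE 2 (b t) m)
    {t : ℝ} (ht : t ∈ Icc 0 T) (x y : Euc d) :
    ‖(y + U t y) - (x + U t x)‖ ≤ ‖y - x‖ * Real.exp (m * T) := by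
  have hm0 : 0 ≤ m := (norm_nonneg _).trans ((hm t ht).norm_le 0)
  lift m to ℝ≥0 using hm0
  have := dist_le_of_trajectories_ODE_of_mem (v := fun t => b t) (s := fun _ => univ) (K := m)
    (δ := ‖y - x‖) (f := fun t => y + U t y) (g := fun t => x + U t x)
    (fun t ht => (LipschitzWith.of_dist_le_mul fun x y => by
      rw [dist_eq_norm, dist_eq_norm]
      exact CbField.lipschitz (hm t (Ico_subset_Icc_self ht)) x y).lipschitzOnWith)
    (fun t ht => (h.hasDerivWithinAt_fst ht y).continuousWithinAt)
    (fun t ht => (h.hasDerivWithinAt_fst (Ico_subset_Icc_self ht) y).Ici_of_Icc ht)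
    (fun _ _ => mem_univ _)
    (fun t ht => (h.hasDerivWithinAt_fst ht x).continuousWithinAt)
    (fun t ht => (h.hasDerivWithinAt_fst (Ico_subset_Icc_self ht) x).Ici_of_Icc ht)
    (fun _ _ => mem_univ _) (by simp [h.init_fst, dist_eq_norm]) t ht
  rw [dist_eq_norm] at this
  refine this.trans (mul_le_mul_of_nonneg_left (Real.exp_le_exp.2 ?_) (norm_nonneg _))
  rw [sub_zero]
  exact mul_le_mul_of_nonneg_left ht.2 m.2

/-- The second component of a jet is the derivative of the flow in space: the remainder of the first
order expansion solves the linearized equation up to a quadratic error, so that it is quadratically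
small by Grönwall's inequality. -/
theorem hasFDerivAt (h : IsJet b (Icc 0 T) U V) (hm0 : 0 < m)
    (hm : ∀ t ∈ Icc 0 T, CbNormLE 2 (b t) m) {t : ℝ} (ht : t ∈ Icc 0 T) (x : Euc d) :
    HasFDerivAt (fun x => x + U t x) (V t x) x := by
  set M : ℝ := m * Real.exp (m * T) ^ 2 / m * Real.exp (m * T) with hM
  have hM0 : 0 ≤ M := by positivity
  have key : ∀ y, ‖(y + U t y) - (x + U t x) - V t x (y - x)‖ ≤ M * ‖y - x‖ ^ 2 := by
    intro y
    -- `e` bounds the second order Taylor remainder of `b` between the trajectories of `x` and `y`.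
    set e : ℝ := m * (‖y - x‖ * Real.exp (m * T)) ^ 2
    have hd : ∀ s ∈ Icc 0 T, HasDerivWithinAt
        (fun s => (y + U s y) - (x + U s x) - V s x (y - x))
        (b s (y + U s y) - b s (x + U s x) -
          (fderiv ℝ (b s) (x + U s x)) (V s x (y - x))) (Icc 0 T) s := fun s hs =>
      ((h.hasDerivWithinAt_fst hs y).sub (h.hasDerivWithinAt_fst hs x)).sub (by
        have := ((h.hasDerivWithinAt_snd hs x).clm_apply
          (hasDerivWithinAt_const s (Icc 0 T) (y - x)))
        simpa using this)
    have := norm_le_gronwallBound_of_norm_deriv_right_le (δ := 0) (K := m) (ε := e)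
      (fun s hs => (hd s hs).continuousWithinAt)
      (fun s hs => (hd s (Ico_subset_Icc_self hs)).Ici_of_Icc hs)
      (by simp [h.init_fst, h.init_snd]) (fun s hs => ?_) t ht
    · refine this.trans ?_
      simp only [gronwallBound_of_K_ne_0 hm0.ne', zero_mul, zero_add, sub_zero]
      have h1 : Real.exp (m * t) - 1 ≤ Real.exp (m * T) := by
        have : Real.exp (m * t) ≤ Real.exp (m * T) :=
          Real.exp_le_exp.2 (mul_le_mul_of_nonneg_left ht.2 hm0.le)
        linarith
      calc e / m * (Real.exp (m * t) - 1) ≤ e / m * Real.exp (m * T) :=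
            mul_le_mul_of_nonneg_left h1 (by positivity)
        _ = M * ‖y - x‖ ^ 2 := by simp only [hM, e]; ring
    · have hs' := Ico_subset_Icc_self hs
      have h1 := CbField.taylor (hm s hs') (x + U s x) (y + U s y)
      have h2 := h.dist_flow_le hm hs' x y
      have h3 : m * ‖(y + U s y) - (x + U s x)‖ ^ 2 ≤ e :=
        mul_le_mul_of_nonneg_left (pow_le_pow_left₀ (norm_nonneg _) h2 2) hm0.le
      have h4 : ‖fderiv ℝ (b s) (x + U s x) ((y + U s y) - (x + U s x) - V s x (y - x))‖ ≤
          m * ‖(y + U s y) - (x + U s x) - V s x (y - x)‖ :=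
        (ContinuousLinearMap.le_opNorm _ _).trans (mul_le_mul_of_nonneg_right
          ((hm s hs').norm_fderiv_le one_le_two _) (norm_nonneg _))
      calc _ = ‖fderiv ℝ (b s) (x + U s x) ((y + U s y) - (x + U s x) - V s x (y - x)) +
            (b s (y + U s y) - b s (x + U s x) -
              fderiv ℝ (b s) (x + U s x) ((y + U s y) - (x + U s x)))‖ := by
            congr 1
            simp only [map_sub]
            abel
        _ ≤ _ := (norm_add_le _ _).trans (add_le_add h4 (h1.trans h3))
  rw [hasFDerivAt_iff_isLittleO]
  refine Asymptotics.IsBigO.trans_isLittleO (g := fun y => ‖y - x‖ ^ 2)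
    (Asymptotics.IsBigO.of_bound M (Eventually.of_forall fun y => ?_)) ?_
  · simpa using key y
  · exact Asymptotics.isLittleO_norm_pow_id one_lt_two |>.comp_tendsto
      (k := fun y => y - x) (by
        have : Continuous fun y : Euc d => y - x := by fun_prop
        simpa using this.tendsto x)

theorem continuousOn_fst {J : Set ℝ} (h : IsJet b J U V) : ContinuousOn U J := h.fst.continuousOn

theorem continuousOn_snd {J : Set ℝ} (h : IsJet b J U V) : ContinuousOn V J := h.snd.continuousOn

theorem fderiv_flow (h : IsJet b (Icc 0 T) U V) (hb : CbContinuousOn b (Icc 0 T))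
    {φ : ℝ → C1Map d} (hφ : IsFlow b (Icc 0 T) φ) {t : ℝ} (ht : t ∈ Icc 0 T) :
    (∀ x, φ t x = x + U t x) ∧ ∀ x, fderiv ℝ (φ t) x = V t x := by
  obtain ⟨m, hm0, hm⟩ := hb.exists_bound isCompact_Icc
  have h1 := fun x => h.flow_unique hm hφ ht x
  refine ⟨h1, fun x => ?_⟩
  rw [show (φ t : Euc d → Euc d) = fun x => x + U t x from funext h1]
  exact (h.hasFDerivAt hm0 hm ht x).fderiv

theorem exists_flow (h : IsJet b (Icc 0 T) U V) (hb : CbContinuousOn b (Icc 0 T)) (hT : 0 ≤ T) :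
    ∃ φ : ℝ → C1Map d, IsFlow b (Icc 0 T) φ := by
  classical
  obtain ⟨m, hm0, hm⟩ := hb.exists_bound isCompact_Icc
  have hD : ∀ t ∈ Icc 0 T, fderiv ℝ (fun x => x + U t x) = V t := fun t ht =>
    funext fun x => (h.hasFDerivAt hm0 hm ht x).fderiv
  -- The values outside of `[0, T]` do not matter.
  let φ : ℝ → C1Map d := fun t =>
    if ht : t ∈ Icc 0 T then
      { toFun := fun x => x + U t x
        contDiff := contDiff_one_iff_fderiv.2
          ⟨fun x => (h.hasFDerivAt hm0 hm ht x).differentiableAt, by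
            rw [hD t ht]; exact (V t).continuous⟩
        bdd := ⟨‖V t‖, fun x => by rw [hD t ht]; exact (V t).norm_coe_le_norm x⟩ }
    else
      { toFun := id
        contDiff := contDiff_id
        bdd := ⟨1, fun x => by rw [fderiv_id]; exact ContinuousLinearMap.norm_id_le⟩ }
  have hφ : ∀ t ∈ Icc 0 T, ∀ x, φ t x = x + U t x := fun t ht x => by simp only [φ, dif_pos ht]
  refine ⟨φ, fun x => ?_, fun t ht x => ?_⟩
  · rw [hφ 0 (left_mem_Icc.2 hT), h.init_fst]; simp
  · rw [hφ t ht]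
    exact (h.hasDerivWithinAt_fst ht x).congr (fun s hs => hφ s hs x) (hφ t ht x)

end IsJet

end Flow

/-! ### Push-forward by a displacement and a Jacobian -/

section JetPush

variable {d : ℕ}

/-- The field `x ↦ V(x)ᵀ θ(x + U(x))`, which is `φ_♯ θ` if `φ = id + U` and `V = Dφ`. -/
noncomputable def jetField (U : Euc d →ᵇ Euc d) (V : Jac d) (θ : Euc d →ᵇ Euc d) :
    Euc d →ᵇ Euc d :=
  bddField (fun x => ContinuousLinearMap.adjoint (V x) (θ (x + U x)))
    ((ContinuousLinearMap.adjoint.continuous.comp V.continuous).clm_apply (by fun_prop))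
    ⟨‖V‖ * ‖θ‖, fun x => (ContinuousLinearMap.le_opNorm _ _).trans (by
      rw [LinearIsometryEquiv.norm_map]
      exact mul_le_mul (V.norm_coe_le_norm x) (θ.norm_coe_le_norm _) (norm_nonneg _)
        (norm_nonneg _))⟩

theorem jetField_apply (U : Euc d →ᵇ Euc d) (V : Jac d) (θ : Euc d →ᵇ Euc d) (x : Euc d) :
    jetField U V θ x = ContinuousLinearMap.adjoint (V x) (θ (x + U x)) := rfl

theorem norm_adjoint_apply_le (A : Euc d →L[ℝ] Euc d) (v : Euc d) :
    ‖ContinuousLinearMap.adjoint A v‖ ≤ ‖A‖ * ‖v‖ := by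
  have := (ContinuousLinearMap.adjoint A).le_opNorm v
  rwa [LinearIsometryEquiv.norm_map] at this

theorem norm_jetField_le (U : Euc d →ᵇ Euc d) (V : Jac d) (θ : Euc d →ᵇ Euc d) :
    ‖jetField U V θ‖ ≤ ‖V‖ * ‖θ‖ :=
  (BoundedContinuousFunction.norm_le (by positivity)).2 fun x =>
    (norm_adjoint_apply_le _ _).trans (mul_le_mul (V.norm_coe_le_norm x) (θ.norm_coe_le_norm _)
      (norm_nonneg _) (norm_nonneg _))

theorem jetField_add (U : Euc d →ᵇ Euc d) (V : Jac d) (θ η : Euc d →ᵇ Euc d) :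
    jetField U V (θ + η) = jetField U V θ + jetField U V η := by
  ext1 x
  simp [jetField_apply]

theorem jetField_smul (U : Euc d →ᵇ Euc d) (V : Jac d) (c : ℝ) (θ : Euc d →ᵇ Euc d) :
    jetField U V (c • θ) = c • jetField U V θ := by
  ext1 x
  simp [jetField_apply]

/-- The current `θ ↦ ξ(x ↦ V(x)ᵀ θ(x + U(x)))`, which is `φ_♯ ξ` if `φ = id + U` and `V = Dφ`. -/
noncomputable def jetCurrent (ξ : Current d) (U : Euc d →ᵇ Euc d) (V : Jac d) : Current d :=
  ⟨LinearMap.mkContinuous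
    { toFun := fun θ => ξ.1 (jetField U V θ)
      map_add' := fun θ η => by rw [jetField_add, map_add]
      map_smul' := fun c θ => by rw [RingHom.id_apply, jetField_smul, map_smul] }
    (‖ξ.1‖ * ‖V‖) (fun θ => (ξ.1.le_opNorm _).trans (by
      rw [mul_assoc]
      exact mul_le_mul_of_nonneg_left (norm_jetField_le U V θ) (norm_nonneg _))), by
    intro ε hε
    -- The image under `id + U` of a compact set that carries most of `ξ` carries most of the image.
    obtain ⟨K, hK, h⟩ := ξ.2 (ε / (‖V‖ + 1)) (by positivity)
    refine ⟨(fun x => x + U x) '' K, hK.image (by fun_prop), fun θ hθ => ?_⟩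
    have h1 := h (jetField U V θ) fun x hx => by
      rw [jetField_apply, hθ _ (mem_image_of_mem (fun x => x + U x) hx), map_zero]
    refine h1.trans ?_
    calc ε / (‖V‖ + 1) * ‖jetField U V θ‖ ≤ ε / (‖V‖ + 1) * ((‖V‖ + 1) * ‖θ‖) := by
          have := norm_jetField_le U V θ
          gcongr
          nlinarith [norm_nonneg θ]
      _ = ε * ‖θ‖ := by field_simp⟩

theorem jetCurrent_apply (ξ : Current d) (U : Euc d →ᵇ Euc d) (V : Jac d) (θ : Euc d →ᵇ Euc d) :
    (jetCurrent ξ U V).1 θ = ξ.1 (jetField U V θ) := rfl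

theorem norm_jetCurrent_le (ξ : Current d) (U : Euc d →ᵇ Euc d) (V : Jac d) :
    ‖jetCurrent ξ U V‖ ≤ ‖ξ‖ * ‖V‖ :=
  ContinuousLinearMap.opNorm_le_bound _ (mul_nonneg (norm_nonneg ξ.1) (norm_nonneg V)) fun θ =>
    (ξ.1.le_opNorm _).trans (by
      rw [mul_assoc]
      exact mul_le_mul_of_nonneg_left (norm_jetField_le U V θ) (norm_nonneg ξ.1))

theorem pushCurrent_eq_jetCurrent {φ : C1Map d} {U : Euc d →ᵇ Euc d} {V : Jac d}
    (hU : ∀ x, φ x = x + U x) (hV : ∀ x, fderiv ℝ φ x = V x) (ξ : Current d) :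
    pushCurrent φ ξ = jetCurrent ξ U V := by
  refine Subtype.ext (ContinuousLinearMap.ext fun θ => ?_)
  change ξ.1 (pushField φ θ) = ξ.1 (jetField U V θ)
  congr 1
  ext1 x
  rw [pushField_apply, jetField_apply, hU, hV]

/-- The push-forward depends on the displacement and the Jacobian Lipschitz continuously in the
weak norm. -/
theorem weakNorm_jetCurrent_sub_le (ξ : Current d) (U U' : Euc d →ᵇ Euc d) (V V' : Jac d) :
    weakNorm (jetCurrent ξ U V - jetCurrent ξ U' V') ≤
      ‖ξ‖ * (‖V - V'‖ + ‖V'‖ * ‖U - U'‖) := by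
  refine weakNorm_le fun θ L hL hθ => ?_
  have hθ1 : ‖θ‖ ≤ 1 := by linarith [L.coe_nonneg]
  have hL1 : (L : ℝ) ≤ 1 := by linarith [norm_nonneg θ]
  have h1 : ‖jetField U V θ - jetField U' V' θ‖ ≤ ‖V - V'‖ + ‖V'‖ * ‖U - U'‖ := by
    refine (BoundedContinuousFunction.norm_le (by positivity)).2 fun x => ?_
    have h2 : (jetField U V θ - jetField U' V' θ) x =
        ContinuousLinearMap.adjoint (V x - V' x) (θ (x + U x)) +
          ContinuousLinearMap.adjoint (V' x) (θ (x + U x) - θ (x + U' x)) := by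
      simp only [BoundedContinuousFunction.sub_apply, jetField_apply, map_sub, sub_apply]
      abel
    have h3 : ‖θ (x + U x) - θ (x + U' x)‖ ≤ ‖U - U'‖ := by
      have := hL.dist_le_mul (x + U x) (x + U' x)
      rw [dist_eq_norm, dist_eq_norm, add_sub_add_left_eq_sub] at this
      exact this.trans ((mul_le_of_le_one_left (norm_nonneg _) hL1).trans
        ((U - U').norm_coe_le_norm x))
    rw [h2]
    refine (norm_add_le _ _).trans (add_le_add ?_ ?_)
    · refine (norm_adjoint_apply_le _ _).trans ?_
      calc _ ≤ ‖V - V'‖ * 1 := mul_le_mul ((V - V').norm_coe_le_norm x)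
            ((θ.norm_coe_le_norm _).trans hθ1) (norm_nonneg _) (norm_nonneg _)
        _ = _ := mul_one _
    · exact (norm_adjoint_apply_le _ _).trans (mul_le_mul (V'.norm_coe_le_norm x) h3
        (norm_nonneg _) (norm_nonneg _))
  change ξ.1 (jetField U V θ) - ξ.1 (jetField U' V' θ) ≤ _
  rw [← map_sub]
  exact (le_abs_self _).trans ((abs_current_apply_le ξ _).trans
    (mul_le_mul_of_nonneg_left h1 (norm_nonneg ξ)))

theorem weaklyContinuousOn_jetCurrent (ξ : Current d) {U : ℝ → Euc d →ᵇ Euc d} {V : ℝ → Jac d}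
    {J : Set ℝ} (hU : ContinuousOn U J) (hV : ContinuousOn V J) :
    WeaklyContinuousOn (fun t => jetCurrent ξ (U t) (V t)) J := by
  intro t ht
  have h1 : ContinuousWithinAt
      (fun s => ‖ξ‖ * (‖V s - V t‖ + ‖V t‖ * ‖U s - U t‖)) J t :=
    (((hV t ht).sub (continuousWithinAt_const (b := V t))).norm.add
      (((hU t ht).sub (continuousWithinAt_const (b := U t))).norm.const_mul _)).const_mul _
  refine squeeze_zero (fun _ => weakNorm_nonneg _)
    (fun s => weakNorm_jetCurrent_sub_le ξ (U s) (U t) (V s) (V t)) ?_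
  simpa [ContinuousWithinAt] using h1

theorem IsJet.pushCurrent_eq {b : ℝ → CbField 2 d} {U : ℝ → Euc d →ᵇ Euc d} {V : ℝ → Jac d}
    {T : ℝ} (h : IsJet b (Icc 0 T) U V) (hb : CbContinuousOn b (Icc 0 T)) {φ : ℝ → C1Map d}
    (hφ : IsFlow b (Icc 0 T) φ) {t : ℝ} (ht : t ∈ Icc 0 T) (ξ : Current d) :
    pushCurrent (φ t) ξ = jetCurrent ξ (U t) (V t) :=
  have h1 := h.fderiv_flow hb hφ ht
  pushCurrent_eq_jetCurrent h1.1 h1.2 ξ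

/-- The transported current, in terms of the displacement and the Jacobian of the flow. -/
theorem IsJet.isTransported_iff {b : ℝ → CbField 2 d} {U : ℝ → Euc d →ᵇ Euc d} {V : ℝ → Jac d}
    {T : ℝ} (hT : 0 ≤ T) (h : IsJet b (Icc 0 T) U V) (hb : CbContinuousOn b (Icc 0 T))
    {ξ₀ : Current d} {ξ : ℝ → Current d} :
    IsTransported b ξ₀ (Icc 0 T) ξ ↔ ∀ t ∈ Icc 0 T, ξ t = jetCurrent ξ₀ (U t) (V t) := by
  constructor
  · rintro ⟨-, φ, hφ, hξ⟩ t ht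
    rw [hξ t ht, h.pushCurrent_eq hb hφ ht]
  · intro hξ
    obtain ⟨φ, hφ⟩ := h.exists_flow hb hT
    exact ⟨(weaklyContinuousOn_jetCurrent ξ₀ h.continuousOn_fst h.continuousOn_snd).congr hξ,
      φ, hφ, fun t ht => by rw [hξ t ht, h.pushCurrent_eq hb hφ ht]⟩

end JetPush

/-! ### Transported currents solve the transport equation -/

section Lagrangian

variable {d : ℕ} {T : ℝ}

/-- A jointly continuous family of fields is equicontinuous in time over compact sets. -/
theorem exists_modulus_of_continuousOn {f : ℝ → Euc d →ᵇ Euc d}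
    (hc : ContinuousOn (fun p : ℝ × Euc d => f p.1 p.2) (Icc 0 T ×ˢ univ)) {K : Set (Euc d)}
    (hK : IsCompact K) {ε : ℝ} (hε : 0 < ε) :
    ∃ δ > 0, ∀ s ∈ Icc 0 T, ∀ t ∈ Icc 0 T, |s - t| < δ → ∀ x ∈ K, ‖f s x - f t x‖ ≤ ε := by
  have hu := ((isCompact_Icc (a := (0 : ℝ)) (b := T)).prod hK).uniformContinuousOn_of_continuous
    (hc.mono (prod_mono le_rfl (subset_univ K)))
  obtain ⟨δ, hδ, h⟩ := Metric.uniformContinuousOn_iff.1 hu ε hε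
  refine ⟨δ, hδ, fun s hs t ht hst x hx => ?_⟩
  have := h (s, x) ⟨hs, hx⟩ (t, x) ⟨ht, hx⟩ (by
    rw [Prod.dist_eq, dist_self, Real.dist_eq]; simpa [hδ] using hst)
  rw [dist_eq_norm] at this
  exact this.le

theorem eventually_abs_sub_lt_nhdsWithin (J : Set ℝ) (t : ℝ) {δ : ℝ} (hδ : 0 < δ) :
    ∀ᶠ s in 𝓝[J] t, |s - t| < δ :=
  eventually_nhdsWithin_of_eventually_nhds
    (Metric.eventually_nhds_iff.2 ⟨δ, hδ, fun _ h => by rwa [Real.dist_eq] at h⟩)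

/-- Joint continuity of a bounded family suffices: continuity in the uniform norm is not needed,
and may fail for derivatives of test fields along a flow. -/
theorem Current.continuousOn_apply (ξ : Current d) {f : ℝ → Euc d →ᵇ Euc d} {C : ℝ}
    (hC : ∀ t ∈ Icc 0 T, ‖f t‖ ≤ C)
    (hc : ContinuousOn (fun p : ℝ × Euc d => f p.1 p.2) (Icc 0 T ×ˢ univ)) :
    ContinuousOn (fun t => ξ.1 (f t)) (Icc 0 T) := by
  intro t ht
  rw [ContinuousWithinAt, tendsto_iff_norm_sub_tendsto_zero]
  refine Tendsto.congr (fun s => by rw [map_sub]) (tendsto_zero_iff_norm_tendsto_zero.1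
    (Current.tendsto_apply_zero ξ (g := fun s => f s - f t) (C := C + C) ?_ ?_))
  · filter_upwards [self_mem_nhdsWithin] with s hs
    exact (norm_sub_le _ _).trans (add_le_add (hC s hs) (hC t ht))
  · intro K hK ε hε
    obtain ⟨δ, hδ, h⟩ := exists_modulus_of_continuousOn hc hK hε
    filter_upwards [self_mem_nhdsWithin, eventually_abs_sub_lt_nhdsWithin (Icc 0 T) t hδ]
      with s hs hst
    exact fun x hx => h s hs t ht hst x hx

/-- A current may be differentiated along a family of fields whose time derivative is bounded and
jointly continuous: by tightness, locally uniform convergence of the difference quotients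
suffices. -/
theorem Current.hasDerivWithinAt_apply (ξ : Current d) {f f' : ℝ → Euc d →ᵇ Euc d} {C : ℝ}
    (hf : ∀ t ∈ Icc 0 T, ∀ x, HasDerivWithinAt (fun s => f s x) (f' t x) (Icc 0 T) t)
    (hC : ∀ t ∈ Icc 0 T, ‖f' t‖ ≤ C)
    (hc : ContinuousOn (fun p : ℝ × Euc d => f' p.1 p.2) (Icc 0 T ×ˢ univ)) {t : ℝ}
    (ht : t ∈ Icc 0 T) :
    HasDerivWithinAt (fun s => ξ.1 (f s)) (ξ.1 (f' t)) (Icc 0 T) t := by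
  -- The mean value inequality bounds the difference quotients pointwise.
  have hmv : ∀ s ∈ Icc 0 T, ∀ x, ∀ η : ℝ, (∀ r ∈ uIcc t s, ‖f' r x - f' t x‖ ≤ η) →
      ‖f s x - f t x - (s - t) • f' t x‖ ≤ η * ‖s - t‖ := by
    intro s hs x η h
    have hsub : uIcc t s ⊆ Icc 0 T := ordConnected_Icc.uIcc_subset ht hs
    have := (convex_uIcc t s).norm_image_sub_le_of_norm_hasDerivWithin_le
      (f := fun r => f r x - r • f' t x) (f' := fun r => f' r x - f' t x) (C := η)
      (fun r hr => ((hf r (hsub hr) x).mono hsub).sub (by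
        simpa using (hasDerivWithinAt_id r (uIcc t s)).smul_const (f' t x))) h
      left_mem_uIcc right_mem_uIcc
    refine le_trans (le_of_eq ?_) this
    congr 1
    rw [sub_smul]
    abel
  let g : ℝ → Euc d →ᵇ Euc d := fun s => (s - t)⁻¹ • (f s - f t - (s - t) • f' t)
  have hg : ∀ s ∈ Icc 0 T, ∀ x, ∀ η : ℝ, 0 ≤ η → (∀ r ∈ uIcc t s, ‖f' r x - f' t x‖ ≤ η) →
      ‖g s x‖ ≤ η := by
    intro s hs x η hη h
    have h1 : ‖g s x‖ = ‖s - t‖⁻¹ * ‖f s x - f t x - (s - t) • f' t x‖ := by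
      simp only [g, BoundedContinuousFunction.coe_smul, BoundedContinuousFunction.sub_apply,
        norm_smul, norm_inv]
    rw [h1]
    rcases eq_or_lt_of_le (norm_nonneg (s - t)) with h0 | h0
    · rw [← h0]; simpa using hη
    · rw [inv_mul_le_iff₀ h0, mul_comm]
      exact hmv s hs x η h
  have hlim : Tendsto (fun s => ξ.1 (g s)) (𝓝[Icc 0 T] t) (𝓝 0) := by
    have hC0 : 0 ≤ C := (norm_nonneg _).trans (hC t ht)
    refine Current.tendsto_apply_zero ξ (C := C + C) ?_ fun K hK ε hε => ?_
    · filter_upwards [self_mem_nhdsWithin] with s hs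
      refine (BoundedContinuousFunction.norm_le (by positivity)).2 fun x =>
        hg s hs x _ (by positivity) fun r hr => ?_
      exact (norm_sub_le _ _).trans (add_le_add
        (((f' r).norm_coe_le_norm x).trans (hC r (ordConnected_Icc.uIcc_subset ht hs hr)))
        (((f' t).norm_coe_le_norm x).trans (hC t ht)))
    · obtain ⟨δ, hδ, h⟩ := exists_modulus_of_continuousOn hc hK hε
      filter_upwards [self_mem_nhdsWithin, eventually_abs_sub_lt_nhdsWithin (Icc 0 T) t hδ]
        with s hs hst x hx
      refine hg s hs x ε hε.le fun r hr =>
        h r (ordConnected_Icc.uIcc_subset ht hs hr) t ht (lt_of_le_of_lt ?_ hst) x hx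
      exact abs_sub_left_of_mem_uIcc hr
  rw [hasDerivWithinAt_iff_tendsto]
  refine (tendsto_zero_iff_norm_tendsto_zero.1 hlim).congr fun s => ?_
  simp only [g, map_smul, map_sub, smul_eq_mul, norm_mul, norm_inv]

theorem continuousOn_uncurry_bcf {F : Type*} [PseudoMetricSpace F] {J : Set ℝ}
    {g : ℝ → Euc d →ᵇ F} (hg : ContinuousOn g J) :
    ContinuousOn (fun p : ℝ × Euc d => g p.1 p.2) (J ×ˢ univ) :=
  (continuous_eval (F := Euc d →ᵇ F)).comp_continuousOn
    ((hg.comp continuousOn_fst fun _ hp => hp.1).prodMk continuousOn_snd)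

theorem norm_advect_le {θ : CbField 1 d} {b : CbField 2 d} {C m : ℝ}
    (hθ : ∀ x, ‖fderiv ℝ θ x‖ ≤ C) (hb : ∀ x, ‖b x‖ ≤ m) : ‖advect θ b‖ ≤ C * m := by
  have hC : 0 ≤ C := (norm_nonneg _).trans (hθ 0)
  have hm : 0 ≤ m := (norm_nonneg _).trans (hb 0)
  exact (BoundedContinuousFunction.norm_le (by positivity)).2 fun x =>
    ((fderiv ℝ θ x).le_opNorm _).trans (mul_le_mul (hθ x) (hb x) (norm_nonneg _) hC)

theorem norm_stretch_le {θ : CbField 1 d} {b : CbField 2 d} {C m : ℝ}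
    (hθ : ∀ x, ‖θ x‖ ≤ C) (hb : ∀ x, ‖fderiv ℝ b x‖ ≤ m) : ‖stretch b θ‖ ≤ m * C := by
  have hC : 0 ≤ C := (norm_nonneg _).trans (hθ 0)
  have hm : 0 ≤ m := (norm_nonneg _).trans (hb 0)
  exact (BoundedContinuousFunction.norm_le (by positivity)).2 fun x =>
    (norm_adjoint_apply_le _ _).trans (mul_le_mul (hb x) (hθ x) (norm_nonneg _) hm)

theorem advect_apply (θ : CbField 1 d) (b : CbField 2 d) (x : Euc d) :
    advect θ b x = fderiv ℝ θ x (b x) := rfl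

theorem stretch_apply (b : CbField 2 d) (θ : CbField 1 d) (x : Euc d) :
    stretch b θ x = ContinuousLinearMap.adjoint (fderiv ℝ b x) (θ x) := rfl

/-- Transported currents are weak solutions of the transport equation. -/
theorem IsTransported.isLinearWeakSolution {b : ℝ → CbField 2 d} {ξ₀ : Current d}
    {ξ : ℝ → Current d} (hT : 0 ≤ T) (hb : CbContinuousOn b (Icc 0 T))
    (h : IsTransported b ξ₀ (Icc 0 T) ξ) : IsLinearWeakSolution b ξ₀ (Icc 0 T) ξ := by
  obtain ⟨U, V, hUV⟩ := exists_isJet hT hb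
  obtain ⟨m, hm0, hm⟩ := hb.exists_bound isCompact_Icc
  have hξ := (hUV.isTransported_iff hT hb).1 h
  obtain ⟨A, hA⟩ := isCompact_Icc.exists_bound_of_continuousOn hUV.continuousOn_snd
  have hA0 : 0 ≤ A := (norm_nonneg _).trans (hA 0 (left_mem_Icc.2 hT))
  have hflow : ContinuousOn (fun p : ℝ × Euc d => (p.1, p.2 + U p.1 p.2)) (Icc 0 T ×ˢ univ) :=
    continuousOn_fst.prodMk
      (continuousOn_snd.add (continuousOn_uncurry_bcf hUV.continuousOn_fst))
  have hjet : ∀ a : ℝ → Euc d →ᵇ Euc d,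
      ContinuousOn (fun p : ℝ × Euc d => a p.1 p.2) (Icc 0 T ×ˢ univ) →
      ContinuousOn (fun p : ℝ × Euc d => jetField (U p.1) (V p.1) (a p.1) p.2)
        (Icc 0 T ×ˢ univ) := fun a ha =>
    (ContinuousLinearMap.adjoint.continuous.comp_continuousOn
      (continuousOn_uncurry_bcf hUV.continuousOn_snd)).clm_apply
      (ha.comp hflow fun p hp => ⟨hp.1, mem_univ _⟩)
  have hb0 := continuousOn_uncurry_bcf hb.continuousOn_toBdd
  have hb1 := continuousOn_uncurry_bcf hb.continuousOn_jac
  have hadv : ∀ θ : CbField 1 d,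
      ContinuousOn (fun p : ℝ × Euc d => advect θ (b p.1) p.2) (Icc 0 T ×ˢ univ) := fun θ =>
    ((θ.continuous_fderiv le_rfl).comp_continuousOn continuousOn_snd).clm_apply hb0
  have hstr : ∀ θ : CbField 1 d,
      ContinuousOn (fun p : ℝ × Euc d => stretch (b p.1) θ p.2) (Icc 0 T ×ˢ univ) := fun θ =>
    (ContinuousLinearMap.adjoint.continuous.comp_continuousOn hb1).clm_apply
      (θ.contDiff.continuous.comp_continuousOn continuousOn_snd)
  have hbound : ∀ (a : ℝ → Euc d →ᵇ Euc d) (C : ℝ), (∀ t ∈ Icc 0 T, ‖a t‖ ≤ C) →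
      ∀ t ∈ Icc 0 T, ‖jetField (U t) (V t) (a t)‖ ≤ A * C := fun a C ha t ht =>
    (norm_jetField_le _ _ _).trans (mul_le_mul (hA t ht) (ha t ht) (norm_nonneg _) hA0)
  have hcont : ∀ (a : ℝ → Euc d →ᵇ Euc d) (C : ℝ), (∀ t ∈ Icc 0 T, ‖a t‖ ≤ C) →
      ContinuousOn (fun p : ℝ × Euc d => a p.1 p.2) (Icc 0 T ×ˢ univ) →
      ContinuousOn (fun s => (ξ s).1 (a s)) (Icc 0 T) := by
    intro a C ha hac
    refine (Current.continuousOn_apply ξ₀ (hbound a C ha) (hjet a hac)).congr fun s hs => ?_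
    simp only [hξ s hs, jetCurrent_apply]
  have hint : ∀ θ : CbField 1 d, ∀ t ∈ Icc 0 T,
      IntervalIntegrable (fun s => (ξ s).1 (advect θ (b s))) volume 0 t ∧
      IntervalIntegrable (fun s => (ξ s).1 (stretch (b s) θ)) volume 0 t := by
    intro θ t ht
    obtain ⟨C₀, hC₀⟩ := θ.bounded
    obtain ⟨C₁, hC₁⟩ := θ.bounded_fderiv le_rfl
    have hsub : uIcc 0 t ⊆ Icc 0 T := by rw [uIcc_of_le ht.1]; exact Icc_subset_Icc_right ht.2
    exact ⟨((hcont _ _ (fun s hs => norm_advect_le hC₁ (hm s hs).norm_le) (hadv θ)).mono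
        hsub).intervalIntegrable,
      ((hcont _ _ (fun s hs => norm_stretch_le hC₀ ((hm s hs).norm_fderiv_le one_le_two))
        (hstr θ)).mono hsub).intervalIntegrable⟩
  refine ⟨h.weaklyContinuous, fun t ht => ⟨‖ξ₀‖ * A, fun s hs => ?_⟩, hint, fun θ t ht => ?_⟩
  · have hs' : s ∈ Icc 0 T := ⟨hs.1, hs.2.trans ht.2⟩
    rw [hξ s hs']
    exact (norm_jetCurrent_le _ _ _).trans (mul_le_mul_of_nonneg_left (hA s hs') (norm_nonneg ξ₀))
  · obtain ⟨C₀, hC₀⟩ := θ.bounded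
    obtain ⟨C₁, hC₁⟩ := θ.bounded_fderiv le_rfl
    set a : ℝ → Euc d →ᵇ Euc d := fun s => advect θ (b s) + stretch (b s) θ with ha
    have haC : ∀ s ∈ Icc 0 T, ‖a s‖ ≤ C₁ * m + m * C₀ := fun s hs =>
      (norm_add_le _ _).trans (add_le_add (norm_advect_le hC₁ (hm s hs).norm_le)
        (norm_stretch_le hC₀ ((hm s hs).norm_fderiv_le one_le_two)))
    have hac : ContinuousOn (fun p : ℝ × Euc d => a p.1 p.2) (Icc 0 T ×ˢ univ) :=
      (hadv θ).add (hstr θ)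
    have hder : ∀ s ∈ Icc 0 T, ∀ x, HasDerivWithinAt
        (fun s => jetField (U s) (V s) θ.toBdd x) (jetField (U s) (V s) (a s) x) (Icc 0 T) s := by
      intro s hs x
      have h1 : HasDerivWithinAt (fun s => θ (x + U s x))
          (fderiv ℝ θ (x + U s x) (b s (x + U s x))) (Icc 0 T) s :=
        ((θ.contDiff.differentiable one_ne_zero _).hasFDerivAt).comp_hasDerivWithinAt s
          (hUV.hasDerivWithinAt_fst hs x)
      have h2 : HasDerivWithinAt (fun s => ContinuousLinearMap.adjoint (V s x))
          (ContinuousLinearMap.adjoint ((fderiv ℝ (b s) (x + U s x)).comp (V s x)))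
          (Icc 0 T) s :=
        ((ContinuousLinearMap.adjoint (𝕜 := ℝ) (E := Euc d) (F := Euc d)
          ).toContinuousLinearEquiv.toContinuousLinearMap.hasFDerivAt
          ).comp_hasDerivWithinAt (f := fun s => V s x) s (hUV.hasDerivWithinAt_snd hs x)
      refine (h2.clm_apply h1).congr_deriv ?_
      rw [jetField_apply, ha]
      simp only [BoundedContinuousFunction.add_apply, map_add, advect_apply, stretch_apply,
        ContinuousLinearMap.adjoint_comp, ContinuousLinearMap.comp_apply]
      abel
    -- The field `φ_♯ θ` has the time derivative `φ_♯ (Dθ · b + (Db)ᵀ θ)`.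
    have hderiv := fun s (hs : s ∈ Icc 0 T) =>
      Current.hasDerivWithinAt_apply ξ₀ hder (hbound a _ haC) (hjet a hac) hs
    have hsub : Icc 0 t ⊆ Icc 0 T := Icc_subset_Icc_right ht.2
    have hFTC := intervalIntegral.integral_eq_sub_of_hasDerivAt_of_le ht.1
      (fun s hs => (hderiv s (hsub hs)).continuousWithinAt.mono hsub)
      (fun s hs => (hderiv s (hsub (Ioo_subset_Icc_self hs))).hasDerivAt
        (Icc_mem_nhds hs.1 (hs.2.trans_le ht.2)))
      (((Current.continuousOn_apply ξ₀ (hbound a _ haC) (hjet a hac)).mono (by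
        rw [uIcc_of_le ht.1]; exact hsub)).intervalIntegrable)
    have h0 : jetField (U 0) (V 0) θ.toBdd = θ.toBdd := by
      ext1 x
      simp only [jetField_apply, hUV.init_fst, hUV.init_snd, BoundedContinuousFunction.coe_zero,
        Pi.zero_apply, add_zero, BoundedContinuousFunction.coe_one, Pi.one_apply]
      change ContinuousLinearMap.adjoint (ContinuousLinearMap.id ℝ (Euc d)) (θ.toBdd x) = _
      rw [ContinuousLinearMap.adjoint_id]
      rfl
    have hsum : ∫ s in (0 : ℝ)..t, ξ₀.1 (jetField (U s) (V s) (a s)) =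
        (∫ s in (0 : ℝ)..t, (ξ s).1 (advect θ (b s))) +
          ∫ s in (0 : ℝ)..t, (ξ s).1 (stretch (b s) θ) := by
      rw [← intervalIntegral.integral_add (hint θ t ht).1 (hint θ t ht).2]
      refine intervalIntegral.integral_congr fun s hs => ?_
      rw [uIcc_of_le ht.1] at hs
      simp only [hξ s (hsub hs), jetCurrent_apply, ha, jetField_add, map_add]
    rw [hsum, h0] at hFTC
    rw [hξ t ht, jetCurrent_apply]
    linarith

end Lagrangian

/-! ### Maps with bounded Lipschitz derivative -/

section C11

variable {E F G : Type*} [NormedAddCommGroup E] [NormedSpace ℝ E] [NormedAddCommGroup F]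
  [NormedSpace ℝ F] [NormedAddCommGroup G] [NormedSpace ℝ G]

/-- `f` is of class `C^{1,1}`: `f` is bounded by `c₀` and its derivative is bounded by `c₁` and
Lipschitz with constant `c₂`. -/
structure C11Bound (f : E → F) (c₀ c₁ c₂ : ℝ) : Prop where
  diff : Differentiable ℝ f
  norm_le : ∀ x, ‖f x‖ ≤ c₀
  norm_fderiv_le : ∀ x, ‖fderiv ℝ f x‖ ≤ c₁
  lipschitz_fderiv : ∀ x y, ‖fderiv ℝ f x - fderiv ℝ f y‖ ≤ c₂ * ‖x - y‖

namespace C11Bound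

variable {f : E → F} {c₀ c₁ c₂ : ℝ}

theorem nonneg_zero (h : C11Bound f c₀ c₁ c₂) : 0 ≤ c₀ := (norm_nonneg _).trans (h.norm_le 0)

theorem nonneg_one (h : C11Bound f c₀ c₁ c₂) : 0 ≤ c₁ :=
  (norm_nonneg _).trans (h.norm_fderiv_le 0)

theorem lipschitz (h : C11Bound f c₀ c₁ c₂) (x y : E) : ‖f x - f y‖ ≤ c₁ * ‖x - y‖ :=
  norm_sub_le_of_norm_fderiv_le h.diff h.norm_fderiv_le x y

theorem mono (h : C11Bound f c₀ c₁ c₂) {c₀' c₁' c₂' : ℝ} (h₀ : c₀ ≤ c₀') (h₁ : c₁ ≤ c₁')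
    (h₂ : c₂ ≤ c₂') : C11Bound f c₀' c₁' c₂' :=
  ⟨h.diff, fun x => (h.norm_le x).trans h₀, fun x => (h.norm_fderiv_le x).trans h₁,
    fun x y => (h.lipschitz_fderiv x y).trans (mul_le_mul_of_nonneg_right h₂ (norm_nonneg _))⟩

theorem add_smul (h : C11Bound f c₀ c₁ c₂) {g : E → F} {c₀' c₁' c₂' : ℝ}
    (h' : C11Bound g c₀' c₁' c₂') {r : ℝ} (hr : 0 ≤ r) :
    C11Bound (fun x => f x + r • g x) (c₀ + r * c₀') (c₁ + r * c₁') (c₂ + r * c₂') := by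
  have hd : ∀ x, fderiv ℝ (fun x => f x + r • g x) x = fderiv ℝ f x + r • fderiv ℝ g x := fun x =>
    ((h.diff x).hasFDerivAt.add ((h'.diff x).hasFDerivAt.const_smul r)).fderiv
  refine ⟨h.diff.add (h'.diff.const_smul r), fun x => ?_, fun x => ?_, fun x y => ?_⟩
  · refine (norm_add_le _ _).trans (add_le_add (h.norm_le x) ?_)
    rw [norm_smul, Real.norm_eq_abs, abs_of_nonneg hr]
    exact mul_le_mul_of_nonneg_left (h'.norm_le x) hr
  · rw [hd]
    refine (norm_add_le _ _).trans (add_le_add (h.norm_fderiv_le x) ?_)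
    rw [norm_smul, Real.norm_eq_abs, abs_of_nonneg hr]
    exact mul_le_mul_of_nonneg_left (h'.norm_fderiv_le x) hr
  · rw [hd, hd, add_sub_add_comm, ← smul_sub, add_mul, mul_assoc]
    refine (norm_add_le _ _).trans (add_le_add (h.lipschitz_fderiv x y) ?_)
    rw [norm_smul, Real.norm_eq_abs, abs_of_nonneg hr]
    exact mul_le_mul_of_nonneg_left (h'.lipschitz_fderiv x y) hr

/-- Composition with a map with bounded Lipschitz derivative. -/
theorem comp (h : C11Bound f c₀ c₁ c₂) {χ : G → E} {a e : ℝ} (hχ : Differentiable ℝ χ)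
    (ha : ∀ x, ‖fderiv ℝ χ x‖ ≤ a) (he : ∀ x y, ‖fderiv ℝ χ x - fderiv ℝ χ y‖ ≤ e * ‖x - y‖)
    (hc₂ : 0 ≤ c₂) : C11Bound (fun x => f (χ x)) c₀ (c₁ * a) (c₂ * a ^ 2 + c₁ * e) := by
  have ha0 : 0 ≤ a := (norm_nonneg _).trans (ha 0)
  have hd : ∀ x, fderiv ℝ (fun x => f (χ x)) x = (fderiv ℝ f (χ x)).comp (fderiv ℝ χ x) := fun x =>
    fderiv_comp x (h.diff _) (hχ x)
  refine ⟨h.diff.comp hχ, fun x => h.norm_le _, fun x => ?_, fun x y => ?_⟩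
  · rw [hd]
    exact (ContinuousLinearMap.opNorm_comp_le _ _).trans
      (mul_le_mul (h.norm_fderiv_le _) (ha x) (norm_nonneg _) h.nonneg_one)
  · have h1 : fderiv ℝ (fun x => f (χ x)) x - fderiv ℝ (fun x => f (χ x)) y =
        (fderiv ℝ f (χ x) - fderiv ℝ f (χ y)).comp (fderiv ℝ χ x) +
          (fderiv ℝ f (χ y)).comp (fderiv ℝ χ x - fderiv ℝ χ y) := by
      rw [hd, hd, ContinuousLinearMap.sub_comp, ContinuousLinearMap.comp_sub]
      abel
    have h2 : ‖fderiv ℝ f (χ x) - fderiv ℝ f (χ y)‖ ≤ c₂ * (a * ‖x - y‖) :=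
      (h.lipschitz_fderiv _ _).trans (mul_le_mul_of_nonneg_left
        (norm_sub_le_of_norm_fderiv_le hχ ha x y) hc₂)
    rw [h1]
    calc _ ≤ c₂ * (a * ‖x - y‖) * a + c₁ * (e * ‖x - y‖) :=
          (norm_add_le _ _).trans (add_le_add
            ((ContinuousLinearMap.opNorm_comp_le _ _).trans
              (mul_le_mul h2 (ha x) (norm_nonneg _) (by positivity)))
            ((ContinuousLinearMap.opNorm_comp_le _ _).trans
              (mul_le_mul (h.norm_fderiv_le _) (he x y) (norm_nonneg _) h.nonneg_one)))
      _ = _ := by ring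

/-- The product rule for a field of operators applied to a vector field. -/
theorem clm_apply {A : G → E →L[ℝ] F} {u : G → E} {a₀ a₁ a₂ u₀ u₁ u₂ : ℝ}
    (hA : C11Bound A a₀ a₁ a₂) (hu : C11Bound u u₀ u₁ u₂) (ha₂ : 0 ≤ a₂) :
    C11Bound (fun x => A x (u x)) (a₀ * u₀) (a₀ * u₁ + a₁ * u₀)
      (a₂ * u₀ + 2 * (a₁ * u₁) + a₀ * u₂) := by
  have hd : ∀ x, fderiv ℝ (fun x => A x (u x)) x =
      (A x).comp (fderiv ℝ u x) + (fderiv ℝ A x).flip (u x) := fun x =>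
    ((hA.diff x).hasFDerivAt.clm_apply (hu.diff x).hasFDerivAt).fderiv
  have hflip : ∀ (L : G →L[ℝ] E →L[ℝ] F) (v : E), ‖L.flip v‖ ≤ ‖L‖ * ‖v‖ := fun L v => by
    simpa using L.flip.le_opNorm v
  refine ⟨hA.diff.clm_apply hu.diff, fun x => ?_, fun x => ?_, fun x y => ?_⟩
  · exact ((A x).le_opNorm _).trans
      (mul_le_mul (hA.norm_le x) (hu.norm_le x) (norm_nonneg _) hA.nonneg_zero)
  · rw [hd]
    refine (norm_add_le _ _).trans (add_le_add ?_ ?_)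
    · exact (ContinuousLinearMap.opNorm_comp_le _ _).trans
        (mul_le_mul (hA.norm_le x) (hu.norm_fderiv_le x) (norm_nonneg _) hA.nonneg_zero)
    · exact (hflip _ _).trans
        (mul_le_mul (hA.norm_fderiv_le x) (hu.norm_le x) (norm_nonneg _) hA.nonneg_one)
  · have h1 : fderiv ℝ (fun x => A x (u x)) x - fderiv ℝ (fun x => A x (u x)) y =
        ((A x - A y).comp (fderiv ℝ u x) + (A y).comp (fderiv ℝ u x - fderiv ℝ u y)) +
          ((fderiv ℝ A x - fderiv ℝ A y).flip (u x) + (fderiv ℝ A y).flip (u x - u y)) := by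
      rw [hd, hd]
      ext v
      simp only [add_apply, sub_apply, ContinuousLinearMap.comp_apply,
        ContinuousLinearMap.flip_apply, map_sub]
      abel
    rw [h1]
    calc _ ≤ (a₁ * ‖x - y‖ * u₁ + a₀ * (u₂ * ‖x - y‖)) +
          (a₂ * ‖x - y‖ * u₀ + a₁ * (u₁ * ‖x - y‖)) := by
          refine (norm_add_le _ _).trans (add_le_add
            ((norm_add_le _ _).trans (add_le_add ?_ ?_))
            ((norm_add_le _ _).trans (add_le_add ?_ ?_)))
          · exact (ContinuousLinearMap.opNorm_comp_le _ _).trans (mul_le_mul (hA.lipschitz x y)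
              (hu.norm_fderiv_le x) (norm_nonneg _) (mul_nonneg hA.nonneg_one (norm_nonneg _)))
          · exact (ContinuousLinearMap.opNorm_comp_le _ _).trans (mul_le_mul (hA.norm_le y)
              (hu.lipschitz_fderiv x y) (norm_nonneg _) hA.nonneg_zero)
          · exact (hflip _ _).trans (mul_le_mul (hA.lipschitz_fderiv x y)
              (hu.norm_le x) (norm_nonneg _) (mul_nonneg ha₂ (norm_nonneg _)))
          · exact (hflip _ _).trans (mul_le_mul (hA.norm_fderiv_le y)
              (hu.lipschitz x y) (norm_nonneg _) hA.nonneg_one)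
      _ = _ := by ring

theorem taylor (h : C11Bound f c₀ c₁ c₂) (hc₂ : 0 ≤ c₂) (x v : E) :
    ‖f (x + v) - f x - fderiv ℝ f x v‖ ≤ c₂ * ‖v‖ ^ 2 := by
  simpa using norm_taylor_le h.diff hc₂ h.lipschitz_fderiv x (x + v)

theorem continuous_fderiv (h : C11Bound f c₀ c₁ c₂) : Continuous (fderiv ℝ f) :=
  (LipschitzWith.of_dist_le_mul (K := Real.toNNReal c₂) fun x y => by
    rw [dist_eq_norm, dist_eq_norm]
    exact (h.lipschitz_fderiv x y).trans
      (mul_le_mul_of_nonneg_right (Real.le_coe_toNNReal _) (norm_nonneg _))).continuous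

end C11Bound

/-- A `C^{1,1}` field as a test field. -/
noncomputable def C11Bound.toCbField {d : ℕ} {f : Euc d → Euc d} {c₀ c₁ c₂ : ℝ}
    (h : C11Bound f c₀ c₁ c₂) : CbField 1 d where
  toFun := f
  contDiff := contDiff_one_iff_fderiv.2 ⟨h.diff, h.continuous_fderiv⟩
  bdd := ⟨max c₀ c₁, fun j hj x => by
    interval_cases j
    · rw [norm_iteratedFDeriv_zero]; exact (h.norm_le x).trans (le_max_left _ _)
    · rw [norm_iteratedFDeriv_one]; exact (h.norm_fderiv_le x).trans (le_max_right _ _)⟩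

end C11

/-! ### Mollification -/

section Mollify

variable {d : ℕ} {F : Type*} [NormedAddCommGroup F] [NormedSpace ℝ F]

/-- The convolution of `f` with the bump function `φ` of integral one. -/
noncomputable def mollify (φ : ContDiffBump (0 : Euc d)) (f : Euc d → F) : Euc d → F :=
  convolution (φ.normed volume) f (ContinuousLinearMap.lsmul ℝ ℝ) volume

variable (φ : ContDiffBump (0 : Euc d)) {f : Euc d → F} {C L : ℝ}

theorem mollify_apply (x : Euc d) : mollify φ f x = ∫ y, φ.normed volume y • f (x - y) := rfl

theorem integrable_mollify (hf : Continuous f) (x : Euc d) :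
    Integrable fun y => φ.normed volume y • f (x - y) :=
  Continuous.integrable_of_hasCompactSupport
    (φ.continuous_normed.smul (hf.comp (continuous_const.sub continuous_id)))
    φ.hasCompactSupport_normed.smul_right

theorem norm_mollify_le (hC : ∀ x, ‖f x‖ ≤ C) (x : Euc d) : ‖mollify φ f x‖ ≤ C := by
  rw [mollify_apply]
  refine (norm_integral_le_of_norm_le ((φ.integrable_normed (μ := volume)).mul_const C)
    (Eventually.of_forall fun y => ?_)).trans (le_of_eq ?_)
  · rw [norm_smul, Real.norm_eq_abs, abs_of_nonneg (φ.nonneg_normed y)]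
    exact mul_le_mul_of_nonneg_left (hC _) (φ.nonneg_normed y)
  · rw [integral_mul_const, φ.integral_normed, one_mul]

theorem norm_mollify_sub_le [CompleteSpace F] (hf : Continuous f) (hL : 0 ≤ L)
    (h : ∀ x y, ‖f x - f y‖ ≤ L * ‖x - y‖) (x : Euc d) :
    ‖mollify φ f x - f x‖ ≤ L * φ.rOut := by
  rw [← dist_eq_norm]
  refine φ.dist_normed_convolution_le hf.aestronglyMeasurable fun y hy => ?_
  rw [dist_eq_norm]
  refine (h y x).trans (mul_le_mul_of_nonneg_left ?_ hL)
  rw [← dist_eq_norm]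
  exact (Metric.mem_ball.1 hy).le

/-- Mollification commutes with differentiation. -/
theorem hasFDerivAt_mollify (hf : Differentiable ℝ f) (hf' : Continuous (fderiv ℝ f))
    (hC : ∀ x, ‖fderiv ℝ f x‖ ≤ C) (x : Euc d) :
    HasFDerivAt (mollify φ f) (mollify φ (fderiv ℝ f) x) x := by
  refine hasFDerivAt_integral_of_dominated_of_fderiv_le (𝕜 := ℝ) (s := univ)
    (F := fun x y => φ.normed volume y • f (x - y))
    (F' := fun x y => φ.normed volume y • fderiv ℝ f (x - y))
    (bound := fun y => φ.normed volume y * C) univ_mem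
    (Eventually.of_forall fun z => (integrable_mollify φ hf.continuous z).aestronglyMeasurable)
    (integrable_mollify φ hf.continuous x) (integrable_mollify φ hf' x).aestronglyMeasurable
    (Eventually.of_forall fun y z _ => ?_) ((φ.integrable_normed (μ := volume)).mul_const C)
    (Eventually.of_forall fun y z _ => ?_)
  · rw [norm_smul, Real.norm_eq_abs, abs_of_nonneg (φ.nonneg_normed y)]
    exact mul_le_mul_of_nonneg_left (hC _) (φ.nonneg_normed y)
  · exact (((hf (z - y)).hasFDerivAt.comp z ((hasFDerivAt_id z).sub_const y)).congr_fderiv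
      (ContinuousLinearMap.comp_id _)).const_smul (φ.normed volume y)

/-- The mollification of a bounded function is Lipschitz, with a constant that depends on the
mollifier and on the bound only. -/
theorem lipschitz_mollify (hf : Continuous f) (hC : ∀ x, ‖f x‖ ≤ C) (x y : Euc d) :
    ‖mollify φ f x - mollify φ f y‖ ≤
      (∫ t, ‖fderiv ℝ (φ.normed volume) t‖) * C * ‖x - y‖ := by
  have hφ1 : ContDiff ℝ 1 (φ.normed volume) := φ.contDiff_normed
  have hd := fun x => φ.hasCompactSupport_normed.hasFDerivAt_convolution_left
    (ContinuousLinearMap.lsmul ℝ ℝ) hφ1 (hf.locallyIntegrable (μ := volume)) x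
  have hint : Integrable fun t => ‖fderiv ℝ (φ.normed volume) t‖ :=
    ((hφ1.continuous_fderiv one_ne_zero).integrable_of_hasCompactSupport
      (φ.hasCompactSupport_normed.fderiv ℝ)).norm
  refine norm_sub_le_of_norm_fderiv_le (fun x => (hd x).differentiableAt) (fun x => ?_) x y
  rw [(hd x).fderiv, ← integral_mul_const]
  refine norm_integral_le_of_norm_le (hint.mul_const C) (Eventually.of_forall fun t => ?_)
  refine ContinuousLinearMap.opNorm_le_bound _
    (mul_nonneg (norm_nonneg _) ((norm_nonneg _).trans (hC 0))) fun v => ?_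
  rw [ContinuousLinearMap.precompL_apply, ContinuousLinearMap.lsmul_apply, norm_smul,
    mul_right_comm]
  exact mul_le_mul (ContinuousLinearMap.le_opNorm _ _) (hC _) (norm_nonneg _) (by positivity)

/-- Fields of class `C_b^2` are approximated in `C_b^1` by fields with Lipschitz second derivative,
uniformly over bounded sets of `C_b^2`. -/
theorem exists_smooth_approx (d : ℕ) {m ε : ℝ} (hm : 0 ≤ m) (hε : 0 < ε) :
    ∃ q, m ≤ q ∧ ∀ b : CbField 2 d, CbNormLE 2 b m → ∃ β : Euc d → Euc d,
      C11Bound β m m m ∧ C11Bound (fderiv ℝ β) m m q ∧ (∀ x, ‖b x - β x‖ ≤ ε) ∧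
        ∀ x, ‖fderiv ℝ b x - fderiv ℝ β x‖ ≤ ε := by
  -- A kernel of radius `ε / (m + 1)` moves `m`-Lipschitz functions by less than `ε`.
  have hr : 0 < ε / (m + 1) := by positivity
  let φ : ContDiffBump (0 : Euc d) := ⟨ε / (m + 1) / 2, ε / (m + 1), half_pos hr, half_lt_self hr⟩
  have hmr : m * φ.rOut ≤ ε := by
    change m * (ε / (m + 1)) ≤ ε
    rw [mul_div_assoc', div_le_iff₀ (by positivity)]
    nlinarith
  refine ⟨max m ((∫ t, ‖fderiv ℝ (φ.normed volume) t‖) * m), le_max_left _ _, fun b hb => ?_⟩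
  have hc0 : Continuous b := b.contDiff.continuous
  have hc1 := b.continuous_fderiv one_le_two
  have hc2 : Continuous (fderiv ℝ (fderiv ℝ b)) :=
    (b.contDiff.fderiv_right (m := 1) (by norm_num)).continuous_fderiv one_ne_zero
  have hd1 := hasFDerivAt_mollify φ b.differentiable hc1 (hb.norm_fderiv_le one_le_two)
  have hd2 := hasFDerivAt_mollify φ b.differentiable_fderiv hc2 hb.norm_fderiv_fderiv_le
  have e1 : fderiv ℝ (mollify φ b) = mollify φ (fderiv ℝ b) := funext fun x => (hd1 x).fderiv
  have e2 : fderiv ℝ (mollify φ (fderiv ℝ b)) = mollify φ (fderiv ℝ (fderiv ℝ b)) :=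
    funext fun x => (hd2 x).fderiv
  refine ⟨mollify φ b, ⟨fun x => (hd1 x).differentiableAt, norm_mollify_le φ hb.norm_le, ?_, ?_⟩,
    ?_, fun x => ?_, fun x => ?_⟩
  · rw [e1]; exact norm_mollify_le φ (hb.norm_fderiv_le one_le_two)
  · rw [e1]
    exact norm_sub_le_of_norm_fderiv_le (fun x => (hd2 x).differentiableAt)
      (by rw [e2]; exact norm_mollify_le φ hb.norm_fderiv_fderiv_le)
  · rw [e1]
    refine ⟨fun x => (hd2 x).differentiableAt, norm_mollify_le φ (hb.norm_fderiv_le one_le_two),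
      ?_, fun x y => ?_⟩
    · rw [e2]; exact norm_mollify_le φ hb.norm_fderiv_fderiv_le
    · rw [e2]
      exact (lipschitz_mollify φ hc2 hb.norm_fderiv_fderiv_le x y).trans
        (mul_le_mul_of_nonneg_right (le_max_right _ _) (norm_nonneg _))
  · rw [norm_sub_rev]
    exact (norm_mollify_sub_le φ hc0 hm (CbField.lipschitz hb) x).trans hmr
  · rw [norm_sub_rev, e1]
    exact (norm_mollify_sub_le φ hc1 hm (CbField.lipschitz_fderiv hb) x).trans hmr

end Mollify

/-! ### Uniqueness for the transport equation -/

section Pull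

variable {d : ℕ}

/-- The pull-back `θ ↦ (Dχ)ᵀ θ(χ)` of a field by the Euler step `χ = id + h β`. -/
noncomputable def eulerPull (h : ℝ) (β θ : Euc d → Euc d) (x : Euc d) : Euc d :=
  θ (x + h • β x) + h • ContinuousLinearMap.adjoint (fderiv ℝ β x) (θ (x + h • β x))

theorem C11Bound.adjoint {A : Euc d → Euc d →L[ℝ] Euc d} {a₀ a₁ a₂ : ℝ}
    (hA : C11Bound A a₀ a₁ a₂) :
    C11Bound (fun x => ContinuousLinearMap.adjoint (A x)) a₀ a₁ a₂ := by
  let L : (Euc d →L[ℝ] Euc d) →L[ℝ] (Euc d →L[ℝ] Euc d) :=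
    (ContinuousLinearMap.adjoint (𝕜 := ℝ) (E := Euc d) (F := Euc d)
      ).toContinuousLinearEquiv.toContinuousLinearMap
  have hL : ∀ B, ‖L B‖ = ‖B‖ := fun B =>
    LinearIsometryEquiv.norm_map (ContinuousLinearMap.adjoint (𝕜 := ℝ) (E := Euc d) (F := Euc d)) B
  have hcomp : ∀ D : Euc d →L[ℝ] (Euc d →L[ℝ] Euc d), ‖L.comp D‖ ≤ ‖D‖ := fun D =>
    ContinuousLinearMap.opNorm_le_bound _ (norm_nonneg D) fun v => by
      rw [ContinuousLinearMap.comp_apply, hL]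
      exact D.le_opNorm v
  have hd : ∀ x, HasFDerivAt (fun x => ContinuousLinearMap.adjoint (A x))
      (L.comp (fderiv ℝ A x)) x := fun x => L.hasFDerivAt.comp x (hA.diff x).hasFDerivAt
  refine ⟨fun x => (hd x).differentiableAt, fun x => (hL _).trans_le (hA.norm_le x), fun x => ?_,
    fun x y => ?_⟩
  · rw [(hd x).fderiv]
    exact (hcomp _).trans (hA.norm_fderiv_le x)
  · rw [(hd x).fderiv, (hd y).fderiv, ← ContinuousLinearMap.comp_sub]
    exact (hcomp _).trans (hA.lipschitz_fderiv x y)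

/-- Under an Euler step of length `h`, the `C^1` bounds of a field grow by a factor that depends on
the `C^2` norm of `β` only, and the Lipschitz constant of its derivative grows by a factor that
depends on the Lipschitz constant of the second derivative of `β`, too. -/
theorem C11Bound.eulerPull {β θ : Euc d → Euc d} {m q n p h : ℝ} (hβ : C11Bound β m m m)
    (hβ' : C11Bound (fderiv ℝ β) m m q) (hmq : m ≤ q) (hθ : C11Bound θ n n p) (hnp : n ≤ p)
    (hh : 0 ≤ h) :
    C11Bound (eulerPull h β θ) (n * Real.exp (3 * m * h)) (n * Real.exp (3 * m * h))
      (p * Real.exp (7 * q * h)) := by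
  have hm := hβ.nonneg_zero
  have hn := hθ.nonneg_zero
  have hq := hm.trans hmq
  have hp := hn.trans hnp
  have hd : ∀ x, HasFDerivAt (fun x => x + h • β x)
      (ContinuousLinearMap.id ℝ (Euc d) + h • fderiv ℝ β x) x := fun x =>
    (hasFDerivAt_id x).add ((hβ.diff x).hasFDerivAt.const_smul h)
  have hu := hθ.comp (χ := fun x => x + h • β x) (a := 1 + h * m) (e := h * m)
    (fun x => (hd x).differentiableAt)
    (fun x => by
      rw [(hd x).fderiv]
      refine (norm_add_le _ _).trans (add_le_add ContinuousLinearMap.norm_id_le ?_)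
      rw [norm_smul, Real.norm_eq_abs, abs_of_nonneg hh]
      exact mul_le_mul_of_nonneg_left (hβ.norm_fderiv_le x) hh)
    (fun x y => by
      rw [(hd x).fderiv, (hd y).fderiv, add_sub_add_left_eq_sub, ← smul_sub, norm_smul,
        Real.norm_eq_abs, abs_of_nonneg hh, mul_assoc]
      exact mul_le_mul_of_nonneg_left (hβ.lipschitz_fderiv x y) hh) hp
  have hw := hβ'.adjoint.clm_apply hu hq
  have hx : 0 ≤ h * m := mul_nonneg hh hm
  have hy : 0 ≤ h * q := mul_nonneg hh hq
  have hxy : h * m ≤ h * q := mul_le_mul_of_nonneg_left hmq hh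
  have he : ∀ (z : ℝ) (k : ℕ), 0 ≤ z → (1 + z) ^ k ≤ Real.exp (k * z) := fun z k hz => by
    rw [Real.exp_nat_mul]
    exact pow_le_pow_left₀ (by positivity) (by linarith [Real.add_one_le_exp z]) k
  have he3 : (1 + h * m) ^ 3 ≤ Real.exp (3 * m * h) := by
    have := he (h * m) 3 hx
    rwa [show ((3 : ℕ) : ℝ) * (h * m) = 3 * m * h by push_cast; ring] at this
  have he7 : (1 + h * q) ^ 7 ≤ Real.exp (7 * q * h) := by
    have := he (h * q) 7 hy
    rwa [show ((7 : ℕ) : ℝ) * (h * q) = 7 * q * h by push_cast; ring] at this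
  -- The bounds of the Euler step are polynomials in `h m` and `h q`, which `(1 + h m) ^ 3` and
  -- `(1 + h q) ^ 7` dominate coefficientwise.
  refine (hu.add_smul hw hh).mono ?_ ?_ ?_
  · refine le_trans ?_ (mul_le_mul_of_nonneg_left he3 hn)
    have : n + h * (m * n) = n * (1 + h * m) := by ring
    rw [this]
    exact mul_le_mul_of_nonneg_left (by nlinarith [pow_nonneg hx 2, pow_nonneg hx 3]) hn
  · refine le_trans ?_ (mul_le_mul_of_nonneg_left he3 hn)
    have : n * (1 + h * m) + h * (m * (n * (1 + h * m)) + m * n) =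
      n * (1 + 3 * (h * m) + (h * m) ^ 2) := by ring
    rw [this]
    exact mul_le_mul_of_nonneg_left (by nlinarith [pow_nonneg hx 2, pow_nonneg hx 3]) hn
  · refine le_trans ?_ (mul_le_mul_of_nonneg_left he7 hp)
    set x := h * m with hxdef
    set y := h * q with hydef
    have e1 : p * (1 + x) ^ 2 + n * x + h * (q * n + 2 * (m * (n * (1 + x))) +
        m * (p * (1 + x) ^ 2 + n * x)) =
        p * (1 + x) ^ 2 + n * x + (y * n + 2 * (x * (n * (1 + x))) +
          x * (p * (1 + x) ^ 2 + n * x)) := by rw [hxdef, hydef]; ring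
    have e2 : p * (1 + x) ^ 2 + n * x + (y * n + 2 * (x * (n * (1 + x))) +
          x * (p * (1 + x) ^ 2 + n * x)) ≤
        p * (1 + y) ^ 2 + p * y + (y * p + 2 * (y * (p * (1 + y))) +
          y * (p * (1 + y) ^ 2 + p * y)) := by gcongr
    have e3 : p * (1 + y) ^ 2 + p * y + (y * p + 2 * (y * (p * (1 + y))) +
          y * (p * (1 + y) ^ 2 + p * y)) = p * (1 + 7 * y + 6 * y ^ 2 + y ^ 3) := by ring
    have e4 : 1 + 7 * y + 6 * y ^ 2 + y ^ 3 ≤ (1 + y) ^ 7 := by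
      have : (1 + y) ^ 7 = 1 + 7 * y + 21 * y ^ 2 + 35 * y ^ 3 + 35 * y ^ 4 + 21 * y ^ 5 +
        7 * y ^ 6 + y ^ 7 := by ring
      rw [this]
      have h2 := pow_nonneg hy 2
      have h3 := pow_nonneg hy 3
      have h4 := pow_nonneg hy 4
      have h5 := pow_nonneg hy 5
      have h6 := pow_nonneg hy 6
      have h7 := pow_nonneg hy 7
      linarith
    rw [e1]
    exact e2.trans (e3.trans_le (mul_le_mul_of_nonneg_left e4 hp))

/-- The Lie derivative `Dθ · β + (Dβ)ᵀ θ` of `θ`, as a 1-form, along `β`. -/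
noncomputable def lieField {β θ : Euc d → Euc d} {m n p q : ℝ} (hβ : C11Bound β m m q)
    (hθ : C11Bound θ n n p) : Euc d →ᵇ Euc d :=
  bddField (fun x => fderiv ℝ θ x (β x) + ContinuousLinearMap.adjoint (fderiv ℝ β x) (θ x))
    ((hθ.continuous_fderiv.clm_apply hβ.diff.continuous).add
      ((ContinuousLinearMap.adjoint.continuous.comp hβ.continuous_fderiv).clm_apply
        hθ.diff.continuous))
    ⟨n * m + m * n, fun x => (norm_add_le _ _).trans (add_le_add
      (((fderiv ℝ θ x).le_opNorm _).trans (mul_le_mul (hθ.norm_fderiv_le x) (hβ.norm_le x)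
        (norm_nonneg _) hθ.nonneg_zero))
      ((norm_adjoint_apply_le _ _).trans (mul_le_mul (hβ.norm_fderiv_le x) (hθ.norm_le x)
        (norm_nonneg _) hβ.nonneg_zero)))⟩

theorem lieField_apply {β θ : Euc d → Euc d} {m n p q : ℝ} (hβ : C11Bound β m m q)
    (hθ : C11Bound θ n n p) (x : Euc d) : lieField hβ hθ x =
      fderiv ℝ θ x (β x) + ContinuousLinearMap.adjoint (fderiv ℝ β x) (θ x) := rfl

theorem norm_lieField_apply_le {β θ : Euc d → Euc d} {m n p q : ℝ} (hβ : C11Bound β m m q)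
    (hθ : C11Bound θ n n p) (x : Euc d) : ‖lieField hβ hθ x‖ ≤ n * m + m * n := by
  rw [lieField_apply]
  exact (norm_add_le _ _).trans (add_le_add
    (((fderiv ℝ θ x).le_opNorm _).trans (mul_le_mul (hθ.norm_fderiv_le x) (hβ.norm_le x)
      (norm_nonneg _) hθ.nonneg_zero))
    ((norm_adjoint_apply_le _ _).trans (mul_le_mul (hβ.norm_fderiv_le x) (hθ.norm_le x)
      (norm_nonneg _) hβ.nonneg_zero)))

/-- The Lie derivative of a `C^{1,1}` field is Lipschitz, so that the weak norm controls the action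
of a current on it. -/
theorem norm_lieField_sub_le {β θ : Euc d → Euc d} {m n p q : ℝ} (hβ : C11Bound β m m q)
    (hθ : C11Bound θ n n p) (hp : 0 ≤ p) (hq : 0 ≤ q) (x y : Euc d) :
    ‖lieField hβ hθ x - lieField hβ hθ y‖ ≤ (p * m + n * m + (q * n + m * n)) * ‖x - y‖ := by
  have h1 : lieField hβ hθ x - lieField hβ hθ y =
      ((fderiv ℝ θ x - fderiv ℝ θ y) (β x) + fderiv ℝ θ y (β x - β y)) +
      (ContinuousLinearMap.adjoint (fderiv ℝ β x - fderiv ℝ β y) (θ x) +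
        ContinuousLinearMap.adjoint (fderiv ℝ β y) (θ x - θ y)) := by
    simp only [lieField_apply, map_sub, sub_apply]
    abel
  rw [h1]
  calc _ ≤ (p * ‖x - y‖ * m + n * (m * ‖x - y‖)) +
        (q * ‖x - y‖ * n + m * (n * ‖x - y‖)) := by
        refine (norm_add_le _ _).trans (add_le_add ((norm_add_le _ _).trans (add_le_add ?_ ?_))
          ((norm_add_le _ _).trans (add_le_add ?_ ?_)))
        · exact (ContinuousLinearMap.le_opNorm _ _).trans (mul_le_mul (hθ.lipschitz_fderiv x y)
            (hβ.norm_le x) (norm_nonneg _) (by positivity))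
        · exact (ContinuousLinearMap.le_opNorm _ _).trans (mul_le_mul (hθ.norm_fderiv_le y)
            (hβ.lipschitz x y) (norm_nonneg _) hθ.nonneg_zero)
        · exact (norm_adjoint_apply_le _ _).trans (mul_le_mul (hβ.lipschitz_fderiv x y)
            (hθ.norm_le x) (norm_nonneg _) (by positivity))
        · exact (norm_adjoint_apply_le _ _).trans (mul_le_mul (hβ.norm_fderiv_le y)
            (hθ.lipschitz x y) (norm_nonneg _) hβ.nonneg_zero)
    _ = _ := by ring

/-- The Lie derivative is the first order term of the Euler step. -/
theorem norm_eulerPull_sub_le {β θ : Euc d → Euc d} {m n p q h : ℝ} (hβ : C11Bound β m m q)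
    (hθ : C11Bound θ n n p) (hp : 0 ≤ p) (hh : 0 ≤ h) (x : Euc d) :
    ‖eulerPull h β θ x - θ x - h • lieField hβ hθ x‖ ≤ (m ^ 2 * p + m ^ 2 * n) * h ^ 2 := by
  have hm := hβ.nonneg_zero
  have hn := hθ.nonneg_zero
  have h1 : eulerPull h β θ x - θ x - h • lieField hβ hθ x =
      (θ (x + h • β x) - θ x - fderiv ℝ θ x (h • β x)) +
        h • ContinuousLinearMap.adjoint (fderiv ℝ β x) (θ (x + h • β x) - θ x) := by
    simp only [eulerPull, lieField_apply, map_sub, map_smul, smul_add, smul_sub]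
    abel
  have hv : ‖h • β x‖ ≤ h * m := by
    rw [norm_smul, Real.norm_eq_abs, abs_of_nonneg hh]
    exact mul_le_mul_of_nonneg_left (hβ.norm_le x) hh
  have h2 : ‖θ (x + h • β x) - θ x‖ ≤ n * (h * m) := by
    refine (hθ.lipschitz _ _).trans (mul_le_mul_of_nonneg_left ?_ hn)
    rwa [add_sub_cancel_left]
  rw [h1]
  calc _ ≤ p * (h * m) ^ 2 + h * (m * (n * (h * m))) := by
        refine (norm_add_le _ _).trans (add_le_add ?_ ?_)
        · exact (hθ.taylor hp x _).trans
            (mul_le_mul_of_nonneg_left (pow_le_pow_left₀ (norm_nonneg _) hv 2) hp)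
        · rw [norm_smul, Real.norm_eq_abs, abs_of_nonneg hh]
          exact mul_le_mul_of_nonneg_left ((norm_adjoint_apply_le _ _).trans
            (mul_le_mul (hβ.norm_fderiv_le x) h2 (norm_nonneg _) hm)) hh
    _ = _ := by ring

end Pull

section Uniqueness

variable {d : ℕ}

/-- A bounded weak solution on `[0, T]` of the transport equation with zero initial datum. -/
structure IsNullSolution (b : ℝ → CbField 2 d) (T M : ℝ) (ζ : ℝ → Current d) : Prop where
  weaklyContinuous : WeaklyContinuousOn ζ (Icc 0 T)
  norm_le : ∀ t ∈ Icc 0 T, ‖ζ t‖ ≤ M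
  integrable : ∀ θ : CbField 1 d, ∀ t ∈ Icc 0 T,
    IntervalIntegrable (fun s => (ζ s).1 (advect θ (b s) + stretch (b s) θ)) volume 0 t
  weak : ∀ θ : CbField 1 d, ∀ t ∈ Icc 0 T,
    (ζ t).1 θ.toBdd = ∫ s in (0 : ℝ)..t, (ζ s).1 (advect θ (b s) + stretch (b s) θ)

namespace IsNullSolution

variable {b : ℝ → CbField 2 d} {T M : ℝ} {ζ : ℝ → Current d}

/-- The error of one time step, in which the test field is pulled back by an Euler step along a
field `β` close to `b`. The constant `η` measures the distance from `b` to `β`, and `w` the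
oscillation of the solution in the weak norm. -/
theorem one_step (hζ : IsNullSolution b T M ζ) {s h : ℝ} (hs : 0 ≤ s) (hh : 0 ≤ h)
    (hsT : s + h ≤ T) {β : Euc d → Euc d} {m q η w : ℝ} (hβ : C11Bound β m m m)
    (hβ' : C11Bound (fderiv ℝ β) m m q) (hmq : m ≤ q)
    (hη : ∀ r ∈ Icc s (s + h), ∀ x, ‖b r x - β x‖ ≤ η)
    (hη' : ∀ r ∈ Icc s (s + h), ∀ x, ‖fderiv ℝ (b r) x - fderiv ℝ β x‖ ≤ η)
    (hw : ∀ r ∈ Icc s (s + h), weakNorm (ζ r - ζ s) ≤ w)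
    {θ : Euc d → Euc d} {n p : ℝ} (hθ : C11Bound θ n n p) (hnp : n ≤ p) :
    |(ζ (s + h)).1 hθ.toCbField.toBdd -
        (ζ s).1 (hβ.eulerPull hβ' hmq hθ hnp hh).toCbField.toBdd| ≤
      h * (2 * M * η * n + (6 * w * q + 2 * M * h * q ^ 2) * p) := by
  have hm := hβ.nonneg_zero
  have hn := hθ.nonneg_zero
  have hq := hm.trans hmq
  have hp := hn.trans hnp
  have hsh : s ≤ s + h := by linarith
  have hsI : s ∈ Icc 0 T := ⟨hs, hsh.trans hsT⟩
  have hshI : s + h ∈ Icc 0 T := ⟨hs.trans hsh, hsT⟩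
  have hη0 : 0 ≤ η := (norm_nonneg _).trans (hη s (left_mem_Icc.2 hsh) 0)
  have hw0 : 0 ≤ w := (weakNorm_nonneg _).trans (hw s (left_mem_Icc.2 hsh))
  have hM0 : 0 ≤ M := (norm_nonneg (ζ s)).trans (hζ.norm_le s hsI)
  set Θ := hθ.toCbField with hΘ
  set a := lieField hβ hθ with ha
  have hpt : ∀ r ∈ Icc s (s + h),
      |(ζ r).1 (advect Θ (b r) + stretch (b r) Θ) - (ζ s).1 a| ≤
        2 * M * η * n + 6 * w * q * p := by
    intro r hr
    have hrI : r ∈ Icc 0 T := ⟨hs.trans hr.1, hr.2.trans hsT⟩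
    have h1 : ‖advect Θ (b r) + stretch (b r) Θ - a‖ ≤ n * η + η * n := by
      refine (BoundedContinuousFunction.norm_le (by positivity)).2 fun x => ?_
      have : (advect Θ (b r) + stretch (b r) Θ - a) x = fderiv ℝ θ x (b r x - β x) +
          ContinuousLinearMap.adjoint (fderiv ℝ (b r) x - fderiv ℝ β x) (θ x) := by
        simp only [BoundedContinuousFunction.sub_apply, BoundedContinuousFunction.add_apply,
          advect_apply, stretch_apply, ha, lieField_apply, map_sub, sub_apply]
        change fderiv ℝ θ x (b r x) + ContinuousLinearMap.adjoint (fderiv ℝ (b r) x) (θ x) - _ = _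
        abel
      rw [this]
      exact (norm_add_le _ _).trans (add_le_add
        (((fderiv ℝ θ x).le_opNorm _).trans (mul_le_mul (hθ.norm_fderiv_le x) (hη r hr x)
          (norm_nonneg _) hn))
        ((norm_adjoint_apply_le _ _).trans (mul_le_mul (hη' r hr x) (hθ.norm_le x)
          (norm_nonneg _) hη0)))
    have h2 : |(ζ r).1 (advect Θ (b r) + stretch (b r) Θ - a)| ≤ M * (n * η + η * n) :=
      (abs_current_apply_le _ _).trans (mul_le_mul (hζ.norm_le r hrI) h1 (norm_nonneg _) hM0)
    have h3 : |(ζ r - ζ s).1 a| ≤ w * (6 * q * p) := by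
      have h31 := abs_apply_le_weakNorm (ζ r - ζ s) (norm_lieField_apply_le hβ hθ)
        (by positivity) (norm_lieField_sub_le hβ hθ hp hm)
      refine h31.trans (mul_le_mul (hw r hr) ?_ (by positivity) hw0)
      have e1 : n * m ≤ p * q := mul_le_mul hnp hmq hm hp
      have e2 : p * m ≤ p * q := mul_le_mul_of_nonneg_left hmq hp
      linarith
    have h4 : (ζ r).1 (advect Θ (b r) + stretch (b r) Θ) - (ζ s).1 a =
        (ζ r).1 (advect Θ (b r) + stretch (b r) Θ - a) + (ζ r - ζ s).1 a := by
      rw [map_sub]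
      change _ = _ - _ + ((ζ r).1 a - (ζ s).1 a)
      ring
    rw [h4]
    refine (abs_add_le _ _).trans ((add_le_add h2 h3).trans (le_of_eq ?_))
    ring
  have hinc : (ζ (s + h)).1 Θ.toBdd - (ζ s).1 Θ.toBdd - h * (ζ s).1 a =
      ∫ r in s..(s + h), ((ζ r).1 (advect Θ (b r) + stretch (b r) Θ) - (ζ s).1 a) := by
    rw [intervalIntegral.integral_sub
      ((hζ.integrable Θ s hsI).symm.trans (hζ.integrable Θ _ hshI)) intervalIntegrable_const,
      ← intervalIntegral.integral_interval_sub_left (hζ.integrable Θ _ hshI)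
        (hζ.integrable Θ s hsI), ← hζ.weak Θ _ hshI, ← hζ.weak Θ s hsI,
      intervalIntegral.integral_const, smul_eq_mul, add_sub_cancel_left]
  have hint : |(ζ (s + h)).1 Θ.toBdd - (ζ s).1 Θ.toBdd - h * (ζ s).1 a| ≤
      (2 * M * η * n + 6 * w * q * p) * h := by
    rw [hinc]
    have := intervalIntegral.norm_integral_le_of_norm_le_const (a := s) (b := s + h)
      (C := 2 * M * η * n + 6 * w * q * p)
      (f := fun r => (ζ r).1 (advect Θ (b r) + stretch (b r) Θ) - (ζ s).1 a)
      (fun r hr => hpt r (by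
        rw [uIoc_of_le hsh] at hr
        exact Ioc_subset_Icc_self hr))
    rwa [add_sub_cancel_left, abs_of_nonneg hh, Real.norm_eq_abs] at this
  set P := (hβ.eulerPull hβ' hmq hθ hnp hh).toCbField with hP
  have hpull : |(ζ s).1 (P.toBdd - Θ.toBdd - h • a)| ≤ M * ((q ^ 2 * p + q ^ 2 * p) * h ^ 2) := by
    refine (abs_current_apply_le _ _).trans (mul_le_mul (hζ.norm_le s hsI) ?_ (norm_nonneg _) hM0)
    refine (BoundedContinuousFunction.norm_le (by positivity)).2 fun x => ?_
    refine (norm_eulerPull_sub_le hβ hθ hp hh x).trans ?_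
    gcongr
  rw [map_sub, map_sub, map_smul, smul_eq_mul] at hpull
  calc _ = |((ζ (s + h)).1 Θ.toBdd - (ζ s).1 Θ.toBdd - h * (ζ s).1 a) -
        ((ζ s).1 P.toBdd - (ζ s).1 Θ.toBdd - h * (ζ s).1 a)| := by congr 1; ring
    _ ≤ _ := (abs_sub _ _).trans (add_le_add hint hpull)
    _ = _ := by ring

/-- Iteration of the time steps: by the zero initial datum, the value at a test field is bounded by
the sum of the errors made when the field is pulled back step by step to the time zero. The term
with `η` involves the `C^1` bound of the pulled back fields, which is independent of `q`. The
`C^{1,1}` bound, which is not, enters only the terms that are small with `w` and `h`. -/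
theorem iterate (hζ : IsNullSolution b T M ζ) {h : ℝ} (hh : 0 ≤ h) {m q η w : ℝ} (hmq : m ≤ q)
    (hm : 0 ≤ m) (hη : 0 ≤ η) (hw : 0 ≤ w) (hM : 0 ≤ M) {N : ℕ} (hN : N * h ≤ T)
    (hβ : ∀ s ∈ Icc 0 T, ∃ β : Euc d → Euc d, C11Bound β m m m ∧ C11Bound (fderiv ℝ β) m m q ∧
      ∀ r ∈ Icc 0 T, |r - s| ≤ h →
        (∀ x, ‖b r x - β x‖ ≤ η) ∧ ∀ x, ‖fderiv ℝ (b r) x - fderiv ℝ β x‖ ≤ η)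
    (hζw : ∀ s ∈ Icc 0 T, ∀ r ∈ Icc 0 T, |r - s| ≤ h → weakNorm (ζ r - ζ s) ≤ w) (k : ℕ)
    (hk : k ≤ N) (θ : Euc d → Euc d) (n p : ℝ) (hθ : C11Bound θ n n p) (hnp : n ≤ p) :
    |(ζ (k * h)).1 hθ.toCbField.toBdd| ≤
      k * h * (2 * M * η * (n * Real.exp (3 * m * (k * h))) +
        (6 * w * q + 2 * M * h * q ^ 2) * (p * Real.exp (7 * q * (k * h)))) := by
  induction k generalizing θ n p with
  | zero =>
    have hT : 0 ≤ T := le_trans (by positivity) hN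
    simp [hζ.weak hθ.toCbField 0 (left_mem_Icc.2 hT)]
  | succ k ih =>
    have hn := hθ.nonneg_zero
    have hp := hn.trans hnp
    have hq := hm.trans hmq
    have hkh : 0 ≤ k * h := by positivity
    have hk1 : ((k + 1 : ℕ) : ℝ) * h = k * h + h := by push_cast; ring
    have hkT : k * h + h ≤ T := by
      rw [← hk1]
      exact (mul_le_mul_of_nonneg_right (by exact_mod_cast hk) hh).trans hN
    have hsub : Icc (k * h) (k * h + h) ⊆ Icc 0 T := Icc_subset_Icc hkh hkT
    have hkI : (k : ℝ) * h ∈ Icc 0 T := hsub (left_mem_Icc.2 (by linarith))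
    obtain ⟨β, hβ1, hβ2, hβ3⟩ := hβ _ hkI
    have hdist : ∀ r ∈ Icc (k * h) (k * h + h), |r - k * h| ≤ h := fun r hr => by
      rw [abs_of_nonneg (by linarith [hr.1])]
      linarith [hr.2]
    have h1 := hζ.one_step hkh hh hkT hβ1 hβ2 hmq
      (fun r hr => (hβ3 r (hsub hr) (hdist r hr)).1) (fun r hr => (hβ3 r (hsub hr) (hdist r hr)).2)
      (fun r hr => hζw _ hkI r (hsub hr) (hdist r hr)) hθ hnp
    have hnp' : n * Real.exp (3 * m * h) ≤ p * Real.exp (7 * q * h) := by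
      refine mul_le_mul hnp (Real.exp_le_exp.2 ?_) (Real.exp_pos _).le hp
      nlinarith
    have h2 := ih (by omega) _ _ _ (hβ1.eulerPull hβ2 hmq hθ hnp hh) hnp'
    rw [mul_assoc n, mul_assoc p, ← Real.exp_add, ← Real.exp_add, ← mul_add, ← mul_add,
      add_comm h] at h2
    rw [hk1]
    set X := 2 * M * η
    set Y := 6 * w * q + 2 * M * h * q ^ 2
    have hX : 0 ≤ X := by positivity
    have hY : 0 ≤ Y := by positivity
    set A := Real.exp (3 * m * (k * h + h))
    set A' := Real.exp (7 * q * (k * h + h))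
    have hA : 1 ≤ A := Real.one_le_exp (by positivity)
    have hA' : 1 ≤ A' := Real.one_le_exp (by positivity)
    have h3 : h * (X * n + Y * p) ≤ h * (X * (n * A) + Y * (p * A')) := by
      gcongr
      · exact le_mul_of_one_le_right hn hA
      · exact le_mul_of_one_le_right hp hA'
    have h4 := abs_sub_abs_le_abs_sub ((ζ (k * h + h)).1 hθ.toCbField.toBdd)
      ((ζ (k * h)).1 (hβ1.eulerPull hβ2 hmq hθ hnp hh).toCbField.toBdd)
    calc _ ≤ k * h * (X * (n * A) + Y * (p * A')) + h * (X * (n * A) + Y * (p * A')) := by linarith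
      _ = _ := by ring

end IsNullSolution

theorem le_of_forall_pos_le_add_mul {a A B : ℝ} (h : ∀ w > 0, a ≤ A + w * B) : a ≤ A := by
  have hlim : Tendsto (fun w : ℝ => A + w * B) (𝓝[>] 0) (𝓝 A) := by
    have : Continuous fun w : ℝ => A + w * B := by fun_prop
    simpa using (this.tendsto 0).mono_left nhdsWithin_le_nhds
  exact ge_of_tendsto hlim (by filter_upwards [self_mem_nhdsWithin] with w hw using h w hw)

/-- Smooth compactly supported fields have the bounds that are propagated by the Euler steps. -/
theorem C11Bound.exists_of_contDiff {θ : Euc d → Euc d} (hθ : ContDiff ℝ 3 θ)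
    (hc : HasCompactSupport θ) : ∃ n p, n ≤ p ∧ C11Bound θ n n p := by
  have h1 : ContDiff ℝ 2 (fderiv ℝ θ) := hθ.fderiv_right (by norm_num)
  obtain ⟨C₀, hC₀⟩ := hc.exists_bound_of_continuous hθ.continuous
  obtain ⟨C₁, hC₁⟩ := (hc.fderiv ℝ).exists_bound_of_continuous h1.continuous
  obtain ⟨C₂, hC₂⟩ := h1.lipschitzWith_of_hasCompactSupport (hc.fderiv ℝ) two_ne_zero
  refine ⟨max C₀ C₁, max (max C₀ C₁) C₂, le_max_left _ _, hθ.differentiable (by norm_num),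
    fun x => (hC₀ x).trans (le_max_left _ _), fun x => (hC₁ x).trans (le_max_right _ _),
    fun x y => ?_⟩
  have := hC₂.dist_le_mul x y
  rw [dist_eq_norm, dist_eq_norm] at this
  exact this.trans (mul_le_mul_of_nonneg_right (le_max_right _ _) (norm_nonneg _))

theorem CbContinuousOn.uniform {b : ℝ → CbField 2 d} {J : Set ℝ} (hb : CbContinuousOn b J)
    (hJ : IsCompact J) {ε : ℝ} (hε : 0 < ε) : ∃ δ > 0, ∀ s ∈ J, ∀ r ∈ J, |r - s| < δ →
      (∀ x, ‖b r x - b s x‖ ≤ ε) ∧ ∀ x, ‖fderiv ℝ (b r) x - fderiv ℝ (b s) x‖ ≤ ε := by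
  obtain ⟨δ₁, hδ₁, h1⟩ := Metric.uniformContinuousOn_iff.1
    (hJ.uniformContinuousOn_of_continuous hb.continuousOn_toBdd) ε hε
  obtain ⟨δ₂, hδ₂, h2⟩ := Metric.uniformContinuousOn_iff.1
    (hJ.uniformContinuousOn_of_continuous hb.continuousOn_jac) ε hε
  refine ⟨min δ₁ δ₂, lt_min hδ₁ hδ₂, fun s hs r hr hrs => ⟨fun x => ?_, fun x => ?_⟩⟩
  · have := h1 r hr s hs (by rw [Real.dist_eq]; exact hrs.trans_le (min_le_left _ _))
    rw [dist_eq_norm] at this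
    exact (((b r).toBdd - (b s).toBdd).norm_coe_le_norm x).trans this.le
  · have := h2 r hr s hs (by rw [Real.dist_eq]; exact hrs.trans_le (min_le_right _ _))
    rw [dist_eq_norm] at this
    exact (((b r).jac - (b s).jac).norm_coe_le_norm x).trans this.le

/-- Bounded weak solutions with zero initial datum vanish. In the estimate of `iterate`, the step
length and the oscillation `w` of the solution tend to zero first, for fixed `η` and hence fixed
`q`. Then `η` tends to zero, where the remaining factor does not depend on `q`. -/
theorem IsNullSolution.eq_zero {b : ℝ → CbField 2 d} {T M : ℝ} {ζ : ℝ → Current d}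
    (hζ : IsNullSolution b T M ζ) (hb : CbContinuousOn b (Icc 0 T)) {t : ℝ} (ht : t ∈ Icc 0 T) :
    ζ t = 0 := by
  obtain ⟨m, hm0, hm⟩ := hb.exists_bound isCompact_Icc
  have hM : 0 ≤ M := (norm_nonneg (ζ t)).trans (hζ.norm_le t ht)
  refine Current.eq_zero_of_forall_smooth _ fun θ hθ hθc => ?_
  obtain ⟨n, p, hnp, hθ'⟩ := C11Bound.exists_of_contDiff hθ hθc
  have key : ∀ η > 0, ∃ q ≥ m, ∀ w > 0, |(ζ t).1 hθ'.toCbField.toBdd| ≤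
      t * (2 * M * η * (n * Real.exp (3 * m * t)) +
        (6 * w * q + 2 * M * w * q ^ 2) * (p * Real.exp (7 * q * t))) := by
    intro η hη
    obtain ⟨q, hmq, hq⟩ := exists_smooth_approx d hm0.le (half_pos hη)
    refine ⟨q, hmq, fun w hw => ?_⟩
    obtain ⟨δ₁, hδ₁, h1⟩ := hb.uniform isCompact_Icc (half_pos hη)
    obtain ⟨δ₂, hδ₂, h2⟩ := hζ.weaklyContinuous.uniform isCompact_Icc hw
    -- The time step is at most `w`, and both the drift and the solution vary little within it.
    set δ := min w (min δ₁ δ₂) with hδ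
    have hδ0 : 0 < δ := lt_min hw (lt_min hδ₁ hδ₂)
    obtain ⟨N, hN⟩ := exists_nat_gt (t / δ)
    have hN0 : (0 : ℝ) < N := lt_of_le_of_lt (div_nonneg ht.1 hδ0.le) hN
    have hh0 : 0 ≤ t / N := div_nonneg ht.1 hN0.le
    have hNh : N * (t / N) = t := by field_simp
    have hhδ : t / N < δ := by
      rw [div_lt_iff₀ hδ0] at hN
      rw [div_lt_iff₀ hN0]
      linarith
    have := hζ.iterate (h := t / N) hh0 (η := η) (w := w) hmq hm0.le hη.le hw.le hM (N := N)
      (hNh.trans_le ht.2) (fun s hs => ?_)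
      (fun s hs r hr hrs => h2 r hr s hs (hrs.trans_lt (hhδ.trans_le
        ((min_le_right _ _).trans (min_le_right _ _))))) N le_rfl θ n p hθ' hnp
    · rw [hNh] at this
      have hn := hθ'.nonneg_zero
      have hp := hn.trans hnp
      refine this.trans (mul_le_mul_of_nonneg_left (add_le_add le_rfl ?_) ht.1)
      have hwh : t / N ≤ w := hhδ.le.trans (min_le_left _ _)
      gcongr
    · obtain ⟨β, hβ1, hβ2, hβ3, hβ4⟩ := hq (b s) (hm s hs)
      refine ⟨β, hβ1, hβ2, fun r hr hrs => ?_⟩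
      have h3 := h1 s hs r hr (hrs.trans_lt (hhδ.trans_le
        ((min_le_right _ _).trans (min_le_left _ _))))
      exact ⟨fun x => (norm_sub_le_norm_sub_add_norm_sub _ (b s x) _).trans
          ((add_le_add (h3.1 x) (hβ3 x)).trans_eq (add_halves η)),
        fun x => (norm_sub_le_norm_sub_add_norm_sub _ (fderiv ℝ (b s) x) _).trans
          ((add_le_add (h3.2 x) (hβ4 x)).trans_eq (add_halves η))⟩
  have h1 : |(ζ t).1 hθ'.toCbField.toBdd| ≤ 0 := by
    refine le_of_forall_pos_le_add_mul (B := t * (2 * M * (n * Real.exp (3 * m * t))))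
      fun η hη => ?_
    obtain ⟨q, -, hq⟩ := key η hη
    refine le_of_forall_pos_le_add_mul
      (B := t * ((6 * q + 2 * M * q ^ 2) * (p * Real.exp (7 * q * t)))) fun w hw => ?_
    refine (hq w hw).trans_eq ?_
    ring
  exact abs_nonpos_iff.1 h1

/-- Weak solutions of the transport equation are unique: the difference of two solutions is a null
solution. -/
theorem IsLinearWeakSolution.unique {b : ℝ → CbField 2 d} {ξ₀ : Current d} {ξ η : ℝ → Current d}
    {T : ℝ} (hb : CbContinuousOn b (Icc 0 T)) (hT : 0 ≤ T)
    (hξ : IsLinearWeakSolution b ξ₀ (Icc 0 T) ξ) (hη : IsLinearWeakSolution b ξ₀ (Icc 0 T) η) :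
    EqOn ξ η (Icc 0 T) := by
  obtain ⟨C, hC⟩ := hξ.locallyBounded T (right_mem_Icc.2 hT)
  obtain ⟨C', hC'⟩ := hη.locallyBounded T (right_mem_Icc.2 hT)
  have hint : ∀ {ξ : ℝ → Current d}, IsLinearWeakSolution b ξ₀ (Icc 0 T) ξ →
      ∀ θ : CbField 1 d, ∀ t ∈ Icc 0 T,
        IntervalIntegrable (fun s => (ξ s).1 (advect θ (b s) + stretch (b s) θ)) volume 0 t ∧
        (ξ t).1 θ.toBdd =
          ξ₀.1 θ.toBdd + ∫ s in (0 : ℝ)..t, (ξ s).1 (advect θ (b s) + stretch (b s) θ) := by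
    intro ξ hξ θ t ht
    obtain ⟨h1, h2⟩ := hξ.integrable θ t ht
    have h3 := hξ.weak θ t ht
    simp only [map_add]
    refine ⟨h1.add h2, ?_⟩
    rw [intervalIntegral.integral_add h1 h2]
    linarith
  have hζ : IsNullSolution b T (C + C') (fun t => ξ t - η t) := by
    refine ⟨hξ.weaklyContinuous.sub hη.weaklyContinuous, fun t ht =>
      (norm_sub_le (ξ t) (η t)).trans (add_le_add (hC t ht) (hC' t ht)), fun θ t ht =>
      (hint hξ θ t ht).1.sub (hint hη θ t ht).1, fun θ t ht => ?_⟩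
    change (ξ t).1 θ.toBdd - (η t).1 θ.toBdd = ∫ s in (0 : ℝ)..t,
      ((ξ s).1 (advect θ (b s) + stretch (b s) θ) - (η s).1 (advect θ (b s) + stretch (b s) θ))
    rw [intervalIntegral.integral_sub (hint hξ θ t ht).1 (hint hη θ t ht).1, (hint hξ θ t ht).2,
      (hint hη θ t ht).2]
    ring
  intro t ht
  exact Subtype.ext (sub_eq_zero.1 (congrArg Subtype.val (hζ.eq_zero hb ht)))

/-- Weak solutions of the transport equation are transported by the flow, and conversely. -/
theorem isLinearWeakSolution_iff_isTransported {b : ℝ → CbField 2 d} {ξ₀ : Current d}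
    {ξ : ℝ → Current d} {T : ℝ} (hT : 0 ≤ T) (hb : CbContinuousOn b (Icc 0 T)) :
    IsLinearWeakSolution b ξ₀ (Icc 0 T) ξ ↔ IsTransported b ξ₀ (Icc 0 T) ξ := by
  refine ⟨fun h => ?_, fun h => h.isLinearWeakSolution hT hb⟩
  obtain ⟨U, V, hUV⟩ := exists_isJet hT hb
  have hη : IsTransported b ξ₀ (Icc 0 T) (fun t => jetCurrent ξ₀ (U t) (V t)) :=
    (hUV.isTransported_iff hT hb).2 fun _ _ => rfl
  exact (hUV.isTransported_iff hT hb).2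
    (h.unique hb hT (hη.isLinearWeakSolution hT hb))

end Uniqueness

/-! ### The flow equation as an autonomous differential equation -/

section Nonlinear

variable {d : ℕ} {B : Current d → CbField 2 d} {C_B : ℝ} {ξ₀ : Current d}

theorem weakNorm_le_norm (ξ : Current d) : weakNorm ξ ≤ ‖ξ‖ :=
  weakNorm_le fun θ L _ h => (le_abs_self _).trans ((abs_current_apply_le ξ θ).trans
    (mul_le_of_le_one_right (norm_nonneg ξ) (by linarith [L.coe_nonneg])))

theorem IsDrift.nonneg (hB : IsDrift B C_B) : 0 ≤ C_B := by
  have h := (norm_nonneg _).trans ((hB.growth 0).norm_le 0)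
  rwa [weakNorm_zero, zero_add, mul_one] at h

theorem IsDrift.cbContinuousOn (hB : IsDrift B C_B) {ξ : ℝ → Current d} {J : Set ℝ}
    (hξ : WeaklyContinuousOn ξ J) : CbContinuousOn (fun t => B (ξ t)) J := by
  intro t ht ε hε
  obtain ⟨δ, hδ, h⟩ := hB.continuous (ξ t) ε hε
  filter_upwards [(hξ t ht).eventually (gt_mem_nhds hδ)] with s hs using h _ hs

/-- The vector field `(U, V) ↦ (b(id + U), Db(id + U) V)` with `b = B(φ_♯ ξ₀)`, whose solutions are
the displacements and the Jacobians of the flows that solve the flow equation. -/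
noncomputable def jetVectorField (B : Current d → CbField 2 d) (ξ₀ : Current d)
    (Y : (Euc d →ᵇ Euc d) × Jac d) : (Euc d →ᵇ Euc d) × Jac d :=
  (along (B (jetCurrent ξ₀ Y.1 Y.2)).toBdd Y.1, along (B (jetCurrent ξ₀ Y.1 Y.2)).jac Y.1 * Y.2)

theorem lipschitzOnBounded_jetVectorField (hB : IsDrift B C_B) (ξ₀ : Current d) :
    LipschitzOnBounded (jetVectorField B ξ₀) := by
  intro R
  have hC := hB.nonneg
  -- `W` bounds the drift in `C_b^2`, and `e` is a Lipschitz constant of its value and Jacobian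
  -- along the displacement, over the ball of radius `R`.
  set W : ℝ := C_B * (‖ξ₀‖ * |R| + 1) with hW
  set e : ℝ := W + C_B * (‖ξ₀‖ * (1 + |R|)) with he
  have hN : 0 ≤ ‖ξ₀‖ := norm_nonneg ξ₀
  have hW0 : 0 ≤ W := by positivity
  have he0 : 0 ≤ e := by positivity
  refine ⟨Real.toNNReal (W + e * (1 + |R|)), LipschitzOnWith.of_dist_le_mul fun Y hY Y' hY' => ?_⟩
  rw [Real.coe_toNNReal _ (by positivity)]
  rw [mem_closedBall_zero_iff] at hY hY'
  have hV : ‖Y.2‖ ≤ |R| := (norm_snd_le Y).trans (hY.trans (le_abs_self R))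
  have hV' : ‖Y'.2‖ ≤ |R| := (norm_snd_le Y').trans (hY'.trans (le_abs_self R))
  have hdU : ‖Y.1 - Y'.1‖ ≤ dist Y Y' := by
    rw [dist_eq_norm]; exact norm_fst_le (Y - Y')
  have hdV : ‖Y.2 - Y'.2‖ ≤ dist Y Y' := by
    rw [dist_eq_norm]; exact norm_snd_le (Y - Y')
  set ξ := jetCurrent ξ₀ Y.1 Y.2
  set ξ' := jetCurrent ξ₀ Y'.1 Y'.2
  have hb : CbNormLE 2 (B ξ) W := (hB.growth ξ).mono (by
    have : weakNorm ξ ≤ ‖ξ₀‖ * |R| := (weakNorm_le_norm ξ).trans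
      ((norm_jetCurrent_le _ _ _).trans (mul_le_mul_of_nonneg_left hV hN))
    rw [hW]
    gcongr)
  have hD : weakNorm (ξ - ξ') ≤ ‖ξ₀‖ * (1 + |R|) * dist Y Y' := by
    refine (weakNorm_jetCurrent_sub_le ξ₀ Y.1 Y'.1 Y.2 Y'.2).trans ?_
    rw [mul_assoc, one_add_mul]
    gcongr
  have hCD : C_B * weakNorm (ξ - ξ') ≤ C_B * (‖ξ₀‖ * (1 + |R|)) * dist Y Y' := by
    rw [mul_assoc]; exact mul_le_mul_of_nonneg_left hD hC
  have hWU : W * ‖Y.1 - Y'.1‖ ≤ W * dist Y Y' := mul_le_mul_of_nonneg_left hdU hW0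
  have h1 : dist (along (B ξ).toBdd Y.1) (along (B ξ').toBdd Y'.1) ≤ e * dist Y Y' := by
    refine (dist_along_le hW0 (CbField.dist_toBdd_le hb) (fun x => by
      rw [dist_eq_norm]; exact hB.lipschitz ξ ξ' x) Y.1 Y'.1).trans ?_
    rw [he, add_mul]
    exact add_le_add hWU hCD
  have h2 : dist (along (B ξ).jac Y.1) (along (B ξ').jac Y'.1) ≤ e * dist Y Y' := by
    refine (dist_along_le hW0 (CbField.dist_jac_le hb) (fun x => by
      rw [dist_eq_norm]; exact hB.lipschitz_fderiv ξ ξ' x) Y.1 Y'.1).trans ?_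
    rw [he, add_mul]
    exact add_le_add hWU hCD
  have h3 : dist (along (B ξ).jac Y.1 * Y.2) (along (B ξ').jac Y'.1 * Y'.2) ≤
      W * dist Y Y' + e * dist Y Y' * |R| := by
    rw [dist_eq_norm] at h2 ⊢
    have : along (B ξ).jac Y.1 * Y.2 - along (B ξ').jac Y'.1 * Y'.2 =
        along (B ξ).jac Y.1 * (Y.2 - Y'.2) +
          (along (B ξ).jac Y.1 - along (B ξ').jac Y'.1) * Y'.2 := by
      rw [mul_sub, sub_mul]; abel
    rw [this]
    exact (norm_add_le _ _).trans (add_le_add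
      ((norm_mul_le _ _).trans (mul_le_mul (norm_along_jac_le hb _) hdV (norm_nonneg _) hW0))
      ((norm_mul_le _ _).trans (mul_le_mul h2 hV' (norm_nonneg _) (by positivity))))
  rw [Prod.dist_eq]
  have hWd : 0 ≤ W * dist Y Y' := by positivity
  have heR : 0 ≤ e * dist Y Y' * |R| := by positivity
  have hed : 0 ≤ e * dist Y Y' := by positivity
  have hsum : (W + e * (1 + |R|)) * dist Y Y' =
      W * dist Y Y' + e * dist Y Y' * |R| + e * dist Y Y' := by ring
  rw [hsum]
  exact max_le (h1.trans (by linarith)) (h3.trans (by linarith))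

theorem hasDerivWithinAt_fst {F G : Type*} [NormedAddCommGroup F] [NormedSpace ℝ F]
    [NormedAddCommGroup G] [NormedSpace ℝ G] {Y : ℝ → F × G} {y : F × G} {J : Set ℝ} {t : ℝ}
    (h : HasDerivWithinAt Y y J t) : HasDerivWithinAt (fun s => (Y s).1) y.1 J t :=
  (ContinuousLinearMap.fst ℝ F G).hasFDerivAt.comp_hasDerivWithinAt (f := Y) t h

theorem hasDerivWithinAt_snd {F G : Type*} [NormedAddCommGroup F] [NormedSpace ℝ F]
    [NormedAddCommGroup G] [NormedSpace ℝ G] {Y : ℝ → F × G} {y : F × G} {J : Set ℝ} {t : ℝ}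
    (h : HasDerivWithinAt Y y J t) : HasDerivWithinAt (fun s => (Y s).2) y.2 J t :=
  (ContinuousLinearMap.snd ℝ F G).hasFDerivAt.comp_hasDerivWithinAt (f := Y) t h

/-- Solutions of the flow equation correspond to solutions of an autonomous ordinary differential
equation in the Banach space of displacements and Jacobians. -/
theorem isFlowSolution_iff (hB : IsDrift B C_B) {T : ℝ} (hT : 0 ≤ T) {ξ : ℝ → Current d} :
    IsFlowSolution B ξ₀ (Icc 0 T) ξ ↔ ∃ Y : ℝ → (Euc d →ᵇ Euc d) × Jac d, Y 0 = (0, 1) ∧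
      SolvesODE (fun _ => jetVectorField B ξ₀) (Icc 0 T) Y ∧
      ∀ t ∈ Icc 0 T, ξ t = jetCurrent ξ₀ (Y t).1 (Y t).2 := by
  constructor
  · intro h
    have hb := hB.cbContinuousOn h.weaklyContinuous
    obtain ⟨U, V, hUV⟩ := exists_isJet hT hb
    have hξ := (hUV.isTransported_iff hT hb).1 h
    refine ⟨fun t => (U t, V t), Prod.ext hUV.init_fst hUV.init_snd, fun t ht => ?_, hξ⟩
    have h1 := (hUV.fst t ht).prodMk (hUV.snd t ht)
    simp only [hξ t ht] at h1
    exact h1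
  · rintro ⟨Y, hY0, hY, hξ⟩
    have hc : ContinuousOn Y (Icc 0 T) := hY.continuousOn
    have hw : WeaklyContinuousOn ξ (Icc 0 T) :=
      (weaklyContinuousOn_jetCurrent ξ₀ (continuous_fst.comp_continuousOn hc)
        (continuous_snd.comp_continuousOn hc)).congr hξ
    have hUV : IsJet (fun t => B (ξ t)) (Icc 0 T) (fun t => (Y t).1) (fun t => (Y t).2) := by
      refine ⟨by rw [hY0], by rw [hY0], fun t ht => ?_, fun t ht => ?_⟩
      · simp only [hξ t ht]
        exact hasDerivWithinAt_fst (hY t ht)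
      · simp only [hξ t ht]
        exact hasDerivWithinAt_snd (hY t ht)
    exact (hUV.isTransported_iff hT (hB.cbContinuousOn hw)).2 hξ

theorem IsFlowSolution.unique (hB : IsDrift B C_B) {T : ℝ} (hT : 0 ≤ T) {ξ η : ℝ → Current d}
    (hξ : IsFlowSolution B ξ₀ (Icc 0 T) ξ) (hη : IsFlowSolution B ξ₀ (Icc 0 T) η) :
    EqOn ξ η (Icc 0 T) := by
  obtain ⟨Y, hY0, hY, hξY⟩ := (isFlowSolution_iff hB hT).1 hξ
  obtain ⟨Z, hZ0, hZ, hηZ⟩ := (isFlowSolution_iff hB hT).1 hη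
  intro t ht
  rw [hξY t ht, hηZ t ht,
    (lipschitzOnBounded_jetVectorField hB ξ₀).unique hY hZ (hY0.trans hZ0.symm) ht]

theorem exists_isFlowSolution (hB : IsDrift B C_B) (ξ₀ : Current d) :
    ∃ T > 0, ∃ ξ, IsFlowSolution B ξ₀ (Icc 0 T) ξ := by
  obtain ⟨δ, hδ, Y, hY0, hY⟩ :=
    (lipschitzOnBounded_jetVectorField hB ξ₀).exists_solvesODE 0 (0, 1)
  rw [zero_add] at hY
  exact ⟨δ, hδ, fun t => jetCurrent ξ₀ (Y t).1 (Y t).2,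
    (isFlowSolution_iff hB hδ.le).2 ⟨Y, hY0, hY, fun _ _ => rfl⟩⟩

/-- Every solution on a compact interval extends to a longer one, as the differential equation can
be solved anew from the final displacement and Jacobian. -/
theorem IsFlowSolution.exists_extension (hB : IsDrift B C_B) {T : ℝ} (hT : 0 ≤ T)
    {ξ : ℝ → Current d} (hξ : IsFlowSolution B ξ₀ (Icc 0 T) ξ) :
    ∃ T' > T, ∃ η, IsFlowSolution B ξ₀ (Icc 0 T') η := by
  obtain ⟨Y, hY0, hY, -⟩ := (isFlowSolution_iff hB hT).1 hξ
  obtain ⟨δ, hδ, Z, hZ0, hZ⟩ :=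
    (lipschitzOnBounded_jetVectorField hB ξ₀).exists_solvesODE T (Y T)
  obtain ⟨X, hX, hX'⟩ := hY.glue hT (by linarith) hZ hZ0.symm
  exact ⟨T + δ, by linarith, fun t => jetCurrent ξ₀ (X t).1 (X t).2,
    (isFlowSolution_iff hB (by linarith)).2
      ⟨X, (hX (left_mem_Icc.2 hT)).trans hY0, hX', fun _ _ => rfl⟩⟩

theorem isPDESolution_iff_isFlowSolution (hB : IsDrift B C_B) {T : ℝ} (hT : 0 ≤ T)
    {ξ : ℝ → Current d} :
    IsPDESolution B ξ₀ (Icc 0 T) ξ ↔ IsFlowSolution B ξ₀ (Icc 0 T) ξ :=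
  ⟨fun h => (isLinearWeakSolution_iff_isTransported hT
      (hB.cbContinuousOn h.weaklyContinuous)).1 h,
    fun h => (isLinearWeakSolution_iff_isTransported hT
      (hB.cbContinuousOn h.weaklyContinuous)).2 h⟩

end Nonlinear

/-! ### Maximal solutions -/

section Maximal

variable {d : ℕ}

theorem IsFlow.mono {b : ℝ → CbField 2 d} {J J' : Set ℝ} {φ : ℝ → C1Map d} (h : IsFlow b J φ)
    (hJ : J' ⊆ J) : IsFlow b J' φ :=
  ⟨h.1, fun t ht x => (h.2 t (hJ ht) x).mono hJ⟩

theorem IsTransported.mono {b : ℝ → CbField 2 d} {ξ₀ : Current d} {J J' : Set ℝ}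
    {ξ : ℝ → Current d} (h : IsTransported b ξ₀ J ξ) (hJ : J' ⊆ J) : IsTransported b ξ₀ J' ξ := by
  obtain ⟨hw, φ, hφ, hξ⟩ := h
  exact ⟨hw.mono hJ, φ, hφ.mono hJ, fun t ht => hξ t (hJ ht)⟩

theorem IsLinearWeakSolution.mono {b : ℝ → CbField 2 d} {ξ₀ : Current d} {J J' : Set ℝ}
    {ξ : ℝ → Current d} (h : IsLinearWeakSolution b ξ₀ J ξ) (hJ : J' ⊆ J) :
    IsLinearWeakSolution b ξ₀ J' ξ :=
  ⟨h.weaklyContinuous.mono hJ, fun t ht => h.locallyBounded t (hJ ht),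
    fun θ t ht => h.integrable θ t (hJ ht), fun θ t ht => h.weak θ t (hJ ht)⟩

/-- Compact intervals `[0, T]` are neighbourhoods in `[0, τ)` of their points `t < T`. -/
theorem exists_nhdsWithin_timeInterval_le {τ : EReal} {t : ℝ} (ht : t ∈ timeInterval τ) :
    ∃ T : ℝ, 0 ≤ T ∧ (T : EReal) < τ ∧ t ∈ Icc 0 T ∧ 𝓝[timeInterval τ] t ≤ 𝓝[Icc 0 T] t := by
  obtain ⟨T, htT, hT⟩ := EReal.lt_iff_exists_real_btwn.1 ht.2
  have htT' : t < T := EReal.coe_lt_coe_iff.1 htT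
  refine ⟨T, ht.1.trans htT'.le, hT, ⟨ht.1, htT'.le⟩, ?_⟩
  refine le_inf nhdsWithin_le_nhds (le_principal_iff.2 ?_)
  filter_upwards [self_mem_nhdsWithin, nhdsWithin_le_nhds (Iio_mem_nhds htT')] with s hs hsT
  exact ⟨hs.1, hsT.le⟩

theorem WeaklyContinuousOn.of_Icc {ξ : ℝ → Current d} {τ : EReal}
    (h : ∀ T : ℝ, 0 ≤ T → (T : EReal) < τ → WeaklyContinuousOn ξ (Icc 0 T)) :
    WeaklyContinuousOn ξ (timeInterval τ) := by
  intro t ht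
  obtain ⟨T, hT0, hT, htT, hle⟩ := exists_nhdsWithin_timeInterval_le ht
  exact (h T hT0 hT t htT).mono_left hle

theorem IsLinearWeakSolution.of_Icc {b : ℝ → CbField 2 d} {ξ₀ : Current d} {ξ : ℝ → Current d}
    {τ : EReal}
    (h : ∀ T : ℝ, 0 ≤ T → (T : EReal) < τ → IsLinearWeakSolution b ξ₀ (Icc 0 T) ξ) :
    IsLinearWeakSolution b ξ₀ (timeInterval τ) ξ :=
  ⟨WeaklyContinuousOn.of_Icc fun T hT0 hT => (h T hT0 hT).weaklyContinuous,
    fun t ht => (h t ht.1 ht.2).locallyBounded t (right_mem_Icc.2 ht.1),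
    fun θ t ht => (h t ht.1 ht.2).integrable θ t (right_mem_Icc.2 ht.1),
    fun θ t ht => (h t ht.1 ht.2).weak θ t (right_mem_Icc.2 ht.1)⟩

theorem IsFlow.unique {b : ℝ → CbField 2 d} {T : ℝ} (hT : 0 ≤ T) (hb : CbContinuousOn b (Icc 0 T))
    {φ ψ : ℝ → C1Map d} (hφ : IsFlow b (Icc 0 T) φ) (hψ : IsFlow b (Icc 0 T) ψ) {t : ℝ}
    (ht : t ∈ Icc 0 T) (x : Euc d) : φ t x = ψ t x := by
  obtain ⟨U, V, hUV⟩ := exists_isJet hT hb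
  rw [(hUV.fderiv_flow hb hφ ht).1 x, (hUV.fderiv_flow hb hψ ht).1 x]

/-- The flows on the compact subintervals are restrictions of one flow on `[0, τ)`. -/
theorem IsTransported.of_Icc {b : ℝ → CbField 2 d} {ξ₀ : Current d} {ξ : ℝ → Current d}
    {τ : EReal} (hτ : 0 < τ)
    (hb : ∀ T : ℝ, 0 ≤ T → (T : EReal) < τ → CbContinuousOn b (Icc 0 T))
    (h : ∀ T : ℝ, 0 ≤ T → (T : EReal) < τ → IsTransported b ξ₀ (Icc 0 T) ξ) :
    IsTransported b ξ₀ (timeInterval τ) ξ := by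
  refine ⟨WeaklyContinuousOn.of_Icc fun T hT0 hT => (h T hT0 hT).weaklyContinuous, ?_⟩
  have hex : ∀ T : ℝ, 0 ≤ T → (T : EReal) < τ → ∃ φ : ℝ → C1Map d, IsFlow b (Icc 0 T) φ ∧
      ∀ t ∈ Icc 0 T, ξ t = pushCurrent (φ t) ξ₀ := fun T hT0 hT => (h T hT0 hT).push
  have : Nonempty (ℝ → C1Map d) := ⟨(hex 0 le_rfl hτ).choose⟩
  choose! Φ hΦ hΦξ using hex
  have heq : ∀ T : ℝ, (T : EReal) < τ → ∀ s ∈ Icc 0 T, ∀ x, Φ s s x = Φ T s x := by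
    intro T hT s hs x
    have hsτ : (s : EReal) < τ := lt_of_le_of_lt (EReal.coe_le_coe_iff.2 hs.2) hT
    exact IsFlow.unique hs.1 (hb s hs.1 hsτ) (hΦ s hs.1 hsτ)
      ((hΦ T (hs.1.trans hs.2) hT).mono (Icc_subset_Icc_right hs.2)) (right_mem_Icc.2 hs.1) x
  refine ⟨fun t => Φ t t, ⟨(hΦ 0 le_rfl hτ).1, fun t ht x => ?_⟩,
    fun t ht => hΦξ t ht.1 ht.2 t (right_mem_Icc.2 ht.1)⟩
  obtain ⟨T, hT0, hT, htT, hle⟩ := exists_nhdsWithin_timeInterval_le ht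
  have h1 := (hΦ T hT0 hT).2 t htT x
  have h2 : HasDerivWithinAt (fun s => Φ s s x) (b t (Φ t t x)) (Icc 0 T) t := by
    rw [heq T hT t htT x]
    exact h1.congr (fun s hs => heq T hT s hs x) (heq T hT t htT x)
  exact h2.mono_of_mem_nhdsWithin (hle self_mem_nhdsWithin)

/-- If solutions are unique and every solution on a compact interval extends to a longer one, then
the solutions on compact intervals are the restrictions of one function to the intervals `[0, T]`
with `T` less than the lifespan. -/
theorem exists_maximal {Sol : Set ℝ → (ℝ → Current d) → Prop}
    (hmono : ∀ {T T' : ℝ} {ξ}, T' ≤ T → Sol (Icc 0 T) ξ → Sol (Icc 0 T') ξ)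
    (hcongr : ∀ {T : ℝ} {ξ η}, EqOn η ξ (Icc 0 T) → Sol (Icc 0 T) ξ → Sol (Icc 0 T) η)
    (huniq : ∀ {T : ℝ} {ξ η}, 0 ≤ T → Sol (Icc 0 T) ξ → Sol (Icc 0 T) η → EqOn ξ η (Icc 0 T))
    (hex : ∃ T : ℝ, 0 < T ∧ ∃ ξ, Sol (Icc 0 T) ξ)
    (hext : ∀ {T : ℝ} {ξ}, 0 ≤ T → Sol (Icc 0 T) ξ → ∃ T' > T, ∃ η, Sol (Icc 0 T') η) :
    ∃ ξ, 0 < lifespan Sol ∧ (∀ T : ℝ, 0 ≤ T → (T : EReal) < lifespan Sol → Sol (Icc 0 T) ξ) ∧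
      ∀ T : ℝ, 0 ≤ T → ∀ η, Sol (Icc 0 T) η → (T : EReal) < lifespan Sol ∧ EqOn η ξ (Icc 0 T) := by
  have hle : ∀ {T : ℝ} {ξ}, 0 < T → Sol (Icc 0 T) ξ → (T : EReal) ≤ lifespan Sol :=
    fun {T ξ} hT h => le_sSup ⟨T, hT, ⟨ξ, h, fun η hη => huniq hT.le hη h⟩, rfl⟩
  have hlt : ∀ {T : ℝ} {ξ}, 0 ≤ T → Sol (Icc 0 T) ξ → (T : EReal) < lifespan Sol := by
    intro T ξ hT h
    obtain ⟨T', hTT', η, hη⟩ := hext hT h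
    exact (EReal.coe_lt_coe_iff.2 hTT').trans_le (hle (hT.trans_lt hTT') hη)
  have hsol : ∀ T : ℝ, (T : EReal) < lifespan Sol → ∃ ξ, Sol (Icc 0 T) ξ := by
    intro T hT
    obtain ⟨τ, ⟨T', -, ⟨ξ, hξ, -⟩, rfl⟩, hTT'⟩ := lt_sSup_iff.1 hT
    exact ⟨ξ, hmono (EReal.coe_le_coe_iff.1 hTT'.le) hξ⟩
  -- By uniqueness, the value at time `t` may be read off the solution on `[0, t]`.
  choose! Ξ hΞ using hsol
  have heq : ∀ {T : ℝ} {η}, 0 ≤ T → Sol (Icc 0 T) η → EqOn η (fun t => Ξ t t) (Icc 0 T) := by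
    intro T η hT h t ht
    have hη := hmono ht.2 h
    exact huniq ht.1 hη (hΞ t (hlt ht.1 hη)) (right_mem_Icc.2 ht.1)
  obtain ⟨T₀, hT₀, ξ, hξ⟩ := hex
  refine ⟨fun t => Ξ t t, (EReal.coe_pos.2 hT₀).trans (hlt hT₀.le hξ),
    fun T hT0 hT => hcongr (heq hT0 (hΞ T hT)).symm (hΞ T hT),
    fun T hT η hη => ⟨hlt hT hη, heq hT hη⟩⟩

/-- A function that restricts to the unique solution on all compact intervals shorter than `τ`, and
only on those, is the maximal solution. -/
theorem isMaximalSolution_of_Icc {Sol : Set ℝ → (ℝ → Current d) → Prop} {τ : EReal}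
    {ξ : ℝ → Current d} (hτ : 0 < τ) (hξ : Sol (timeInterval τ) ξ)
    (hmono : ∀ {J J' : Set ℝ} {η}, J' ⊆ J → Sol J η → Sol J' η)
    (hmax : ∀ T : ℝ, 0 ≤ T → ∀ η, Sol (Icc 0 T) η → (T : EReal) < τ ∧ EqOn η ξ (Icc 0 T)) :
    IsMaximalSolution Sol τ ξ := by
  refine ⟨hτ, hξ, fun J hJ h0 hJ0 η hη => ?_⟩
  have h : ∀ t ∈ J, (t : EReal) < τ ∧ EqOn η ξ (Icc 0 t) := fun t ht =>
    hmax t (hJ0 ht) η (hmono (hJ.out h0 ht) hη)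
  exact ⟨fun t ht => ⟨hJ0 ht, (h t ht).1⟩,
    fun t ht => (h t ht).2 (right_mem_Icc.2 (hJ0 ht))⟩

end Maximal

theorem mainTheorem2 {d : ℕ} (B : Current d → CbField 2 d) (C_B : ℝ) (hB : IsDrift B C_B)
    (hdiv : ∀ ξ, DivergenceFree (B ξ)) (ξ₀ : Current d) :
    (∃ T : ℝ, 0 < T ∧ UniquelySolvable (IsPDESolution B ξ₀) T) ∧
    (∃ ξ : ℝ → Current d,
      IsMaximalSolution (IsPDESolution B ξ₀) (lifespan (IsFlowSolution B ξ₀)) ξ ∧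
      IsMaximalSolution (IsFlowSolution B ξ₀) (lifespan (IsFlowSolution B ξ₀)) ξ) ∧
    (∀ (T : ℝ) (b : ℝ → CbField 2 d), 0 < T → CbContinuousOn b (Icc 0 T) →
      ∀ ξ : ℝ → Current d,
        IsLinearWeakSolution b ξ₀ (Icc 0 T) ξ ↔ IsTransported b ξ₀ (Icc 0 T) ξ) := by
  refine ⟨?_, ?_, fun T b hT hb ξ => isLinearWeakSolution_iff_isTransported hT.le hb⟩
  · obtain ⟨T, hT, ξ, hξ⟩ := exists_isFlowSolution hB ξ₀
    exact ⟨T, hT, ξ, (isPDESolution_iff_isFlowSolution hB hT.le).2 hξ, fun η hη =>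
      IsFlowSolution.unique hB hT.le ((isPDESolution_iff_isFlowSolution hB hT.le).1 hη) hξ⟩
  · have hcongr : ∀ {T : ℝ} {ξ η : ℝ → Current d}, EqOn η ξ (Icc 0 T) →
        IsFlowSolution B ξ₀ (Icc 0 T) ξ → IsFlowSolution B ξ₀ (Icc 0 T) η := by
      intro T ξ η he h
      obtain ⟨hw, φ, hφ, hξ⟩ := h
      refine ⟨hw.congr he, φ, ⟨hφ.1, fun t ht x => ?_⟩, fun t ht => (he ht).trans (hξ t ht)⟩
      simp only [he ht]
      exact hφ.2 t ht x
    obtain ⟨ξ, hpos, hsol, hmax⟩ := exists_maximal (Sol := IsFlowSolution B ξ₀)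
      (fun hT h => IsTransported.mono h (Icc_subset_Icc_right hT)) hcongr
      (fun hT => IsFlowSolution.unique hB hT) (exists_isFlowSolution hB ξ₀)
      (fun hT h => h.exists_extension hB hT)
    refine ⟨ξ, isMaximalSolution_of_Icc hpos ?_ (fun hJ h => IsLinearWeakSolution.mono h hJ) ?_,
      isMaximalSolution_of_Icc hpos ?_ (fun hJ h => IsTransported.mono h hJ) hmax⟩
    · exact IsLinearWeakSolution.of_Icc fun T hT0 hT =>
        (isPDESolution_iff_isFlowSolution hB hT0).2 (hsol T hT0 hT)
    · exact fun T hT η hη => hmax T hT η ((isPDESolution_iff_isFlowSolution hB hT).1 hη)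
    · exact IsTransported.of_Icc hpos
        (fun T hT0 hT => hB.cbContinuousOn (hsol T hT0 hT).weaklyContinuous) hsol
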